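/- Let $\mathbf k$ be a field of characteristic zero, $V=\bigoplus_{i\in\mathbb Z}V_i$ a finite-dimensional graded $\mathbf k$-vector space and $B:V\otimes V\to\mathbf k$ a graded symmetric nondegenerate bilinear form of degree $+3$ (so $B(u,v)=0$ unless $|u|+|v|=-3$). Let $\{h_s\}$ be a homogeneous basis of $V$ and $\{h^s\}$ the dual basis, $B(h^s,h_t)=\delta_{st}$. In signs, an element stands for its degree; $\epsilon(\sigma)$ is the Koszul sign of a permutation $\sigma$ of homogeneous elements, defined by $x_1\cdots x_n=\epsilon(\sigma)\,x_{\sigma(1)}\cdots x_{\sigma(n)}$ in the free graded commutative algebra, and $\chi(\sigma)=\mathrm{sgn}(\sigma)\,\epsilon(\sigma)$. **Loop homotopy Lie algebras.** A *loop homotopy Lie algebra structure* on $(V,B)$ is a family of graded antisymmetric multilinear maps $l^g_n:V^{\otimes n}\to V$ of degree $n-2$ ($g,n\ge 0$) such that (A1) for all $g,n\ge0$ and homogeneous $v_1,\dots,v_n\in V$ (with $l^{-1}_n:=0$) $$0=\sum_{\substack{k+l=n+1\\ g_1+g_2=g}}\ \sum_{\sigma\in \mathrm{unsh}(l,n-l)}\chi(\sigma)(-1)^{l(k-1)}\,l^{g_1}_k\big(l^{g_2}_l(v_{\sigma(1)},\dots,v_{\sigma(l)}),v_{\sigma(l+1)},\dots,v_{\sigma(n)}\big)+\tfrac12\sum_s(-1)^{h_s+n}\,l^{g-1}_{n+2}(h_s,h^s,v_1,\dots,v_n);$$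 (A2) for all $g\ge0$, $n\ge1$ and $v_1,\dots,v_{n-1}\in V$ the element $\sum_s(-1)^{(n+1)h_s}\,h_s\otimes l^g_n(h^s,v_1,\dots,v_{n-1})\in V\otimes V$ is graded symmetric. **Coderivations.** Let $W=\uparrow\! V$ be the suspension, $W_p=V_{p-1}$, and let ${}^c\!\wedge W$ be the free graded commutative algebra $\wedge W$ with the coproduct $$\Delta(w_1\cdots w_n)=\sum_{0\le i\le n}\ \sum_{\sigma\in\mathrm{unsh}(i,n-i)}\epsilon(\sigma)\,(w_{\sigma(1)}\cdots w_{\sigma(i)})\otimes(w_{\sigma(i+1)}\cdots w_{\sigma(n)}).$$ Let $\pi_n$ be the projection on $\wedge^nW$. Let $C={}^c\!\wedge W[t]={}^c\!\wedge W\otimes\mathbf k[t]$, a graded coalgebra over $\mathbf k[t]$ with $t$ in degree $0$; extend $\pi_n$ to $C$ linearly. For a $\mathbf k[t]$-linear endomorphism $\Omega$ of $C$ put $\Psi^1=\Omega$ and $$\Psi^{n+1}=(1^{\otimes(n-1)}\otimes\Delta)\Psi^n-(\Psi^n\otimes1)\Delta-T(\Psi^n\otimes 1)\Delta,$$ where $T$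 exchanges the last two tensor factors with the Koszul sign. Call $\Omega$ an *order $r$ coderivation* if $\Psi^{r+1}=0$; for $r=1$ this is an ordinary coderivation. Let $y=\sum_s(\uparrow\! h_s)(\uparrow\! h^s)\in\wedge^2W$. **Theorem.** There is a unique order $2$ coderivation $\theta$ of $C$ of degree $-1$ such that $\pi_1\theta=0$, $\pi_2\theta=0$ on $\wedge^nW[t]$ for $n>0$, and $\pi_2\theta(1)=\tfrac12\,t\,y$. For a degree $-1$ ordinary coderivation $\delta$ of $C$ let $\delta^g_n(w_1\cdots w_n)\in W$ be the coefficient of $t^g$ in $\pi_1\delta(w_1\cdots w_n)$. The formula $$l^g_n(v_1,\dots,v_n)=(-1)^{(n-1)v_1+(n-2)v_2+\cdots+v_{n-1}}\downarrow\!\delta^g_n(\uparrow\! v_1\cdots\uparrow\! v_n)$$ defines a one-to-one correspondence between degree $-1$ coderivations $\delta$ of $C$ with $$(\delta+\theta)^2=0$$ and the loop homotopy Lie algebra structures on $(V,B)$ such that, for every $n$, only finitely many of the operations $l^g_n$, $g\ge0$, are nonzero. More precisely, the formula is a bijection between all degree $-1$ coderivations $\delta$ of $C$ and all families of graded antisymmetric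 operations $l^g_n$ of degree $n-2$ with this finiteness property. Under it, $\pi_1(\delta+\theta)^2=0$ is equivalent to (A1); when (A1) holds, $\pi_2(\delta+\theta)^2=0$ is equivalent to (A2); and $(\delta+\theta)^2=0$ is equivalent to (A1) and (A2) together. Moreover $\delta(1)=0$ if and only if $l^g_0=0$ for all $g$. If $\mathbf k[t]$ is replaced by the ring of formal power series $\mathbf k[[t]]$ throughout (with $C={}^c\!\wedge W\otimes_{\mathbf k}\mathbf k[[t]]$), all of this holds without the finiteness condition; in particular, all loop homotopy Lie algebra structures on $(V,B)$ then correspond to the coderivations $\delta$ with $(\delta+\theta)^2=0$. -/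

import Mathlib

open scoped TensorProduct DirectSum

noncomputable section

namespace LoopLie

/-! ### Graded vector spaces, suspension, Koszul signs -/

section Graded

/-- The sign `(-1)^p` on the degree `p` part, as a linear endomorphism of a graded space. -/
def signMap {k V : Type*} [Field k] [AddCommGroup V] [Module k V]
    (𝒲 : ℤ → Submodule k V) [DirectSum.Decomposition 𝒲] : V →ₗ[k] V :=
  DirectSum.toModule k ℤ V (fun p => (p.negOnePow : ℤ) • (𝒲 p).subtype) ∘ₗ
    (DirectSum.decomposeLinearEquiv 𝒲).toLinearMap

/-- The projection on the odd part, `(1 - P) / 2`, where `P` is the operator `(-1)^degree`. -/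
def oddProj {k M : Type*} [Field k] [AddCommGroup M] [Module k M] (P : M →ₗ[k] M) : M →ₗ[k] M :=
  (2 : k)⁻¹ • (LinearMap.id - P)

/-- The Koszul flip `x ⊗ y ↦ (-1)^(|x||y|) y ⊗ x`, written by means of the projection `o` on the odd
part: it is the ordinary flip, with a minus sign on `odd ⊗ odd`. -/
def gradedSwap {R M : Type*} [CommRing R] [AddCommGroup M] [Module R M] (o : M →ₗ[R] M) :
    M ⊗[R] M →ₗ[R] M ⊗[R] M :=
  (TensorProduct.comm R M M).toLinearMap ∘ₗ
    (LinearMap.id - (2 : R) • TensorProduct.map o o)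

/-- The suspension `W = ↑V`, `W_p = V_{p-1}`. The underlying vector space of `↑V` is that of `V`,
and the map `↑ : V → ↑V` is the identity. -/
def susp {k V : Type*} [Field k] [AddCommGroup V] [Module k V] (𝒱 : ℤ → Submodule k V) :
    ℤ → Submodule k V := fun p => 𝒱 (p - 1)

instance suspDecomposition {k V : Type*} [Field k] [AddCommGroup V] [Module k V]
    (𝒱 : ℤ → Submodule k V) [DirectSum.Decomposition 𝒱] : DirectSum.Decomposition (susp 𝒱) :=
  DirectSum.IsInternal.chooseDecomposition _ (by
    have h := DirectSum.Decomposition.isInternal 𝒱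
    rw [DirectSum.isInternal_submodule_iff_iSupIndep_and_iSup_eq_top] at h ⊢
    refine ⟨h.1.comp (f := fun p : ℤ => p - 1) (fun a b hab => by simpa using hab), ?_⟩
    rw [← h.2]
    exact (Equiv.subRight (1 : ℤ)).iSup_comp (g := 𝒱))

theorem signMap_of_mem {k V : Type*} [Field k] [AddCommGroup V] [Module k V]
    (𝒲 : ℤ → Submodule k V) [DirectSum.Decomposition 𝒲] {p : ℤ} {x : V} (hx : x ∈ 𝒲 p) :
    signMap 𝒲 x = (p.negOnePow : ℤ) • x := by
  simp only [signMap, LinearMap.comp_apply, LinearEquiv.coe_coe,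
    DirectSum.decomposeLinearEquiv_apply, DirectSum.decompose_of_mem 𝒲 hx]
  erw [DirectSum.toModule_lof]
  rfl

theorem oddProj_signMap_of_even {k V : Type*} [Field k] [AddCommGroup V] [Module k V]
    (𝒲 : ℤ → Submodule k V) [DirectSum.Decomposition 𝒲] {p : ℤ} {x : V} (hx : x ∈ 𝒲 p)
    (hp : Even p) : oddProj (signMap 𝒲) x = 0 := by
  simp [oddProj, signMap_of_mem 𝒲 hx, Int.negOnePow_even p hp]

theorem oddProj_signMap_of_odd {k V : Type*} [Field k] [CharZero k] [AddCommGroup V] [Module k V]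
    (𝒲 : ℤ → Submodule k V) [DirectSum.Decomposition 𝒲] {p : ℤ} {x : V} (hx : x ∈ 𝒲 p)
    (hp : Odd p) : oddProj (signMap 𝒲) x = x := by
  simp only [oddProj, LinearMap.smul_apply, LinearMap.sub_apply, LinearMap.id_apply,
    signMap_of_mem 𝒲 hx, Int.negOnePow_odd p hp]
  simp only [Units.val_neg, Units.val_one, neg_smul, one_smul, sub_neg_eq_add]
  rw [← two_smul k x, smul_smul, inv_mul_cancel₀ two_ne_zero, one_smul]

/-- The Koszul sign `ε(σ; x₁, …, xₙ)` for elements of degrees `d₁, …, dₙ`, defined by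
`x₁ ⋯ xₙ = ε(σ) x_{σ(1)} ⋯ x_{σ(n)}` in the free graded commutative algebra: every inversion
contributes the sign of the two factors that it exchanges. -/
def koszulSign {n : ℕ} (σ : Equiv.Perm (Fin n)) (d : Fin n → ℤ) : ℤˣ :=
  ∏ p ∈ (Finset.univ : Finset (Fin n × Fin n)).filter (fun p => p.1 < p.2 ∧ σ p.2 < σ p.1),
    (d (σ p.1) * d (σ p.2)).negOnePow

/-- `χ(σ) = sgn(σ) ε(σ)`. -/
def chi {n : ℕ} (σ : Equiv.Perm (Fin n)) (d : Fin n → ℤ) : ℤˣ :=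
  Equiv.Perm.sign σ * koszulSign σ d

/-- The `(l, n - l)`-unshuffles: `σ(1) < ⋯ < σ(l)` and `σ(l+1) < ⋯ < σ(n)`. -/
def unshuffles (l n : ℕ) : Finset (Equiv.Perm (Fin n)) :=
  Finset.univ.filter (fun σ =>
    (∀ i j : Fin n, i < j → (j : ℕ) < l → σ i < σ j) ∧
    (∀ i j : Fin n, i < j → l ≤ (i : ℕ) → σ i < σ j))

end Graded

/-! ### The free graded commutative algebra `∧W` -/

section FreeAlgebra

/-- Graded commutativity `x y = (-1)^(pq) y x` for generators of degrees `p` and `q`. -/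
inductive ExtRel {k V : Type*} [Field k] [AddCommGroup V] [Module k V] (𝒲 : ℤ → Submodule k V) :
    TensorAlgebra k V → TensorAlgebra k V → Prop
  | comm {p q : ℤ} {x y : V} (hx : x ∈ 𝒲 p) (hy : y ∈ 𝒲 q) :
      ExtRel 𝒲 (TensorAlgebra.ι k x * TensorAlgebra.ι k y)
        (((p * q).negOnePow : ℤ) • (TensorAlgebra.ι k y * TensorAlgebra.ι k x))

/-- The free graded commutative algebra `∧W` on the graded vector space `W`
(over a field of characteristic zero). -/
def Ext {k V : Type*} [Field k] [AddCommGroup V] [Module k V] (𝒲 : ℤ → Submodule k V) :=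
  RingQuot (ExtRel 𝒲)

instance {k V : Type*} [Field k] [AddCommGroup V] [Module k V] (𝒲 : ℤ → Submodule k V) :
    Ring (Ext 𝒲) := inferInstanceAs (Ring (RingQuot (ExtRel 𝒲)))

instance {k V : Type*} [Field k] [AddCommGroup V] [Module k V] (𝒲 : ℤ → Submodule k V) :
    Algebra k (Ext 𝒲) := inferInstanceAs (Algebra k (RingQuot (ExtRel 𝒲)))

/-- The quotient map from the tensor algebra to `∧W`. -/
def extMk {k V : Type*} [Field k] [AddCommGroup V] [Module k V] (𝒲 : ℤ → Submodule k V) :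
    TensorAlgebra k V →ₐ[k] Ext 𝒲 :=
  RingQuot.mkAlgHom k (ExtRel 𝒲)

/-- The inclusion of the generators, `W → ∧W`. -/
def gen {k V : Type*} [Field k] [AddCommGroup V] [Module k V] (𝒲 : ℤ → Submodule k V) :
    V →ₗ[k] Ext 𝒲 :=
  (extMk 𝒲).toLinearMap ∘ₗ TensorAlgebra.ι k

theorem gen_comm {k V : Type*} [Field k] [AddCommGroup V] [Module k V] (𝒲 : ℤ → Submodule k V)
    {p q : ℤ} {x y : V} (hx : x ∈ 𝒲 p) (hy : y ∈ 𝒲 q) :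
    gen 𝒲 x * gen 𝒲 y = ((p * q).negOnePow : ℤ) • (gen 𝒲 y * gen 𝒲 x) := by
  have h : extMk 𝒲 _ = extMk 𝒲 _ := RingQuot.mkAlgHom_rel k (ExtRel.comm (𝒲 := 𝒲) hx hy)
  rw [map_mul, map_zsmul, map_mul] at h
  exact h

/-- The universal property of `∧W`. -/
def extLift {k V S : Type*} [Field k] [AddCommGroup V] [Module k V] (𝒲 : ℤ → Submodule k V)
    [Ring S] [Algebra k S] (f : V →ₗ[k] S)
    (hf : ∀ (p q : ℤ) (x y : V), x ∈ 𝒲 p → y ∈ 𝒲 q →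
      f x * f y = ((p * q).negOnePow : ℤ) • (f y * f x)) : Ext 𝒲 →ₐ[k] S :=
  RingQuot.liftAlgHom k ⟨TensorAlgebra.lift k f, by
    rintro _ _ ⟨hx, hy⟩
    rw [map_mul, map_zsmul, map_mul]
    simpa using hf _ _ _ _ hx hy⟩

theorem extLift_gen {k V S : Type*} [Field k] [AddCommGroup V] [Module k V]
    (𝒲 : ℤ → Submodule k V) [Ring S] [Algebra k S] (f : V →ₗ[k] S)
    (hf : ∀ (p q : ℤ) (x y : V), x ∈ 𝒲 p → y ∈ 𝒲 q →
      f x * f y = ((p * q).negOnePow : ℤ) • (f y * f x)) (x : V) :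
    extLift 𝒲 f hf (gen 𝒲 x) = f x := by
  have h : extLift 𝒲 f hf (gen 𝒲 x) = TensorAlgebra.lift k f (TensorAlgebra.ι k x) :=
    RingQuot.liftAlgHom_mkAlgHom_apply k _ _ _
  rw [h, TensorAlgebra.lift_ι_apply]

/-- `∧ⁿW`, the span of the products of `n` generators. -/
def extPow {k V : Type*} [Field k] [AddCommGroup V] [Module k V] (𝒲 : ℤ → Submodule k V) (n : ℕ) :
    Submodule k (Ext 𝒲) :=
  Submodule.span k {a | ∃ x : Fin n → V, a = (List.ofFn fun i => gen 𝒲 (x i)).prod}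

/-- The part of `∧W` of total degree `p`. -/
def extDeg {k V : Type*} [Field k] [AddCommGroup V] [Module k V] (𝒲 : ℤ → Submodule k V) (p : ℤ) :
    Submodule k (Ext 𝒲) :=
  Submodule.span k {a | ∃ (n : ℕ) (x : Fin n → V) (d : Fin n → ℤ),
    (∀ i, x i ∈ 𝒲 (d i)) ∧ ∑ i, d i = p ∧ a = (List.ofFn fun i => gen 𝒲 (x i)).prod}

/-- The operator `(-1)^degree` on `∧W`, as an algebra automorphism. -/
def extSign {k V : Type*} [Field k] [AddCommGroup V] [Module k V] (𝒲 : ℤ → Submodule k V)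
    [DirectSum.Decomposition 𝒲] : Ext 𝒲 →ₐ[k] Ext 𝒲 :=
  extLift 𝒲 (gen 𝒲 ∘ₗ signMap 𝒲) (by
    intro p q x y hx hy
    simp only [LinearMap.comp_apply, signMap_of_mem 𝒲 hx, signMap_of_mem 𝒲 hy, map_zsmul,
      smul_mul_assoc, mul_smul_comm]
    rw [gen_comm 𝒲 hx hy]
    simp only [smul_smul]
    congr 1
    ring)

theorem extSign_gen {k V : Type*} [Field k] [AddCommGroup V] [Module k V]
    (𝒲 : ℤ → Submodule k V) [DirectSum.Decomposition 𝒲] (x : V) :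
    extSign 𝒲 (gen 𝒲 x) = gen 𝒲 (signMap 𝒲 x) := by
  simp [extSign, extLift_gen]

/-- The algebra homomorphism `∧W → (∧W)[z]`, `w ↦ w z`, that records the word length. -/
def extLength {k V : Type*} [Field k] [AddCommGroup V] [Module k V] (𝒲 : ℤ → Submodule k V) :
    Ext 𝒲 →ₐ[k] Polynomial (Ext 𝒲) :=
  extLift 𝒲 (((Polynomial.monomial 1 : Ext 𝒲 →ₗ[Ext 𝒲] Polynomial (Ext 𝒲)).restrictScalars k) ∘ₗ
      gen 𝒲) (by
    intro p q x y hx hy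
    simp only [LinearMap.comp_apply, LinearMap.restrictScalars_apply,
      Polynomial.monomial_mul_monomial]
    rw [gen_comm 𝒲 hx hy, map_zsmul])

/-- The projection `πₙ : ∧W → ∧ⁿW` along the other `∧ᵐW`, as an endomorphism of `∧W`. -/
def extProj {k V : Type*} [Field k] [AddCommGroup V] [Module k V] (𝒲 : ℤ → Submodule k V)
    (n : ℕ) : Ext 𝒲 →ₗ[k] Ext 𝒲 :=
  (Polynomial.lcoeff (Ext 𝒲) n).restrictScalars k ∘ₗ (extLength 𝒲).toLinearMap

end FreeAlgebra

/-! ### The coalgebra `ᶜ∧W` -/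

section Coalgebra

/-- Left multiplication by `w ⊗ 1 + 1 ⊗ w` on `∧W ⊗ ∧W`, with the Koszul sign:
`a ⊗ b ↦ w a ⊗ b + (-1)^(|w||a|) a ⊗ w b`. -/
def primMul {k V : Type*} [Field k] [AddCommGroup V] [Module k V] (𝒲 : ℤ → Submodule k V)
    [DirectSum.Decomposition 𝒲] : V →ₗ[k] Module.End k (Ext 𝒲 ⊗[k] Ext 𝒲) where
  toFun w :=
    TensorProduct.map (LinearMap.mulLeft k (gen 𝒲 w)) LinearMap.id
      + TensorProduct.map LinearMap.id
          (LinearMap.mulLeft k (gen 𝒲 (w - oddProj (signMap 𝒲) w)))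
      + TensorProduct.map (extSign 𝒲).toLinearMap
          (LinearMap.mulLeft k (gen 𝒲 (oddProj (signMap 𝒲) w)))
  map_add' x y := by
    apply TensorProduct.ext'
    intro a b
    simp only [LinearMap.add_apply, TensorProduct.map_tmul, LinearMap.mulLeft_apply, map_add,
      map_sub, LinearMap.id_apply, add_mul, sub_mul, TensorProduct.add_tmul,
      TensorProduct.tmul_add, TensorProduct.tmul_sub]
    abel
  map_smul' c x := by
    apply TensorProduct.ext'
    intro a b
    simp only [LinearMap.add_apply, LinearMap.smul_apply, TensorProduct.map_tmul,
      LinearMap.mulLeft_apply, map_smul, map_sub, LinearMap.id_apply, smul_mul_assoc, sub_mul,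
      TensorProduct.tmul_smul, TensorProduct.tmul_sub, TensorProduct.smul_tmul', smul_add,
      smul_sub, RingHom.id_apply]

theorem primMul_apply {k V : Type*} [Field k] [CharZero k] [AddCommGroup V] [Module k V]
    (𝒲 : ℤ → Submodule k V) [DirectSum.Decomposition 𝒲] {p : ℤ} {w : V} (hw : w ∈ 𝒲 p)
    (a b : Ext 𝒲) :
    primMul 𝒲 w (a ⊗ₜ[k] b) = (gen 𝒲 w * a) ⊗ₜ[k] b +
      (if Even p then a else extSign 𝒲 a) ⊗ₜ[k] (gen 𝒲 w * b) := by
  simp only [primMul, LinearMap.coe_mk, AddHom.coe_mk, LinearMap.add_apply,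
    TensorProduct.map_tmul, LinearMap.mulLeft_apply, LinearMap.id_apply]
  rcases Int.even_or_odd p with hp | hp
  · simp [oddProj_signMap_of_even 𝒲 hw hp, hp]
  · simp [oddProj_signMap_of_odd 𝒲 hw hp, Int.not_even_iff_odd.mpr hp]

theorem primMul_comm {k V : Type*} [Field k] [CharZero k] [AddCommGroup V] [Module k V]
    (𝒲 : ℤ → Submodule k V) [DirectSum.Decomposition 𝒲] (p q : ℤ) (x y : V)
    (hx : x ∈ 𝒲 p) (hy : y ∈ 𝒲 q) :
    primMul 𝒲 x * primMul 𝒲 y = ((p * q).negOnePow : ℤ) • (primMul 𝒲 y * primMul 𝒲 x) := by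
  apply TensorProduct.ext'
  intro a b
  have hxy := gen_comm 𝒲 hx hy
  have h1 : ∀ c, gen 𝒲 x * (gen 𝒲 y * c)
      = ((p * q).negOnePow : ℤ) • (gen 𝒲 y * (gen 𝒲 x * c)) := by
    intro c
    rw [← mul_assoc, hxy, smul_mul_assoc, mul_assoc]
  simp only [Module.End.mul_apply, LinearMap.smul_apply, primMul_apply 𝒲 hx, primMul_apply 𝒲 hy,
    map_add, h1, smul_add]
  rcases Int.even_or_odd p with hp | hp <;> rcases Int.even_or_odd q with hq | hq
  · have e : (p * q).negOnePow = 1 := Int.negOnePow_even _ (hp.mul_right q)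
    simp only [hp, hq, e, if_true, Units.val_one, one_smul]
    abel
  · have e : (p * q).negOnePow = 1 := Int.negOnePow_even _ (hp.mul_right q)
    simp only [hp, Int.not_even_iff_odd.mpr hq, e, if_true, if_false, Units.val_one, one_smul,
      map_mul, extSign_gen, signMap_of_mem 𝒲 hx, Int.negOnePow_even _ hp]
    abel
  · have e : (p * q).negOnePow = 1 := Int.negOnePow_even _ (hq.mul_left p)
    simp only [hq, Int.not_even_iff_odd.mpr hp, e, if_true, if_false, Units.val_one, one_smul,
      map_mul, extSign_gen, signMap_of_mem 𝒲 hy, Int.negOnePow_even _ hq]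
    abel
  · have e : (p * q).negOnePow = -1 := Int.negOnePow_odd _ (hp.mul hq)
    simp only [Int.not_even_iff_odd.mpr hq, Int.not_even_iff_odd.mpr hp, e, if_false,
      Units.val_neg, Units.val_one, neg_smul, one_smul, neg_mul, map_neg, TensorProduct.neg_tmul,
      TensorProduct.tmul_neg,
      map_mul, extSign_gen, signMap_of_mem 𝒲 hx, signMap_of_mem 𝒲 hy, Int.negOnePow_odd _ hp,
      Int.negOnePow_odd _ hq]
    abel

/-- The comultiplication of `ᶜ∧W`: the multiplicative map with `w ↦ w ⊗ 1 + 1 ⊗ w` for `w ∈ W`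
(multiplicative for the product of `∧W ⊗ ∧W` with Koszul signs). In other words `Δ(1) = 1 ⊗ 1` and
`Δ(w a) = (w ⊗ 1 + 1 ⊗ w) Δ(a)`, so that `Δ(w₁ ⋯ wₙ)` is the sum over all unshuffles `σ` of
`ε(σ) (w_{σ(1)} ⋯ w_{σ(i)}) ⊗ (w_{σ(i+1)} ⋯ w_{σ(n)})`, `0 ≤ i ≤ n`. -/
def comul {k V : Type*} [Field k] [CharZero k] [AddCommGroup V] [Module k V]
    (𝒲 : ℤ → Submodule k V) [DirectSum.Decomposition 𝒲] : Ext 𝒲 →ₗ[k] Ext 𝒲 ⊗[k] Ext 𝒲 :=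
  LinearMap.applyₗ ((1 : Ext 𝒲) ⊗ₜ[k] (1 : Ext 𝒲)) ∘ₗ (extLift 𝒲 (primMul 𝒲) (primMul_comm 𝒲)).toLinearMap

theorem comul_one {k V : Type*} [Field k] [CharZero k] [AddCommGroup V] [Module k V]
    (𝒲 : ℤ → Submodule k V) [DirectSum.Decomposition 𝒲] : comul 𝒲 1 = 1 ⊗ₜ 1 := by
  simp [comul]

theorem comul_gen_mul {k V : Type*} [Field k] [CharZero k] [AddCommGroup V] [Module k V]
    (𝒲 : ℤ → Submodule k V) [DirectSum.Decomposition 𝒲] (w : V) (a : Ext 𝒲) :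
    comul 𝒲 (gen 𝒲 w * a) = primMul 𝒲 w (comul 𝒲 a) := by
  simp [comul, extLift_gen]

end Coalgebra

/-! ### Higher order coderivations -/

section Coderivations

/-- The second deviation `Ψ²_Ω = ΔΩ - (Ω ⊗ 1)Δ - T₂₁(Ω ⊗ 1)Δ` of an endomorphism `Ω` of `(C, Δ)`;
`o` is the projection of `C` on its odd part, which enters through the Koszul sign of the flip.
For graded cocommutative `Δ` the last term is `(1 ⊗ Ω)Δ`. -/
def deviationTwo {R C : Type*} [CommRing R] [AddCommGroup C] [Module R C]
    (Δ : C →ₗ[R] C ⊗[R] C) (o Ω : C →ₗ[R] C) : C →ₗ[R] C ⊗[R] C :=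
  Δ ∘ₗ Ω - LinearMap.rTensor C Ω ∘ₗ Δ - gradedSwap o ∘ₗ LinearMap.rTensor C Ω ∘ₗ Δ

/-- The recursion for the deviations,
`Ψⁿ⁺¹ = (1ⁿ⁻¹ ⊗ Δ)Ψⁿ - (Ψⁿ ⊗ 1)Δ - T_{1,…,n-1,n+1,n}(Ψⁿ ⊗ 1)Δ`; here `M` is `C^{⊗(n-1)}`. -/
def deviationStep {R C M : Type*} [CommRing R] [AddCommGroup C] [Module R C] [AddCommGroup M]
    [Module R M] (Δ : C →ₗ[R] C ⊗[R] C) (o : C →ₗ[R] C) (Ψ : C →ₗ[R] M ⊗[R] C) :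
    C →ₗ[R] (M ⊗[R] C) ⊗[R] C :=
  (TensorProduct.assoc R M C C).symm.toLinearMap ∘ₗ LinearMap.lTensor M Δ ∘ₗ Ψ
    - LinearMap.rTensor C Ψ ∘ₗ Δ
    - (TensorProduct.assoc R M C C).symm.toLinearMap ∘ₗ LinearMap.lTensor M (gradedSwap o) ∘ₗ
        (TensorProduct.assoc R M C C).toLinearMap ∘ₗ LinearMap.rTensor C Ψ ∘ₗ Δ

/-- If `Ψ` is the `n`-th deviation of an endomorphism, this says that the `(n + r)`-th vanishes. -/
def DeviationVanishes {R : Type*} {C : Type*} [CommRing R] [AddCommGroup C] [Module R C]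
    (Δ : C →ₗ[R] C ⊗[R] C) (o : C →ₗ[R] C) :
    ℕ → ∀ (M : Type _) [AddCommGroup M] [Module R M], (C →ₗ[R] M ⊗[R] C) → Prop
  | 0, _, _, _, Ψ => Ψ = 0
  | r + 1, M, _, _, Ψ => DeviationVanishes Δ o r (M ⊗[R] C) (deviationStep Δ o Ψ)

/-- Order `r` coderivations of `(C, Δ)`: the deviation `Ψ^{r+1}_Ω` vanishes. -/
def IsCoderivation {R C : Type*} [CommRing R] [AddCommGroup C] [Module R C]
    (Δ : C →ₗ[R] C ⊗[R] C) (o : C →ₗ[R] C) : ℕ → (C →ₗ[R] C) → Prop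
  | 0, Ω => Ω = 0
  | r + 1, Ω => DeviationVanishes Δ o r C (deviationTwo Δ o Ω)

end Coderivations

/-! ### The coalgebra `ᶜ∧W ⊗ R` over a commutative `k`-algebra `R` such as `k[t]` -/

section BaseChange

/-- `ᶜ∧W ⊗_k R`, an `R`-module. For `R = k[t]` this is `ᶜ∧W[t]`. -/
abbrev ExtR {k V : Type*} [Field k] [AddCommGroup V] [Module k V]
    (R : Type*) [CommRing R] [Algebra k R] (𝒲 : ℤ → Submodule k V) := R ⊗[k] Ext 𝒲

/-- The `R`-linear extension of the comultiplication. -/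
def comulR {k V : Type*} [Field k] [CharZero k] [AddCommGroup V] [Module k V]
    (R : Type*) [CommRing R] [Algebra k R] (𝒲 : ℤ → Submodule k V) [DirectSum.Decomposition 𝒲] :
    ExtR R 𝒲 →ₗ[R] ExtR R 𝒲 ⊗[R] ExtR R 𝒲 :=
  (TensorProduct.AlgebraTensorModule.distribBaseChange k R (Ext 𝒲) (Ext 𝒲)).toLinearMap ∘ₗ
    (comul 𝒲).baseChange R

/-- The projection on the part of odd degree (elements of `R` have degree `0`). -/
def oddR {k V : Type*} [Field k] [AddCommGroup V] [Module k V]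
    (R : Type*) [CommRing R] [Algebra k R] (𝒲 : ℤ → Submodule k V) [DirectSum.Decomposition 𝒲] :
    ExtR R 𝒲 →ₗ[R] ExtR R 𝒲 :=
  (oddProj (extSign 𝒲).toLinearMap).baseChange R

/-- The projection `πₙ` on `∧ⁿW ⊗ R`. -/
def projR {k V : Type*} [Field k] [AddCommGroup V] [Module k V]
    (R : Type*) [CommRing R] [Algebra k R] (𝒲 : ℤ → Submodule k V) (n : ℕ) :
    ExtR R 𝒲 →ₗ[R] ExtR R 𝒲 :=
  (extProj 𝒲 n).baseChange R

/-- `R`-linear endomorphisms of `ᶜ∧W ⊗ R` that are homogeneous of degree `e`. -/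
def HasDegree {k V R : Type*} [Field k] [AddCommGroup V] [Module k V]
    [CommRing R] [Algebra k R] (𝒲 : ℤ → Submodule k V) (e : ℤ) (Ω : Module.End R (ExtR R 𝒲)) :
    Prop :=
  ∀ p : ℤ, ∀ x ∈ (extDeg 𝒲 p).baseChange R, Ω x ∈ (extDeg 𝒲 (p + e)).baseChange R

/-- `coDER^r_e(ᶜ∧W ⊗ R)`: the order `r` coderivations of degree `e`. -/
def IsCoDer {k V R : Type*} [Field k] [CharZero k] [AddCommGroup V] [Module k V]
    [CommRing R] [Algebra k R] (𝒲 : ℤ → Submodule k V) [DirectSum.Decomposition 𝒲]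
    (r : ℕ) (e : ℤ) (Ω : Module.End R (ExtR R 𝒲)) : Prop :=
  IsCoderivation (comulR R 𝒲) (oddR R 𝒲) r Ω ∧ HasDegree 𝒲 e Ω

/-- Given a linear functional `c` on `R`, such as a coefficient of a polynomial, the map
`c ⊗ 1 : R ⊗ ∧W → ∧W`. -/
def coefR {k V R : Type*} [Field k] [AddCommGroup V] [Module k V]
    [CommRing R] [Algebra k R] (𝒲 : ℤ → Submodule k V) (c : R →ₗ[k] k) :
    ExtR R 𝒲 →ₗ[k] Ext 𝒲 :=
  (TensorProduct.lid k (Ext 𝒲)).toLinearMap ∘ₗ LinearMap.rTensor (Ext 𝒲) c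

end BaseChange

/-! ### Loop homotopy Lie algebras -/

section Loop

/-- `B` is a graded symmetric nondegenerate bilinear form of degree `+3` on the graded space `V`
(`B(u, v) = 0` unless `|u| + |v| + 3 = 0`). -/
structure IsLoopForm {k V : Type*} [Field k] [AddCommGroup V] [Module k V]
    (𝒱 : ℤ → Submodule k V) (B : LinearMap.BilinForm k V) : Prop where
  degree : ∀ (p q : ℤ) (u v : V), u ∈ 𝒱 p → v ∈ 𝒱 q → p + q + 3 ≠ 0 → B u v = 0
  symm : ∀ (p q : ℤ) (u v : V), u ∈ 𝒱 p → v ∈ 𝒱 q → B u v = ((p * q).negOnePow : ℤ) • B v u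
  nondegenerate : B.Nondegenerate

/-- Families `l^g_n : V^{⊗n} → V` of multilinear operations, `g, n ≥ 0`. -/
abbrev Ops (k V : Type*) [Field k] [AddCommGroup V] [Module k V] :=
  ℕ → ∀ n : ℕ, MultilinearMap k (fun _ : Fin n => V) V

/-- `l^g_n` has degree `n - 2` and is graded antisymmetric. -/
structure IsOps {k V : Type*} [Field k] [AddCommGroup V] [Module k V]
    (𝒱 : ℤ → Submodule k V) (l : Ops k V) : Prop where
  degree : ∀ (g n : ℕ) (v : Fin n → V) (d : Fin n → ℤ), (∀ i, v i ∈ 𝒱 (d i)) →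
    l g n v ∈ 𝒱 (∑ i, d i + n - 2)
  antisymm : ∀ (g n : ℕ) (v : Fin n → V) (d : Fin n → ℤ), (∀ i, v i ∈ 𝒱 (d i)) →
    ∀ σ : Equiv.Perm (Fin n), l g n v = (chi σ d : ℤ) • l g n (fun i => v (σ i))

/-- The term `∑_s (-1)^(h_s + n) l^{g-1}_{n+2}(h_s, h^s, v₁, …, vₙ)`, where `l^{-1} = 0`. Here `h`
and `h'` are the bases `{h_s}` and `{h^s}`, and `dh s` is the degree of `h_s`. -/
def loopTerm {k V ι : Type*} [Field k] [AddCommGroup V] [Module k V] [Fintype ι]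
    (h h' : ι → V) (dh : ι → ℤ) (l : Ops k V) (n : ℕ) (v : Fin n → V) : ℕ → V
  | 0 => 0
  | g + 1 => ∑ s, ((dh s + n).negOnePow : ℤ) •
      l g (n + 2) (Fin.cons (h s) (Fin.cons (h' s) v : Fin (n + 1) → V) : Fin (n + 2) → V)

/-- The main identity, axiom (A1). The summation index `a` is the arity `l` of the inner operation,
so that the outer one has arity `n - a + 1`. -/
def MainIdentity {k V ι : Type*} [Field k] [AddCommGroup V] [Module k V] [Fintype ι]
    (𝒱 : ℤ → Submodule k V) (h h' : ι → V) (dh : ι → ℤ) (l : Ops k V) : Prop :=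
  ∀ (g n : ℕ) (v : Fin n → V) (d : Fin n → ℤ), (∀ i, v i ∈ 𝒱 (d i)) →
    (∑ p ∈ Finset.HasAntidiagonal.antidiagonal g, ∑ a : Fin (n + 1), ∑ σ ∈ unshuffles a n,
      ((chi σ d * ((a : ℤ) * ((n : ℤ) - a)).negOnePow : ℤˣ) : ℤ) •
        l p.1 (n - a + 1)
          (Fin.cons
            (l p.2 a (fun i : Fin a => v (σ ⟨i, by omega⟩)))
            (fun j : Fin (n - a) => v (σ ⟨a + j, by omega⟩)) : Fin (n - a + 1) → V))
      + (2 : k)⁻¹ • loopTerm h h' dh l n v g = 0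

/-- Axiom (A2): `∑_s (-1)^((n+1) h_s) h_s ⊗ l^g_n(h^s, v₁, …, v_{n-1})` is (graded) symmetric, for
all `n ≥ 1`; below, `n` is written as `m + 1`. -/
def SymmetryAxiom {k V ι : Type*} [Field k] [AddCommGroup V] [Module k V] [Fintype ι]
    (𝒱 : ℤ → Submodule k V) [DirectSum.Decomposition 𝒱] (h h' : ι → V) (dh : ι → ℤ)
    (l : Ops k V) : Prop :=
  ∀ (g m : ℕ) (v : Fin m → V),
    gradedSwap (oddProj (signMap 𝒱))
        (∑ s, ((((m : ℤ) + 2) * dh s).negOnePow : ℤ) •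
          (h s ⊗ₜ[k] l g (m + 1) (Fin.cons (h' s) v : Fin (m + 1) → V)))
      = ∑ s, ((((m : ℤ) + 2) * dh s).negOnePow : ℤ) •
          (h s ⊗ₜ[k] l g (m + 1) (Fin.cons (h' s) v : Fin (m + 1) → V))

/-- Loop homotopy Lie algebra structures on `(V, B)`, where `h`, `h'` are dual bases with respect
to `B` and `dh` gives the degrees of the elements of `h`. -/
structure IsLoopHomotopyLie {k V ι : Type*} [Field k] [AddCommGroup V] [Module k V] [Fintype ι]
    (𝒱 : ℤ → Submodule k V) [DirectSum.Decomposition 𝒱] (h h' : ι → V) (dh : ι → ℤ)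
    (l : Ops k V) : Prop where
  ops : IsOps 𝒱 l
  main : MainIdentity 𝒱 h h' dh l
  symmetry : SymmetryAxiom 𝒱 h h' dh l

/-- `y = ∑_s (↑h_s)(↑h^s) ∈ ∧²W`, `W = ↑V`. -/
def symElement {k V ι : Type*} [Field k] [AddCommGroup V] [Module k V] [Fintype ι]
    (𝒱 : ℤ → Submodule k V) (h h' : ι → V) : Ext (susp 𝒱) :=
  ∑ s, gen (susp 𝒱) (h s) * gen (susp 𝒱) (h' s)

/-- `θ` is a degree `-1` order `2` coderivation of `ᶜ∧W ⊗ R` with `π₁θ = 0`, with `π₂θ = 0` on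
`∧ⁿW ⊗ R` for `n > 0`, and with `π₂θ(1) = ½ t y`. -/
structure IsTheta {k V ι R : Type*} [Field k] [CharZero k] [AddCommGroup V] [Module k V]
    [Fintype ι] [CommRing R] [Algebra k R] (𝒱 : ℤ → Submodule k V) [DirectSum.Decomposition 𝒱]
    (h h' : ι → V) (t : R) (θ : Module.End R (ExtR R (susp 𝒱))) : Prop where
  coder : IsCoDer (susp 𝒱) 2 (-1) θ
  proj_one : ∀ x, projR R (susp 𝒱) 1 (θ x) = 0
  proj_two : ∀ n > 0, ∀ x ∈ (extPow (susp 𝒱) n).baseChange R, projR R (susp 𝒱) 2 (θ x) = 0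
  proj_two_one : projR R (susp 𝒱) 2 (θ ((1 : R) ⊗ₜ[k] (1 : Ext (susp 𝒱))))
    = t ⊗ₜ[k] ((2 : k)⁻¹ • symElement 𝒱 h h')

/-- The relation between a coderivation `δ` and operations `l^g_n`: with `δ^g_n` the coefficient of
`t^g` (given by `c g`) of the restriction of `π₁δ` to `∧ⁿW`,
`↑l^g_n(v₁, …, vₙ) = (-1)^((n-1)v₁ + (n-2)v₂ + ⋯ + v_{n-1}) δ^g_n(↑v₁ ⋯ ↑vₙ)`. -/
def Corresponds {k V R : Type*} [Field k] [AddCommGroup V] [Module k V]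
    [CommRing R] [Algebra k R] (𝒱 : ℤ → Submodule k V) (c : ℕ → R →ₗ[k] k)
    (δ : Module.End R (ExtR R (susp 𝒱))) (l : Ops k V) : Prop :=
  ∀ (g n : ℕ) (v : Fin n → V) (d : Fin n → ℤ), (∀ i, v i ∈ 𝒱 (d i)) →
    gen (susp 𝒱) (l g n v) = ((∑ i : Fin n, ((n : ℤ) - 1 - i) * d i).negOnePow : ℤ) •
      coefR (susp 𝒱) (c g) (projR R (susp 𝒱) 1
        (δ ((1 : R) ⊗ₜ[k] (List.ofFn fun i => gen (susp 𝒱) (v i)).prod)))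

/-- The correspondence between loop homotopy Lie algebra structures (restricted to those in the
class `𝒜`) and coderivations `δ` of `ᶜ∧W ⊗ R` with `(δ + θ)² = 0`, for the algebra `R` with the
distinguished element `t` and the coefficient functionals `c g`:

* `θ` exists and is unique;
* the relation `Corresponds` is a bijection between the degree `-1` coderivations `δ` with
  `(δ + θ)² = 0` and the loop homotopy Lie algebra structures;
* more precisely, it is a bijection between all degree `-1` coderivations and all families of
  operations, under which `π₁(δ + θ)² = 0` is (A1), and given this, `π₂(δ + θ)² = 0` is (A2), the
  two together being equivalent to `(δ + θ)² = 0`; moreover `δ(1) = 0` means that `l^g_0 = 0`. -/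
def CoderivationCorrespondence {k V ι : Type*} [Field k] [CharZero k] [AddCommGroup V]
    [Module k V] [Fintype ι] (𝒱 : ℤ → Submodule k V) [DirectSum.Decomposition 𝒱]
    (h h' : ι → V) (dh : ι → ℤ) (R : Type*) [CommRing R] [Algebra k R] (t : R)
    (c : ℕ → R →ₗ[k] k) (𝒜 : Set (Ops k V)) : Prop :=
  ∃ θ : Module.End R (ExtR R (susp 𝒱)),
    IsTheta 𝒱 h h' t θ ∧
    (∀ θ', IsTheta 𝒱 h h' t θ' → θ' = θ) ∧
    (∃ Φ : {δ : Module.End R (ExtR R (susp 𝒱)) //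
              IsCoDer (susp 𝒱) 1 (-1) δ ∧ (δ + θ) ^ 2 = 0} ≃
            {l : Ops k V // IsLoopHomotopyLie 𝒱 h h' dh l ∧ l ∈ 𝒜},
      ∀ δ, Corresponds 𝒱 c δ.1 (Φ δ).1) ∧
    (∃ Φ : {δ : Module.End R (ExtR R (susp 𝒱)) // IsCoDer (susp 𝒱) 1 (-1) δ} ≃
            {l : Ops k V // IsOps 𝒱 l ∧ l ∈ 𝒜},
      ∀ δ, Corresponds 𝒱 c δ.1 (Φ δ).1 ∧
        ((∀ x, projR R (susp 𝒱) 1 (((δ.1 + θ) ^ 2) x) = 0) ↔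
          MainIdentity 𝒱 h h' dh (Φ δ).1) ∧
        (MainIdentity 𝒱 h h' dh (Φ δ).1 →
          ((∀ x, projR R (susp 𝒱) 2 (((δ.1 + θ) ^ 2) x) = 0) ↔
            SymmetryAxiom 𝒱 h h' dh (Φ δ).1)) ∧
        ((δ.1 + θ) ^ 2 = 0 ↔
          MainIdentity 𝒱 h h' dh (Φ δ).1 ∧ SymmetryAxiom 𝒱 h h' dh (Φ δ).1) ∧
        (δ.1 ((1 : R) ⊗ₜ[k] (1 : Ext (susp 𝒱))) = 0 ↔ ∀ g, (Φ δ).1 g 0 = 0))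

end Loop

end LoopLie

end

/-!
The graded bialgebra `∧W ⊗ R`, `R = k[t]` or `k[[t]]`, is used through the convolution product of
endomorphisms: for a linear map `G` put `conv G = μ (G ⊗ 1) Δ` (`SymBialgebra.conv`).

* If `f` takes values in `W`, then `conv f` is a coderivation with `π₁ conv f = f`, and a
  coderivation with `π₁ = 0` vanishes (`SymBialgebra.isCod_conv`, `SymBialgebra.IsCod.eq_zero`).
  So coderivations are the same thing as linear maps `∧W → W ⊗ R`, that is, as families of graded
  symmetric multilinear maps on `W` with coefficients in `R`; after the signs of the suspension,
  these are the families of graded antisymmetric operations on `V` (`isOps_opsOf`,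
  `exists_corresponds`).
* An order two coderivation with `π₁ = π₂ = 0` vanishes (`SymBialgebra.eq_zero_of_dev3`), and the
  multiplication by a product of two generators is an order two coderivation
  (`SymBialgebra.dev3_mulLeft`). Hence `θ` exists, is unique, and is the multiplication by `½ t y`.
* The square of `δ + θ` for `δ = conv f` is computed term by term. The square of `δ` is the
  coderivation with the linear part `f δ`; the square of `θ` vanishes since `y` is odd; and the
  anticommutator of `δ` with the multiplication by `v w` is the convolution of
  `a ↦ f(v w a) ± w f(v a) ± v f(w a)` (`SymBialgebra.conv_anticomm`). Since `∑ h_s ⊗ h^s` is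
  symmetric, the last two terms coincide after summation, so `(δ + θ)² = conv (G₁ + G₂)` with
  `G₁ = f δ + ½ t f(y ·)` in `W` and `G₂ = t ∑ ± ↑h_s f(↑h^s ·)` in `∧²W` (`sq_eq_conv`).
  Such a convolution vanishes if and only if `G₁ = G₂ = 0`, and `G₁`, `G₂` are its images under
  `π₁` and, if `G₁ = 0`, under `π₂`.
* Evaluated on words with the unshuffle formula for `Δ` (`comul_prod`), the coefficients of `G₁` are
  the left hand sides of the main identity (`linPart_eq_zero_iff`). The vanishing of `G₂` says that
  the tensors `∑ ↑h_s ⊗ f(↑h^s a)`, with signs, are in the kernel of `W ⊗ W → ∧²W`, which consists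
  of the antisymmetric tensors of `W`, that is, of the symmetric tensors of `V`
  (`mulGen_rTensor_eq_zero_iff`); this is the symmetry axiom (`quadPart_eq_zero_iff`).

Of the ring `R` only its coefficient functionals are used (`CoeffSystem`). Operations correspond to
coderivations over `R` exactly if their coordinates are the coefficients of elements of `R`, which
for polynomials is the finiteness condition.
-/

noncomputable section

namespace LoopLie

/-! ### Coalgebras with the formal properties of `ᶜ∧W` -/

/-- The formal properties of the graded bialgebra `∧W ⊗ R` on which the coalgebra part of the
argument rests. `W p` is a set of generators of degree `p`, `s` is the operator `(-1)^degree`, `o`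
the projection on the odd part, `Δ` the comultiplication and `π n` the projection on the part of
word length `n`. Everything is prescribed by its behaviour under left multiplication with
generators, so that proofs proceed by induction on words. -/
structure SymBialgebra (R C : Type*) [CommRing R] [Ring C] [Algebra R C] where
  W : ℤ → Set C
  s : C →ₐ[R] C
  o : C →ₗ[R] C
  Δ : C →ₗ[R] C ⊗[R] C
  π : ℕ → C →ₗ[R] C
  nat_unit : ∀ n : ℕ, n ≠ 0 → IsUnit (n : R)
  two_o : ∀ x, (2 : R) • o x = x - s x
  s_gen : ∀ {p w}, w ∈ W p → s w = (p.negOnePow : ℤ) • w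
  gen_comm : ∀ {p q v w}, v ∈ W p → w ∈ W q → v * w = ((p * q).negOnePow : ℤ) • (w * v)
  Δ_one : Δ 1 = 1 ⊗ₜ 1
  Δ_gen_mul : ∀ {p w}, w ∈ W p → ∀ x, Δ (w * x) =
    TensorProduct.map (LinearMap.mulLeft R w) LinearMap.id (Δ x) +
    TensorProduct.map (if Even p then AlgHom.id R C else s).toLinearMap
      (LinearMap.mulLeft R w) (Δ x)
  π_zero_one : π 0 1 = 1
  π_succ_one : ∀ n, π (n + 1) 1 = 0
  π_zero_gen_mul : ∀ {p w}, w ∈ W p → ∀ x, π 0 (w * x) = 0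
  π_succ_gen_mul : ∀ {p w}, w ∈ W p → ∀ n x, π (n + 1) (w * x) = w * π n x
  mem_of_gen : ∀ N : Submodule R C, 1 ∈ N → (∀ p w x, w ∈ W p → x ∈ N → w * x ∈ N) → ∀ x, x ∈ N

namespace SymBialgebra

variable {R C : Type*} [CommRing R] [Ring C] [Algebra R C] (S : SymBialgebra R C)

/-- The operator `(-1)^(p * degree)`. -/
def sg (p : ℤ) : C →ₐ[R] C := if Even p then AlgHom.id R C else S.s

/-- Left multiplication by `w ⊗ 1 + 1 ⊗ w` for an element `w` of degree `p`. -/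
def prim (p : ℤ) (w : C) : C ⊗[R] C →ₗ[R] C ⊗[R] C :=
  TensorProduct.map (LinearMap.mulLeft R w) LinearMap.id +
    TensorProduct.map (S.sg p).toLinearMap (LinearMap.mulLeft R w)

@[simp] theorem prim_tmul (p : ℤ) (w a b : C) :
    S.prim p w (a ⊗ₜ b) = (w * a) ⊗ₜ[R] b + S.sg p a ⊗ₜ (w * b) := by
  simp [prim]

theorem Δ_mul {p w} (hw : w ∈ S.W p) (x : C) : S.Δ (w * x) = S.prim p w (S.Δ x) := by
  simp [S.Δ_gen_mul hw, prim, sg]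

theorem induction {P : C → Prop} (one : P 1) (gen_mul : ∀ p w x, w ∈ S.W p → P x → P (w * x))
    (add : ∀ x y, P x → P y → P (x + y)) (smul : ∀ (r : R) x, P x → P (r • x)) (x : C) : P x :=
  S.mem_of_gen
    { carrier := {x | P x}
      add_mem' := fun {a b} ha hb => add a b ha hb
      zero_mem' := by simpa using smul 0 1 one
      smul_mem' := fun c x hx => smul c x hx } one gen_mul x

theorem hom_ext {M : Type*} [AddCommGroup M] [Module R M] {f g : C →ₗ[R] M} (one : f 1 = g 1)
    (gen_mul : ∀ p w x, w ∈ S.W p → f x = g x → f (w * x) = g (w * x)) : f = g := by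
  ext x
  refine S.induction (P := fun x => f x = g x) one gen_mul (fun x y hx hy => ?_)
    (fun r x hx => ?_) x
  · simp [hx, hy]
  · simp [hx]

theorem smul_two_cancel (S : SymBialgebra R C) {M : Type*} [AddCommGroup M] [Module R M] {x y : M}
    (h : (2 : R) • x = (2 : R) • y) : x = y := by
  have h2 : IsUnit (2 : R) := by simpa using S.nat_unit 2 two_ne_zero
  exact (IsUnit.smul_left_cancel h2).1 h

theorem eq_zero_of_nsmul (S : SymBialgebra R C) {M : Type*} [AddCommGroup M] [Module R M] {x : M}
    {n : ℕ} (hn : n ≠ 0) (h : n • x = 0) : x = 0 := by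
  rw [← Nat.cast_smul_eq_nsmul R] at h
  exact (IsUnit.smul_eq_zero (S.nat_unit n hn)).1 h

theorem eq_zero_of_eq_neg (S : SymBialgebra R C) {M : Type*} [AddCommGroup M] [Module R M] {x : M}
    (h : x = -x) : x = 0 := by
  refine S.eq_zero_of_nsmul two_ne_zero ?_
  rw [two_smul]
  nth_rewrite 2 [h]
  simp

/-! ### Signs -/

theorem negOnePow_smul_self {M : Type*} [AddCommGroup M] (p : ℤ) (x : M) :
    (p.negOnePow : ℤ) • (p.negOnePow : ℤ) • x = x := by
  rw [smul_smul, ← Units.val_mul, ← Int.negOnePow_add, Int.negOnePow_even _ (Even.add_self p)]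
  simp

theorem negOnePow_smul_smul {M : Type*} [AddCommGroup M] (p q : ℤ) (x : M) :
    (p.negOnePow : ℤ) • (q.negOnePow : ℤ) • x = ((p + q).negOnePow : ℤ) • x := by
  rw [smul_smul, ← Units.val_mul, ← Int.negOnePow_add]

theorem negOnePow_congr {p q : ℤ} (h : Even (p - q)) : p.negOnePow = q.negOnePow :=
  (Int.negOnePow_eq_iff p q).2 h

theorem s_s (x : C) : S.s (S.s x) = x := by
  have : (S.s.toLinearMap ∘ₗ S.s.toLinearMap) = LinearMap.id := by
    apply S.hom_ext
    · simp
    · intro p w x hw hx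
      simp only [LinearMap.comp_apply, AlgHom.toLinearMap_apply, LinearMap.id_apply] at hx ⊢
      rw [map_mul, map_mul, hx, S.s_gen hw, map_zsmul, S.s_gen hw, negOnePow_smul_self]
  exact LinearMap.congr_fun this x

theorem sg_even {p : ℤ} (hp : Even p) : S.sg p = AlgHom.id R C := by simp [sg, hp]

theorem sg_odd {p : ℤ} (hp : Odd p) : S.sg p = S.s := by
  simp [sg, Int.not_even_iff_odd.2 hp]

theorem sg_sg (p q : ℤ) (x : C) : S.sg p (S.sg q x) = S.sg (p + q) x := by
  rcases Int.even_or_odd p with hp | hp <;> rcases Int.even_or_odd q with hq | hq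
  · simp [S.sg_even, hp, hq, hp.add hq]
  · simp [S.sg_even, S.sg_odd, hp, hq, hp.add_odd hq]
  · simp [S.sg_even, S.sg_odd, hp, hq, hp.add_even hq]
  · simp [S.sg_even, S.sg_odd, hp, hq, hp.add_odd hq, s_s]

theorem sg_gen {p w} (hw : w ∈ S.W p) (q : ℤ) : S.sg q w = ((p * q).negOnePow : ℤ) • w := by
  rcases Int.even_or_odd q with hq | hq
  · simp [S.sg_even hq, Int.negOnePow_even _ (hq.mul_left p)]
  · rw [S.sg_odd hq, S.s_gen hw]
    congr 2
    refine negOnePow_congr ?_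
    have : p - p * q = p * (1 - q) := by ring
    rw [this]
    exact (odd_one.sub_odd hq).mul_left p

/-- An operator of degree `e` (modulo two): it commutes with `(-1)^degree` up to `(-1)^e`. -/
def Par (e : ℤ) (F : C →ₗ[R] C) : Prop :=
  ∀ q x, F (S.sg q x) = ((e * q).negOnePow : ℤ) • S.sg q (F x)

theorem par_mulLeft {p w} (hw : w ∈ S.W p) : S.Par p (LinearMap.mulLeft R w) := by
  intro q x
  simp only [LinearMap.mulLeft_apply, map_mul, S.sg_gen hw, smul_mul_assoc, negOnePow_smul_self]

theorem Par.comp {S : SymBialgebra R C} {e f : ℤ} {F G : C →ₗ[R] C} (hF : S.Par e F)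
    (hG : S.Par f G) : S.Par (e + f) (F ∘ₗ G) := by
  intro q x
  simp only [LinearMap.comp_apply]
  rw [hG, map_zsmul, hF, negOnePow_smul_smul]
  congr 3; ring

/-- Graded commutativity of a generator with an arbitrary element. -/
theorem gen_mul_comm {p w} (hw : w ∈ S.W p) (x : C) : w * x = S.sg p x * w := by
  refine S.induction (P := fun x => w * x = S.sg p x * w) ?_ ?_ ?_ ?_ x
  · simp
  · intro q v x hv hx
    rw [map_mul, mul_assoc, ← hx, S.sg_gen hv, ← mul_assoc, S.gen_comm hw hv, smul_mul_assoc,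
      smul_mul_assoc, mul_assoc, mul_comm p q]
  · intro x y hx hy; simp [mul_add, add_mul, hx, hy]
  · intro r x hx; simp [hx]

theorem sg_mul_gen {p w} (hw : w ∈ S.W p) (x : C) : S.sg p x * w = w * x :=
  (S.gen_mul_comm hw x).symm

theorem π_sg (n : ℕ) (q : ℤ) (x : C) : S.π n (S.sg q x) = S.sg q (S.π n x) := by
  have : ∀ n, S.π n (S.sg q x) = S.sg q (S.π n x) := by
    refine S.induction (P := fun x => ∀ n, S.π n (S.sg q x) = S.sg q (S.π n x)) ?_ ?_ ?_ ?_ x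
    · intro n
      cases n <;> simp [S.π_zero_one, S.π_succ_one]
    · intro p w x hw hx n
      rw [map_mul, S.sg_gen hw, smul_mul_assoc, map_zsmul]
      cases n
      · simp [S.π_zero_gen_mul hw]
      · rw [S.π_succ_gen_mul hw, S.π_succ_gen_mul hw, hx, map_mul, S.sg_gen hw, smul_mul_assoc]
    · intro x y hx hy n; simp [hx, hy]
    · intro r x hx n; simp [hx]
  exact this n

/-! ### The flip and the coalgebra axioms -/

/-- The Koszul flip. -/
def T : C ⊗[R] C →ₗ[R] C ⊗[R] C := gradedSwap S.o

theorem two_T_tmul (x y : C) : (2 : R) • S.T (x ⊗ₜ[R] y)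
    = y ⊗ₜ x + S.s y ⊗ₜ x + y ⊗ₜ S.s x - S.s y ⊗ₜ S.s x := by
  simp only [T, gradedSwap, LinearMap.comp_apply, LinearMap.sub_apply, LinearMap.id_apply,
    LinearMap.smul_apply, TensorProduct.map_tmul, map_sub, map_smul, LinearEquiv.coe_coe,
    TensorProduct.comm_tmul, smul_sub]
  have h4 : (2 : R) • (2 : R) • (S.o y ⊗ₜ[R] S.o x) =
      ((2 : R) • S.o y) ⊗ₜ[R] ((2 : R) • S.o x) := by
    rw [TensorProduct.tmul_smul, ← TensorProduct.smul_tmul']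
  rw [h4, S.two_o, S.two_o, two_smul, TensorProduct.sub_tmul, TensorProduct.tmul_sub,
    TensorProduct.tmul_sub]
  abel

theorem T_T (z : C ⊗[R] C) : S.T (S.T z) = z := by
  have : S.T ∘ₗ S.T = LinearMap.id := by
    apply TensorProduct.ext'
    intro x y
    apply S.smul_two_cancel
    apply S.smul_two_cancel
    simp only [LinearMap.comp_apply, LinearMap.id_apply]
    rw [← map_smul S.T, S.two_T_tmul]
    simp only [smul_sub, smul_add, map_add, map_sub, two_T_tmul, s_s]
    simp only [two_smul]
    abel
  exact LinearMap.congr_fun this z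

theorem T_map_id {e : ℤ} {F : C →ₗ[R] C} (hF : S.Par e F) (z : C ⊗[R] C) :
    S.T (LinearMap.rTensor C F z) = TensorProduct.map (S.sg e).toLinearMap F (S.T z) := by
  have : S.T ∘ₗ LinearMap.rTensor C F = TensorProduct.map (S.sg e).toLinearMap F ∘ₗ S.T := by
    apply TensorProduct.ext'
    intro x y
    apply S.smul_two_cancel
    simp only [LinearMap.comp_apply, LinearMap.rTensor_tmul]
    rw [← LinearMap.map_smul (TensorProduct.map (S.sg e).toLinearMap F), S.two_T_tmul, S.two_T_tmul]
    have h1 := hF 1 x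
    rw [S.sg_odd odd_one, mul_one] at h1
    simp only [map_add, map_sub, TensorProduct.map_tmul, AlgHom.toLinearMap_apply, h1]
    rcases Int.even_or_odd e with he | he
    · simp [S.sg_even he, Int.negOnePow_even _ he]
    · simp only [S.sg_odd he, Int.negOnePow_odd _ he, s_s, Units.val_neg, Units.val_one, neg_smul,
        one_smul, TensorProduct.tmul_neg]
      abel
  exact LinearMap.congr_fun this z

theorem prim_eq {p w} (hw : w ∈ S.W p) (z : C ⊗[R] C) :
    S.prim p w z = LinearMap.rTensor C (LinearMap.mulLeft R w) z +
      S.T (LinearMap.rTensor C (LinearMap.mulLeft R w) (S.T z)) := by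
  rw [S.T_map_id (S.par_mulLeft hw), S.T_T]
  rfl

theorem T_prim {p w} (hw : w ∈ S.W p) (z : C ⊗[R] C) :
    S.T (S.prim p w z) = S.prim p w (S.T z) := by
  rw [S.prim_eq hw, S.prim_eq hw, map_add, S.T_T, S.T_T, add_comm]

/-- Cocommutativity. -/
theorem T_Δ (x : C) : S.T (S.Δ x) = S.Δ x := by
  have : S.T ∘ₗ S.Δ = S.Δ := by
    apply S.hom_ext
    · apply S.smul_two_cancel
      simp only [LinearMap.comp_apply, S.Δ_one]
      rw [two_T_tmul, two_smul]
      simp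
    · intro p w x hw hx
      simp only [LinearMap.comp_apply] at hx ⊢
      rw [S.Δ_mul hw, S.T_prim hw, hx]
  exact LinearMap.congr_fun this x

theorem Δ_sg (q : ℤ) (x : C) : S.Δ (S.sg q x)
    = TensorProduct.map (S.sg q).toLinearMap (S.sg q).toLinearMap (S.Δ x) := by
  refine S.induction (P := fun x => S.Δ (S.sg q x)
    = TensorProduct.map (S.sg q).toLinearMap (S.sg q).toLinearMap (S.Δ x)) ?_ ?_ ?_ ?_ x
  · simp [S.Δ_one]
  · intro p w x hw hx
    rw [map_mul, S.sg_gen hw, smul_mul_assoc, map_zsmul, S.Δ_mul hw, S.Δ_mul hw, hx]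
    generalize S.Δ x = z
    induction z using TensorProduct.induction_on with
    | zero => simp
    | add a b ha hb => simp only [map_add, smul_add, ha, hb]
    | tmul a b =>
      simp only [TensorProduct.map_tmul, prim_tmul, AlgHom.toLinearMap_apply, map_add, map_mul,
        S.sg_gen hw, smul_mul_assoc, smul_add, TensorProduct.tmul_smul,
        ← TensorProduct.smul_tmul', sg_sg, add_comm p q]
  · intro x y hx hy; simp only [map_add, hx, hy]
  · intro r x hx; simp only [map_smul, hx]

/-- Coassociativity. -/
theorem coassoc (x : C) : TensorProduct.assoc R C C C (LinearMap.rTensor C S.Δ (S.Δ x))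
    = LinearMap.lTensor C S.Δ (S.Δ x) := by
  refine S.induction (P := fun x =>
    TensorProduct.assoc R C C C (LinearMap.rTensor C S.Δ (S.Δ x))
      = LinearMap.lTensor C S.Δ (S.Δ x)) ?_ ?_ ?_ ?_ x
  · simp [S.Δ_one]
  · intro p w x hw hx
    have hl : LinearMap.lTensor C S.Δ ∘ₗ S.prim p w =
        (TensorProduct.map (LinearMap.mulLeft R w) LinearMap.id +
          TensorProduct.map (S.sg p).toLinearMap (S.prim p w)) ∘ₗ LinearMap.lTensor C S.Δ := by
      apply TensorProduct.ext'
      intro a b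
      simp [S.Δ_mul hw]
    have hr : (TensorProduct.assoc R C C C).toLinearMap ∘ₗ LinearMap.rTensor C S.Δ ∘ₗ S.prim p w =
        (TensorProduct.map (LinearMap.mulLeft R w) LinearMap.id +
          TensorProduct.map (S.sg p).toLinearMap (S.prim p w)) ∘ₗ
          (TensorProduct.assoc R C C C).toLinearMap ∘ₗ LinearMap.rTensor C S.Δ := by
      apply TensorProduct.ext'
      intro a b
      simp only [LinearMap.comp_apply, prim_tmul, map_add, LinearMap.rTensor_tmul, S.Δ_mul hw,
        S.Δ_sg]
      generalize S.Δ a = z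
      induction z using TensorProduct.induction_on with
      | zero => simp
      | add a b ha hb =>
        simp only [map_add, TensorProduct.add_tmul] at ha hb ⊢
        rw [← sub_eq_zero] at ha hb ⊢
        rw [← add_zero (0 : C ⊗[R] (C ⊗[R] C))]
        nth_rewrite 2 [← hb]
        rw [← ha]
        abel
      | tmul a c =>
        simp [TensorProduct.add_tmul, TensorProduct.tmul_add, add_assoc]
    have hl' := LinearMap.congr_fun hl (S.Δ x)
    have hr' := LinearMap.congr_fun hr (S.Δ x)
    simp only [LinearMap.comp_apply, LinearEquiv.coe_coe] at hl' hr'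
    rw [S.Δ_mul hw, hl', hr', hx]
  · intro x y hx hy; simp only [map_add, hx, hy]
  · intro r x hx; simp only [map_smul, hx]

/-- The left counit axiom. -/
theorem counit_left (x : C) : LinearMap.rTensor C (S.π 0) (S.Δ x) = 1 ⊗ₜ x := by
  refine S.induction (P := fun x => LinearMap.rTensor C (S.π 0) (S.Δ x) = 1 ⊗ₜ x) ?_ ?_ ?_ ?_ x
  · simp [S.Δ_one, S.π_zero_one]
  · intro p w x hw hx
    have h : LinearMap.rTensor C (S.π 0) ∘ₗ S.prim p w =
        TensorProduct.map (S.sg p).toLinearMap (LinearMap.mulLeft R w) ∘ₗ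
          LinearMap.rTensor C (S.π 0) := by
      apply TensorProduct.ext'
      intro a b
      simp [S.π_zero_gen_mul hw, S.π_sg]
    have h' := LinearMap.congr_fun h (S.Δ x)
    simp only [LinearMap.comp_apply] at h'
    rw [S.Δ_mul hw, h', hx]
    simp
  · intro x y hx hy; simp only [map_add, hx, hy, TensorProduct.tmul_add]
  · intro r x hx; simp only [map_smul, hx, TensorProduct.tmul_smul]

/-- The right counit axiom. -/
theorem counit_right (x : C) : LinearMap.lTensor C (S.π 0) (S.Δ x) = x ⊗ₜ 1 := by
  refine S.induction (P := fun x => LinearMap.lTensor C (S.π 0) (S.Δ x) = x ⊗ₜ 1) ?_ ?_ ?_ ?_ x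
  · simp [S.Δ_one, S.π_zero_one]
  · intro p w x hw hx
    have h : LinearMap.lTensor C (S.π 0) ∘ₗ S.prim p w =
        TensorProduct.map (LinearMap.mulLeft R w) LinearMap.id ∘ₗ
          LinearMap.lTensor C (S.π 0) := by
      apply TensorProduct.ext'
      intro a b
      simp [S.π_zero_gen_mul hw]
    have h' := LinearMap.congr_fun h (S.Δ x)
    simp only [LinearMap.comp_apply] at h'
    rw [S.Δ_mul hw, h', hx]
    simp
  · intro x y hx hy; simp only [map_add, hx, hy, TensorProduct.add_tmul]
  · intro r x hx; simp only [map_smul, hx, TensorProduct.smul_tmul']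

end SymBialgebra

namespace SymBialgebra

variable {R C : Type*} [CommRing R] [Ring C] [Algebra R C] (S : SymBialgebra R C)

/-! ### Words -/

/-- Products of `n` generators of total degree `p`. -/
inductive IsWord : ℕ → ℤ → C → Prop
  | one : IsWord 0 0 1
  | gen_mul {p q : ℤ} {n : ℕ} {w x : C} :
      w ∈ S.W p → IsWord n q x → IsWord (n + 1) (p + q) (w * x)

theorem hom_eq_zero {M : Type*} [AddCommGroup M] [Module R M] {f : C →ₗ[R] M}
    (h : ∀ n p x, S.IsWord n p x → f x = 0) : f = 0 := by
  have key : ∀ x, x ∈ Submodule.span R {x | ∃ n p, S.IsWord n p x} := by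
    refine S.mem_of_gen _ (Submodule.subset_span ⟨0, 0, .one⟩) ?_
    intro p w x hw hx
    induction hx using Submodule.span_induction with
    | mem x hx =>
      obtain ⟨n, q, hx⟩ := hx
      exact Submodule.subset_span ⟨_, _, .gen_mul hw hx⟩
    | zero => simp
    | add x y _ _ hx hy => rw [mul_add]; exact add_mem hx hy
    | smul r x _ hx => rw [mul_smul_comm]; exact Submodule.smul_mem _ _ hx
  ext x
  have hx := key x
  induction hx using Submodule.span_induction with
  | mem x hx =>
    obtain ⟨n, p, hx⟩ := hx
    simpa using h n p x hx
  | zero => simp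
  | add x y _ _ hx hy => rw [map_add, hx, hy]; simp
  | smul r x _ hx => rw [map_smul, hx]; simp

theorem IsWord.sg {S : SymBialgebra R C} {n p x} (hx : S.IsWord n p x) (q : ℤ) :
    S.sg q x = ((p * q).negOnePow : ℤ) • x := by
  induction hx with
  | one => simp
  | gen_mul hw _ ih =>
    rw [map_mul, ih, S.sg_gen hw, smul_mul_smul_comm, ← Units.val_mul, ← Int.negOnePow_add,
      add_mul]

/-! ### Projections by word length -/

theorem exists_π_zero_eq (x : C) : ∃ r : R, S.π 0 x = r • (1 : C) := by
  refine S.induction (P := fun x => ∃ r : R, S.π 0 x = r • (1 : C)) ?_ ?_ ?_ ?_ x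
  · exact ⟨1, by simp [S.π_zero_one]⟩
  · intro p w x hw _
    exact ⟨0, by simp [S.π_zero_gen_mul hw]⟩
  · rintro x y ⟨r, hr⟩ ⟨r', hr'⟩
    exact ⟨r + r', by rw [map_add, hr, hr', add_smul]⟩
  · rintro r x ⟨r', hr'⟩
    exact ⟨r * r', by rw [map_smul, hr', smul_smul]⟩

theorem π_π (n : ℕ) (x : C) : S.π n (S.π n x) = S.π n x := by
  revert n
  refine S.induction (P := fun x => ∀ n, S.π n (S.π n x) = S.π n x) ?_ ?_ ?_ ?_ x
  · intro n; cases n <;> simp [S.π_zero_one, S.π_succ_one]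
  · intro p w x hw hx n
    cases n
    · simp [S.π_zero_gen_mul hw]
    · simp [S.π_succ_gen_mul hw, hx]
  · intro x y hx hy n; simp [hx, hy]
  · intro r x hx n; simp [hx]

theorem eq_zero_of_π (x : C) (h : ∀ n, S.π n x = 0) : x = 0 := by
  have key : ∃ N, ∀ M, N ≤ M → x = ∑ i ∈ Finset.range M, S.π i x := by
    refine S.induction (P := fun x => ∃ N, ∀ M, N ≤ M → x = ∑ i ∈ Finset.range M, S.π i x)
      ?_ ?_ ?_ ?_ x
    · refine ⟨1, fun M hM => ?_⟩
      obtain ⟨M, rfl⟩ := Nat.exists_eq_add_of_le' hM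
      rw [Finset.sum_range_succ']
      simp [S.π_zero_one, S.π_succ_one]
    · rintro p w x hw ⟨N, hN⟩
      refine ⟨N + 1, fun M hM => ?_⟩
      obtain ⟨M, rfl⟩ := Nat.exists_eq_add_of_le' (Nat.le_of_add_left_le hM)
      rw [Finset.sum_range_succ']
      simp only [S.π_succ_gen_mul hw, S.π_zero_gen_mul hw, add_zero]
      rw [← Finset.mul_sum, ← hN M (by omega)]
    · rintro x y ⟨N, hN⟩ ⟨N', hN'⟩
      refine ⟨max N N', fun M hM => ?_⟩
      simp only [map_add, Finset.sum_add_distrib]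
      rw [← hN M (le_trans (le_max_left _ _) hM), ← hN' M (le_trans (le_max_right _ _) hM)]
    · rintro r x ⟨N, hN⟩
      refine ⟨N, fun M hM => ?_⟩
      simp only [map_smul]
      rw [← Finset.smul_sum, ← hN M hM]
  obtain ⟨N, hN⟩ := key
  rw [hN N le_rfl]
  exact Finset.sum_eq_zero fun i _ => h i

/-- The span of the generators. -/
def lin : Submodule R C := Submodule.span R {x | ∃ p, x ∈ S.W p}

/-- The span of the products of two generators. -/
def quad : Submodule R C := Submodule.span R {x | ∃ p q v w, v ∈ S.W p ∧ w ∈ S.W q ∧ x = v * w}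

theorem gen_mem_lin {p w} (hw : w ∈ S.W p) : w ∈ S.lin := Submodule.subset_span ⟨p, hw⟩

theorem mul_mem_quad {x y : C} (hx : x ∈ S.lin) (hy : y ∈ S.lin) : x * y ∈ S.quad := by
  induction hx using Submodule.span_induction with
  | mem x hx =>
    obtain ⟨p, hx⟩ := hx
    induction hy using Submodule.span_induction with
    | mem y hy =>
      obtain ⟨q, hy⟩ := hy
      exact Submodule.subset_span ⟨p, q, x, y, hx, hy, rfl⟩
    | zero => simp
    | add y z _ _ hy hz => rw [mul_add]; exact add_mem hy hz
    | smul r y _ hy => rw [mul_smul_comm]; exact Submodule.smul_mem _ _ hy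
  | zero => simp
  | add x z _ _ hx hz => rw [add_mul]; exact add_mem hx hz
  | smul r x _ hx => rw [smul_mul_assoc]; exact Submodule.smul_mem _ _ hx

theorem π_one_mem_lin (x : C) : S.π 1 x ∈ S.lin := by
  refine S.induction (P := fun x => S.π 1 x ∈ S.lin) ?_ ?_ ?_ ?_ x
  · simp [S.π_succ_one]
  · intro p w x hw _
    obtain ⟨r, hr⟩ := S.exists_π_zero_eq x
    rw [S.π_succ_gen_mul hw, hr, mul_smul_comm, mul_one]
    exact Submodule.smul_mem _ _ (S.gen_mem_lin hw)
  · intro x y hx hy; rw [map_add]; exact add_mem hx hy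
  · intro r x hx; rw [map_smul]; exact Submodule.smul_mem _ _ hx

theorem π_succ_lin_mul {v : C} (hv : v ∈ S.lin) (n : ℕ) (x : C) :
    S.π (n + 1) (v * x) = v * S.π n x := by
  induction hv using Submodule.span_induction with
  | mem v hv => obtain ⟨p, hv⟩ := hv; exact S.π_succ_gen_mul hv n x
  | zero => simp
  | add v z _ _ hv hz => simp only [add_mul, map_add, hv, hz]
  | smul r v _ hv => simp only [smul_mul_assoc, map_smul, hv]

theorem π_one_quad_mul {v : C} (hv : v ∈ S.quad) (x : C) : S.π 1 (v * x) = 0 := by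
  induction hv using Submodule.span_induction with
  | mem v hv =>
    obtain ⟨p, q, v, w, hv, hw, rfl⟩ := hv
    rw [mul_assoc, S.π_succ_gen_mul hv, S.π_zero_gen_mul hw, mul_zero]
  | zero => simp
  | add v z _ _ hv hz => simp only [add_mul, map_add, hv, hz, add_zero]
  | smul r v _ hv => simp only [smul_mul_assoc, map_smul, hv, smul_zero]

theorem π_two_quad_mul {v : C} (hv : v ∈ S.quad) (x : C) : S.π 2 (v * x) = v * S.π 0 x := by
  induction hv using Submodule.span_induction with
  | mem v hv =>
    obtain ⟨p, q, v, w, hv, hw, rfl⟩ := hv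
    rw [mul_assoc, S.π_succ_gen_mul hv, S.π_succ_gen_mul hw, mul_assoc]
  | zero => simp
  | add v z _ _ hv hz => simp only [add_mul, map_add, hv, hz]
  | smul r v _ hv => simp only [smul_mul_assoc, map_smul, hv]

theorem Δ_lin {v : C} (hv : v ∈ S.lin) : S.Δ v = v ⊗ₜ 1 + 1 ⊗ₜ v := by
  induction hv using Submodule.span_induction with
  | mem v hv =>
    obtain ⟨p, hv⟩ := hv
    have h := S.Δ_mul hv 1
    simpa [S.Δ_one] using h
  | zero => simp
  | add v z _ _ hv hz =>
    rw [map_add, hv, hz, TensorProduct.add_tmul, TensorProduct.tmul_add]; abel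
  | smul r v _ hv =>
    rw [map_smul, hv, smul_add, TensorProduct.tmul_smul, TensorProduct.smul_tmul']

/-! ### Convolution with the identity -/

/-- The convolution `μ (G ⊗ 1) Δ` of a linear map `G` with the identity. -/
def conv : (C →ₗ[R] C) →ₗ[R] (C →ₗ[R] C) where
  toFun G := LinearMap.mul' R C ∘ₗ LinearMap.rTensor C G ∘ₗ S.Δ
  map_add' F G := by ext; simp [LinearMap.rTensor_add]
  map_smul' r G := by ext; simp [LinearMap.rTensor_smul]

theorem conv_apply (G : C →ₗ[R] C) (x : C) :
    S.conv G x = LinearMap.mul' R C (LinearMap.rTensor C G (S.Δ x)) := rfl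

theorem conv_one (G : C →ₗ[R] C) : S.conv G 1 = G 1 := by
  simp [conv_apply, S.Δ_one]

theorem conv_mulLeft (w : C) (G : C →ₗ[R] C) :
    S.conv (LinearMap.mulLeft R w ∘ₗ G) = LinearMap.mulLeft R w ∘ₗ S.conv G := by
  ext x
  simp only [conv_apply, LinearMap.comp_apply, LinearMap.mulLeft_apply]
  generalize S.Δ x = z
  induction z using TensorProduct.induction_on with
  | zero => simp
  | add a b ha hb => simp only [map_add, mul_add, ha, hb]
  | tmul a b => simp [mul_assoc]

theorem conv_gen_mul {e p w} {G : C →ₗ[R] C} (hG : S.Par e G) (hw : w ∈ S.W p) (x : C) :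
    S.conv G (w * x) = S.conv (G ∘ₗ LinearMap.mulLeft R w) x
      + ((e * p).negOnePow : ℤ) • (w * S.conv G x) := by
  simp only [conv_apply, S.Δ_mul hw]
  generalize S.Δ x = z
  induction z using TensorProduct.induction_on with
  | zero => simp
  | add a b ha hb =>
    simp only [map_add, mul_add, smul_add, ha, hb]
    abel
  | tmul a b =>
    simp only [prim_tmul, map_add, LinearMap.rTensor_tmul, LinearMap.mul'_apply,
      LinearMap.comp_apply, LinearMap.mulLeft_apply, hG p a, smul_mul_assoc]
    rw [← mul_assoc (S.sg p (G a)), S.sg_mul_gen hw, mul_assoc]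

theorem conv_π_zero : S.conv (S.π 0) = LinearMap.id := by
  ext x
  simp [conv_apply, S.counit_left]

theorem Par.conv {S : SymBialgebra R C} {e : ℤ} {G : C →ₗ[R] C} (hG : S.Par e G) :
    S.Par e (S.conv G) := by
  intro q x
  simp only [conv_apply, Δ_sg]
  generalize S.Δ x = z
  induction z using TensorProduct.induction_on with
  | zero => simp
  | add a b ha hb => simp only [map_add, smul_add, ha, hb]
  | tmul a b => simp [hG q a, mul_assoc]

theorem par_π (n : ℕ) : S.Par 0 (S.π n) := by
  intro q x
  simp [S.π_sg]

theorem mul_rTensor_eq (G : C →ₗ[R] C) (x : C) :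
    LinearMap.mul' R C (TensorProduct.map G (S.π 0) (S.Δ x)) = G x := by
  have : TensorProduct.map G (S.π 0) = LinearMap.rTensor C G ∘ₗ LinearMap.lTensor C (S.π 0) := by
    rw [LinearMap.rTensor_comp_lTensor]
  rw [this, LinearMap.comp_apply, S.counit_right]
  simp

theorem π_one_conv_lin {G : C →ₗ[R] C} (hG : ∀ x, G x ∈ S.lin) (x : C) :
    S.π 1 (S.conv G x) = G x := by
  rw [← S.mul_rTensor_eq G x, conv_apply]
  generalize S.Δ x = z
  induction z using TensorProduct.induction_on with
  | zero => simp
  | add a b ha hb => simp only [map_add, ha, hb]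
  | tmul a b => simp [S.π_succ_lin_mul (hG a)]

theorem π_one_conv_quad {G : C →ₗ[R] C} (hG : ∀ x, G x ∈ S.quad) (x : C) :
    S.π 1 (S.conv G x) = 0 := by
  rw [conv_apply]
  generalize S.Δ x = z
  induction z using TensorProduct.induction_on with
  | zero => simp
  | add a b ha hb => simp only [map_add, ha, hb, add_zero]
  | tmul a b => simp [S.π_one_quad_mul (hG a)]

theorem π_two_conv_quad {G : C →ₗ[R] C} (hG : ∀ x, G x ∈ S.quad) (x : C) :
    S.π 2 (S.conv G x) = G x := by
  rw [← S.mul_rTensor_eq G x, conv_apply]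
  generalize S.Δ x = z
  induction z using TensorProduct.induction_on with
  | zero => simp
  | add a b ha hb => simp only [map_add, ha, hb]
  | tmul a b => simp [S.π_two_quad_mul (hG a)]

/-! ### Ordinary coderivations -/

/-- Ordinary coderivations, `ΔΩ = (Ω ⊗ 1)Δ + T(Ω ⊗ 1)Δ`. -/
def IsCod (F : C →ₗ[R] C) : Prop :=
  ∀ x, S.Δ (F x) = LinearMap.rTensor C F (S.Δ x) + S.T (LinearMap.rTensor C F (S.Δ x))

theorem isCoderivation_one_iff (F : C →ₗ[R] C) : IsCoderivation S.Δ S.o 1 F ↔ S.IsCod F := by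
  change deviationTwo S.Δ S.o F = 0 ↔ _
  rw [LinearMap.ext_iff]
  refine forall_congr' fun x => ?_
  simp only [deviationTwo, LinearMap.sub_apply, LinearMap.comp_apply, LinearMap.zero_apply]
  rw [sub_sub, sub_eq_zero]
  rfl

theorem isCod_iff {e : ℤ} {F : C →ₗ[R] C} (hF : S.Par e F) : S.IsCod F ↔ ∀ x, S.Δ (F x) =
    LinearMap.rTensor C F (S.Δ x) + TensorProduct.map (S.sg e).toLinearMap F (S.Δ x) := by
  simp only [IsCod, S.T_map_id hF, S.T_Δ]

theorem IsCod.sub {S : SymBialgebra R C} {F G : C →ₗ[R] C} (hF : S.IsCod F) (hG : S.IsCod G) :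
    S.IsCod (F - G) := by
  intro x
  simp only [LinearMap.sub_apply, map_sub, hF x, hG x, LinearMap.rTensor_sub]
  abel

/-- Convolution turns linear maps into the span of the generators into coderivations. -/
theorem isCod_conv {e : ℤ} {f : C →ₗ[R] C} (hf : S.Par e f) (hl : ∀ x, f x ∈ S.lin) :
    S.IsCod (S.conv f) := by
  rw [S.isCod_iff hf.conv]
  intro x
  revert e f
  refine S.induction (P := fun x => ∀ {e : ℤ} {f : C →ₗ[R] C}, S.Par e f → (∀ x, f x ∈ S.lin) →
    S.Δ (S.conv f x) = LinearMap.rTensor C (S.conv f) (S.Δ x) +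
      TensorProduct.map (S.sg e).toLinearMap (S.conv f) (S.Δ x)) ?_ ?_ ?_ ?_ x
  · intro e f hf hl
    rw [conv_one, S.Δ_lin (hl 1), S.Δ_one]
    simp [conv_one]
  · intro p w x hw ih e f hf hl
    have hfw := hf.comp (S.par_mulLeft hw)
    rw [S.conv_gen_mul hf hw, map_add, map_zsmul, S.Δ_mul hw, ih hf hl,
      ih hfw (fun x => hl _), S.Δ_mul hw]
    generalize S.Δ x = z
    induction z using TensorProduct.induction_on with
    | zero => simp
    | add a b ha hb =>
      simp only [map_add, smul_add] at ha hb ⊢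
      rw [← sub_eq_zero] at ha hb ⊢
      rw [← add_zero (0 : C ⊗[R] C)]
      nth_rewrite 2 [← hb]
      rw [← ha]
      abel
    | tmul a b =>
      simp only [LinearMap.rTensor_tmul, TensorProduct.map_tmul, AlgHom.toLinearMap_apply,
        map_add, prim_tmul, map_mul, S.conv_gen_mul hf hw, hf.conv p a, S.sg_gen hw,
        TensorProduct.add_tmul, TensorProduct.tmul_add, smul_add, smul_mul_assoc,
        TensorProduct.tmul_smul, ← TensorProduct.smul_tmul', sg_sg, add_comm p e, mul_comm p e]
      abel
  · intro x y hx hy e f hf hl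
    simp only [map_add, hx hf hl, hy hf hl]; abel
  · intro r x hx e f hf hl
    simp only [map_smul, hx hf hl, smul_add]

theorem rTensor_T {F : C →ₗ[R] C} (hF : S.Par 0 F) (z : C ⊗[R] C) :
    LinearMap.rTensor C F (S.T z) = S.T (LinearMap.lTensor C F z) := by
  rw [← S.T_T (LinearMap.rTensor C F (S.T z)), S.T_map_id hF, S.T_T, S.sg_even (by simp)]
  rfl

theorem lTensor_T {F : C →ₗ[R] C} (hF : S.Par 0 F) (z : C ⊗[R] C) :
    LinearMap.lTensor C F (S.T z) = S.T (LinearMap.rTensor C F z) := by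
  rw [S.T_map_id hF, S.sg_even (by simp)]
  rfl

theorem T_tmul_one (x : C) : S.T (x ⊗ₜ 1) = 1 ⊗ₜ x := by
  apply S.smul_two_cancel
  rw [two_T_tmul, map_one, two_smul]
  abel

theorem tmul_one_eq_zero {x : C} (h : x ⊗ₜ[R] (1 : C) = 0) : x = 0 := by
  simpa using congrArg (LinearMap.mul' R C) h

theorem IsCod.π_zero {S : SymBialgebra R C} {F : C →ₗ[R] C} (hF : S.IsCod F) (x : C) :
    S.π 0 (F x) = 0 := by
  have h := congrArg (LinearMap.rTensor C (S.π 0)) (hF x)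
  rw [S.counit_left, map_add, S.rTensor_T (S.par_π 0), ← LinearMap.comp_apply
    (LinearMap.lTensor C (S.π 0)), LinearMap.lTensor_comp_rTensor,
    ← LinearMap.rTensor_comp_lTensor, LinearMap.comp_apply, S.counit_right,
    LinearMap.rTensor_tmul, S.T_tmul_one, right_eq_add, ← LinearMap.comp_apply,
    ← LinearMap.rTensor_comp] at h
  have h2 := congrArg (LinearMap.lTensor C (S.π 0)) h
  rw [map_zero, ← LinearMap.comp_apply, LinearMap.lTensor_comp_rTensor,
    ← LinearMap.rTensor_comp_lTensor, LinearMap.comp_apply, S.counit_right,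
    LinearMap.rTensor_tmul] at h2
  exact tmul_one_eq_zero h2

/-! ### Uniqueness of coderivations with given leading terms -/

/-- The component of `Δ` in `C ⊗ W` lowers the word length of the first factor by exactly one. -/
theorem rTensor_lTensor_π_one_Δ {M : Type*} [AddCommGroup M] [Module R M] {n : ℕ} {F : C →ₗ[R] M}
    (hF : ∀ p x, S.IsWord n p x → F x = 0) {p x} (hx : S.IsWord (n + 1) p x) :
    LinearMap.rTensor C F (LinearMap.lTensor C (S.π 1) (S.Δ x)) = 0 := by
  have step : ∀ {p w x} (F : C →ₗ[R] M), w ∈ S.W p →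
      LinearMap.rTensor C F (LinearMap.lTensor C (S.π 1) (S.Δ (w * x))) =
      LinearMap.rTensor C (F ∘ₗ LinearMap.mulLeft R w) (LinearMap.lTensor C (S.π 1) (S.Δ x))
        + F (S.sg p x) ⊗ₜ w := by
    intro p w x F hw
    have h : F (S.sg p x) ⊗ₜ w = TensorProduct.map (F ∘ₗ (S.sg p).toLinearMap)
        (LinearMap.mulLeft R w) (LinearMap.lTensor C (S.π 0) (S.Δ x)) := by
      rw [S.counit_right]; simp
    rw [h, S.Δ_mul hw]
    generalize S.Δ x = z
    induction z using TensorProduct.induction_on with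
    | zero => simp
    | add a b ha hb => simp only [map_add, ha, hb]; abel
    | tmul a b => simp [S.π_succ_gen_mul hw]
  induction n generalizing F p x with
  | zero =>
    cases hx with
    | gen_mul hw hx =>
      cases hx
      rw [step F hw, S.Δ_one]
      simp [S.π_succ_one, hF _ _ IsWord.one]
  | succ n ih =>
    cases hx with
    | gen_mul hw hx =>
      rw [step F hw, hx.sg, map_zsmul, hF _ _ hx, ih _ hx]
      · simp
      · intro q y hy
        exact hF _ _ (.gen_mul hw hy)

theorem rTensor_lTensor_π_one_Δ_word {M : Type*} [AddCommGroup M] [Module R M] {n : ℕ}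
    {F : C →ₗ[R] M} (hF : ∀ m < n, ∀ p x, S.IsWord m p x → F x = 0) {p x} (hx : S.IsWord n p x) :
    LinearMap.rTensor C F (LinearMap.lTensor C (S.π 1) (S.Δ x)) = 0 := by
  cases n with
  | zero => cases hx; simp [S.Δ_one, S.π_succ_one]
  | succ n => exact S.rTensor_lTensor_π_one_Δ (hF n (by omega)) hx

theorem conv_π_one_gen_mul {p w} (hw : w ∈ S.W p) (x : C) :
    S.conv (S.π 1) (w * x) = w * x + w * S.conv (S.π 1) x := by
  rw [S.conv_gen_mul (S.par_π 1) hw]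
  have : S.π 1 ∘ₗ LinearMap.mulLeft R w = LinearMap.mulLeft R w ∘ₗ S.π 0 := by
    ext x; simp [S.π_succ_gen_mul hw]
  rw [this, conv_mulLeft, conv_π_zero]
  simp

/-- The convolution of `π₁` with the identity is multiplication by the word length. -/
theorem π_conv_π_one (n : ℕ) (x : C) : S.π n (S.conv (S.π 1) x) = n • S.π n x := by
  revert n
  refine S.induction (P := fun x => ∀ n : ℕ, S.π n (S.conv (S.π 1) x) = n • S.π n x) ?_ ?_ ?_ ?_ x
  · intro n
    cases n <;> simp [S.conv_one, S.π_succ_one]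
  · intro p w x hw hx n
    rw [S.conv_π_one_gen_mul hw, map_add]
    cases n with
    | zero => simp [S.π_zero_gen_mul hw]
    | succ n =>
      rw [S.π_succ_gen_mul hw, S.π_succ_gen_mul hw, hx, mul_smul_comm, succ_nsmul, add_comm]
  · intro x y hx hy n; simp only [map_add, smul_add, hx, hy]
  · intro r x hx n; simp only [map_smul, hx, smul_comm r]

/-- A coderivation is determined by its composition with `π₁`. -/
theorem IsCod.eq_zero {S : SymBialgebra R C} {F : C →ₗ[R] C} (hF : S.IsCod F)
    (h1 : ∀ x, S.π 1 (F x) = 0) : F = 0 := by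
  apply S.hom_eq_zero
  intro n
  induction n using Nat.strong_induction_on with
  | _ n ih =>
    intro p x hx
    -- Applied to `Δ F x = (F ⊗ 1) Δ x + T (F ⊗ 1) Δ x`, the map `π₁ ⊗ 1` kills the first term as
    -- `π₁ F = 0` and the second one by induction, so the word length kills `F x`.
    have h := congrArg (LinearMap.rTensor C (S.π 1)) (hF x)
    have h0 : S.π 1 ∘ₗ F = 0 := LinearMap.ext h1
    rw [map_add, ← LinearMap.comp_apply, ← LinearMap.comp_apply (LinearMap.rTensor C (S.π 1)),
      ← LinearMap.rTensor_comp, h0, S.rTensor_T (S.par_π 1), ← LinearMap.comp_apply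
      (LinearMap.lTensor C (S.π 1)), LinearMap.lTensor_comp_rTensor,
      ← LinearMap.rTensor_comp_lTensor, LinearMap.comp_apply (LinearMap.rTensor C F),
      S.rTensor_lTensor_π_one_Δ_word ih hx] at h
    have h2 : S.conv (S.π 1) (F x) = 0 := by
      rw [conv_apply]
      rw [LinearMap.comp_apply] at h
      rw [h]; simp
    apply S.eq_zero_of_π
    intro n
    cases n with
    | zero => exact hF.π_zero x
    | succ n =>
      apply S.eq_zero_of_nsmul (Nat.succ_ne_zero n)
      rw [← π_conv_π_one, h2, map_zero]

/-- Every coderivation is the convolution of its linear part with the identity. -/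
theorem IsCod.eq_conv {S : SymBialgebra R C} {e : ℤ} {F : C →ₗ[R] C} (hF : S.IsCod F)
    (he : S.Par e F) : F = S.conv (S.π 1 ∘ₗ F) := by
  rw [← sub_eq_zero]
  have hp : S.Par (0 + e) (S.π 1 ∘ₗ F) := (S.par_π 1).comp he
  refine IsCod.eq_zero (S := S) (hF.sub (S.isCod_conv hp fun x => S.π_one_mem_lin _)) ?_
  intro x
  rw [LinearMap.sub_apply, map_sub, S.π_one_conv_lin (G := S.π 1 ∘ₗ F) (fun x => S.π_one_mem_lin _)]
  simp

/-- The square of an odd coderivation is a coderivation. -/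
theorem IsCod.sq {S : SymBialgebra R C} {e : ℤ} {F : C →ₗ[R] C} (hF : S.IsCod F)
    (he : S.Par e F) (hodd : Odd e) : S.IsCod (F ∘ₗ F) := by
  rw [S.isCod_iff (he.comp he)]
  have h := (S.isCod_iff he).1 hF
  intro x
  rw [LinearMap.comp_apply, h, h]
  generalize S.Δ x = z
  induction z using TensorProduct.induction_on with
  | zero => simp
  | add a b ha hb =>
    simp only [map_add] at ha hb ⊢
    rw [← sub_eq_zero] at ha hb ⊢
    rw [← add_zero (0 : C ⊗[R] C)]
    nth_rewrite 2 [← hb]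
    rw [← ha]
    abel
  | tmul a b =>
    simp only [LinearMap.rTensor_tmul, TensorProduct.map_tmul, AlgHom.toLinearMap_apply, he e a,
      sg_sg, map_add, Int.negOnePow_odd _ (hodd.mul hodd), LinearMap.comp_apply, Units.val_neg,
      Units.val_one, neg_smul, one_smul, TensorProduct.neg_tmul]
    abel

end SymBialgebra

namespace SymBialgebra

variable {R C : Type*} [CommRing R] [Ring C] [Algebra R C] (S : SymBialgebra R C)

/-! ### Order two coderivations -/

/-- The deviation `Ψ³` of an endomorphism. -/
def dev3 : (C →ₗ[R] C) →ₗ[R] (C →ₗ[R] (C ⊗[R] C) ⊗[R] C) where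
  toFun F := deviationStep S.Δ S.o (deviationTwo S.Δ S.o F)
  map_add' F G := by
    ext x
    simp only [deviationStep, deviationTwo, LinearMap.rTensor_add, LinearMap.rTensor_sub,
      LinearMap.sub_apply, LinearMap.add_apply, LinearMap.comp_apply, map_add, map_sub,
      LinearMap.comp_add, LinearMap.add_comp, LinearMap.rTensor_comp]
    abel
  map_smul' r F := by
    ext x
    simp only [deviationStep, deviationTwo, LinearMap.rTensor_smul, LinearMap.rTensor_sub,
      LinearMap.sub_apply, LinearMap.smul_apply, LinearMap.comp_apply, map_smul, map_sub,
      LinearMap.comp_smul, LinearMap.smul_comp, LinearMap.rTensor_comp, RingHom.id_apply, smul_sub]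

theorem dev3_sub {F G : C →ₗ[R] C} (hF : S.dev3 F = 0) (hG : S.dev3 G = 0) :
    S.dev3 (F - G) = 0 := by
  have key := map_add S.dev3 (F - G) G
  rw [sub_add_cancel, hF, hG] at key
  refine LinearMap.ext fun x => ?_
  simpa using (LinearMap.congr_fun key x).symm

/-- A term of the form `(X ⊗ L_v) Δ` of the second deviation does not contribute to the third one,
since `w ⊗ 1 + 1 ⊗ w` is the sum of `w ⊗ 1` and its flip. -/
theorem deviationStep_map_mulLeft {p v} (hv : v ∈ S.W p) (X : C →ₗ[R] C) :
    deviationStep S.Δ S.o (TensorProduct.map X (LinearMap.mulLeft R v) ∘ₗ S.Δ) = 0 := by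
  ext x
  simp only [deviationStep, LinearMap.sub_apply, LinearMap.comp_apply, LinearMap.zero_apply,
    LinearEquiv.coe_coe, LinearMap.rTensor_comp]
  set u := LinearMap.lTensor C S.Δ (S.Δ x) with hu
  have hu2 : LinearMap.rTensor C S.Δ (S.Δ x) = (TensorProduct.assoc R C C C).symm u := by
    rw [hu, ← S.coassoc, LinearEquiv.symm_apply_apply]
  have hu3 : LinearMap.lTensor C S.T u = u := by
    rw [hu, ← LinearMap.comp_apply, ← LinearMap.lTensor_comp]
    congr 2
    exact LinearMap.ext S.T_Δ
  have h1 : LinearMap.lTensor C S.Δ (TensorProduct.map X (LinearMap.mulLeft R v) (S.Δ x))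
      = TensorProduct.map X (S.prim p v) u := by
    rw [hu]
    generalize S.Δ x = z
    induction z using TensorProduct.induction_on with
    | zero => simp
    | add a b ha hb => simp only [map_add, ha, hb]
    | tmul a b => simp [S.Δ_mul hv]
  have h2 : ∀ u, LinearMap.rTensor C (TensorProduct.map X (LinearMap.mulLeft R v))
      ((TensorProduct.assoc R C C C).symm u) = (TensorProduct.assoc R C C C).symm
        (TensorProduct.map X (LinearMap.rTensor C (LinearMap.mulLeft R v)) u) := by
    intro u
    obtain ⟨u, rfl⟩ := (TensorProduct.assoc R C C C).surjective u
    rw [LinearEquiv.symm_apply_apply]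
    induction u using TensorProduct.induction_on with
    | zero => simp
    | add a b ha hb => simp only [map_add, ha, hb]
    | tmul a b =>
      induction a using TensorProduct.induction_on with
      | zero => simp
      | add c d hc hd => simp only [TensorProduct.add_tmul, map_add, hc, hd]
      | tmul c d => simp
  have h3 : S.prim p v = LinearMap.rTensor C (LinearMap.mulLeft R v) +
      S.T ∘ₗ LinearMap.rTensor C (LinearMap.mulLeft R v) ∘ₗ S.T :=
    LinearMap.ext fun z => S.prim_eq hv z
  rw [h1, hu2, h2, LinearEquiv.apply_symm_apply, h3, TensorProduct.map_add_right,
    LinearMap.add_apply, map_add, add_sub_cancel_left, sub_eq_zero]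
  congr 1
  have h4 : TensorProduct.map X (S.T ∘ₗ LinearMap.rTensor C (LinearMap.mulLeft R v) ∘ₗ S.T) =
      LinearMap.lTensor C S.T ∘ₗ TensorProduct.map X (LinearMap.rTensor C (LinearMap.mulLeft R v))
        ∘ₗ LinearMap.lTensor C S.T := by
    apply TensorProduct.ext'
    intro a b
    simp
  rw [h4, LinearMap.comp_apply, LinearMap.comp_apply, hu3]
  rfl

/-- Multiplication by a product of two generators is an order two coderivation. -/
theorem dev3_mulLeft {p q v w} (hv : v ∈ S.W p) (hw : w ∈ S.W q) :
    S.dev3 (LinearMap.mulLeft R (v * w)) = 0 := by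
  have hM : LinearMap.mulLeft R (v * w) = LinearMap.mulLeft R v ∘ₗ LinearMap.mulLeft R w := by
    ext x; simp
  have hpar : S.Par (p + q) (LinearMap.mulLeft R (v * w)) := by
    rw [hM]; exact (S.par_mulLeft hv).comp (S.par_mulLeft hw)
  have h2 : deviationTwo S.Δ S.o (LinearMap.mulLeft R (v * w)) =
      TensorProduct.map (LinearMap.mulLeft R v ∘ₗ (S.sg q).toLinearMap) (LinearMap.mulLeft R w) ∘ₗ
          S.Δ +
      TensorProduct.map ((S.sg p).toLinearMap ∘ₗ LinearMap.mulLeft R w) (LinearMap.mulLeft R v) ∘ₗ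
          S.Δ := by
    ext x
    simp only [deviationTwo, LinearMap.sub_apply, LinearMap.comp_apply, LinearMap.add_apply,
      LinearMap.mulLeft_apply]
    change _ - _ - S.T _ = _
    rw [S.T_map_id hpar, S.T_Δ, mul_assoc, S.Δ_mul hv, S.Δ_mul hw]
    generalize S.Δ x = z
    induction z using TensorProduct.induction_on with
    | zero => simp
    | add a b ha hb =>
      simp only [map_add] at ha hb ⊢
      rw [← sub_eq_zero] at ha hb ⊢
      rw [← add_zero (0 : C ⊗[R] C)]
      nth_rewrite 2 [← hb]
      rw [← ha]
      abel
    | tmul a b =>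
      simp only [prim_tmul, map_add, LinearMap.rTensor_tmul, TensorProduct.map_tmul,
        LinearMap.mulLeft_apply, AlgHom.toLinearMap_apply, mul_assoc, LinearMap.comp_apply, sg_sg]
      abel
  have hadd : ∀ F G : C →ₗ[R] C ⊗[R] C, deviationStep S.Δ S.o (F + G) =
      deviationStep S.Δ S.o F + deviationStep S.Δ S.o G := by
    intro F G
    simp only [deviationStep, LinearMap.comp_add, LinearMap.add_comp, LinearMap.rTensor_add]
    abel
  change deviationStep S.Δ S.o (deviationTwo S.Δ S.o _) = 0
  rw [h2, hadd, S.deviationStep_map_mulLeft hw, S.deviationStep_map_mulLeft hv, add_zero]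

/-! ### Uniqueness of order two coderivations with given leading terms -/

theorem dev3_apply (F : C →ₗ[R] C) (x : C) : S.dev3 F x =
    (TensorProduct.assoc R C C C).symm (LinearMap.lTensor C S.Δ (deviationTwo S.Δ S.o F x))
    - LinearMap.rTensor C (deviationTwo S.Δ S.o F) (S.Δ x)
    - (TensorProduct.assoc R C C C).symm (LinearMap.lTensor C S.T (TensorProduct.assoc R C C C
        (LinearMap.rTensor C (deviationTwo S.Δ S.o F) (S.Δ x)))) := rfl

theorem deviationTwo_apply (F : C →ₗ[R] C) (x : C) : deviationTwo S.Δ S.o F x =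
    S.Δ (F x) - LinearMap.rTensor C F (S.Δ x) - S.T (LinearMap.rTensor C F (S.Δ x)) := rfl

theorem mul_map_π_zero_T (z : C ⊗[R] C) :
    LinearMap.mul' R C (TensorProduct.map (S.π 0) (S.π 0) (S.T z)) =
      LinearMap.mul' R C (TensorProduct.map (S.π 0) (S.π 0) z) := by
  have h1 : ∀ z, TensorProduct.map (S.π 0) (S.π 0) z =
      LinearMap.rTensor C (S.π 0) (LinearMap.lTensor C (S.π 0) z) := fun z => by
    rw [← LinearMap.comp_apply, LinearMap.rTensor_comp_lTensor]
  have h2 : ∀ z, TensorProduct.map (S.π 0) (S.π 0) z =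
      LinearMap.lTensor C (S.π 0) (LinearMap.rTensor C (S.π 0) z) := fun z => by
    rw [← LinearMap.comp_apply, LinearMap.lTensor_comp_rTensor]
  rw [h1, S.lTensor_T (S.par_π 0), S.rTensor_T (S.par_π 0), ← h2]
  induction z using TensorProduct.induction_on with
  | zero => simp
  | add a b ha hb => simp only [map_add, ha, hb]
  | tmul a b =>
    obtain ⟨r, hr⟩ := S.exists_π_zero_eq a
    obtain ⟨r', hr'⟩ := S.exists_π_zero_eq b
    rw [TensorProduct.map_tmul, hr, hr', TensorProduct.tmul_smul, ← TensorProduct.smul_tmul']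
    simp only [map_smul, S.T_tmul_one]

theorem map_π_zero_Δ (x : C) : TensorProduct.map (S.π 0) (S.π 0) (S.Δ x) = 1 ⊗ₜ S.π 0 x := by
  rw [← LinearMap.lTensor_comp_rTensor, LinearMap.comp_apply, S.counit_left]
  simp

theorem π_zero_of_dev3 {F : C →ₗ[R] C} (hF : S.dev3 F = 0) (x : C) : S.π 0 (F x) = 0 := by
  set q : C →ₗ[R] C := LinearMap.mul' R C ∘ₗ TensorProduct.map (S.π 0) (S.π 0) ∘ₗ
    deviationTwo S.Δ S.o F with hq
  have hqx : q x = - S.π 0 (F x) := by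
    have h1 : TensorProduct.map (S.π 0) (S.π 0) (LinearMap.rTensor C F (S.Δ x))
        = S.π 0 (F x) ⊗ₜ 1 := by
      rw [← LinearMap.comp_apply, LinearMap.map_comp_rTensor]
      rw [← LinearMap.rTensor_comp_lTensor, LinearMap.comp_apply, S.counit_right]
      rfl
    rw [hq, LinearMap.comp_apply, LinearMap.comp_apply, S.deviationTwo_apply, map_sub, map_sub,
      map_sub, map_sub, S.mul_map_π_zero_T, h1, S.map_π_zero_Δ]
    simp
  -- The map `π₀ ⊗ π₀ ⊗ π₀`, followed by multiplication, sends all three terms of `Ψ³` to `± q x`.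
  set E : (C ⊗[R] C) ⊗[R] C →ₗ[R] C := LinearMap.mul' R C ∘ₗ TensorProduct.map
    (LinearMap.mul' R C ∘ₗ TensorProduct.map (S.π 0) (S.π 0)) (S.π 0) with hE
  have e2 : E (LinearMap.rTensor C (deviationTwo S.Δ S.o F) (S.Δ x)) = q x := by
    rw [hE, LinearMap.comp_apply, ← LinearMap.comp_apply (TensorProduct.map _ _),
      LinearMap.map_comp_rTensor, LinearMap.comp_assoc, ← hq, S.mul_rTensor_eq]
  have hEa : ∀ z, E ((TensorProduct.assoc R C C C).symm z) = LinearMap.mul' R C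
      (TensorProduct.map (S.π 0) (LinearMap.mul' R C ∘ₗ TensorProduct.map (S.π 0) (S.π 0)) z) := by
    intro z
    obtain ⟨u, rfl⟩ := (TensorProduct.assoc R C C C).surjective z
    rw [LinearEquiv.symm_apply_apply, hE]
    induction u using TensorProduct.induction_on with
    | zero => simp
    | add a b ha hb => simp only [map_add, ha, hb]
    | tmul a b =>
      induction a using TensorProduct.induction_on with
      | zero => simp
      | add c d hc hd => simp only [TensorProduct.add_tmul, map_add, hc, hd]
      | tmul c d => simp [mul_assoc]
  have e1 : E ((TensorProduct.assoc R C C C).symm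
      (LinearMap.lTensor C S.Δ (deviationTwo S.Δ S.o F x))) = q x := by
    rw [hEa, hq]
    simp only [LinearMap.comp_apply]
    generalize deviationTwo S.Δ S.o F x = z
    induction z using TensorProduct.induction_on with
    | zero => simp
    | add a b ha hb => simp only [map_add, ha, hb]
    | tmul a b => simp [S.map_π_zero_Δ]
  have e3 : E ((TensorProduct.assoc R C C C).symm (LinearMap.lTensor C S.T
      (TensorProduct.assoc R C C C (LinearMap.rTensor C (deviationTwo S.Δ S.o F) (S.Δ x)))))
        = q x := by
    rw [← e2]
    generalize LinearMap.rTensor C (deviationTwo S.Δ S.o F) (S.Δ x) = u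
    obtain ⟨u, rfl⟩ := (TensorProduct.assoc R C C C).symm.surjective u
    rw [LinearEquiv.apply_symm_apply, hEa, hEa]
    induction u using TensorProduct.induction_on with
    | zero => simp
    | add a b ha hb => simp only [map_add, ha, hb]
    | tmul a b => simp [S.mul_map_π_zero_T]
  have h := congrArg E (LinearMap.congr_fun hF x)
  rw [S.dev3_apply, map_sub, map_sub, e1, e2, e3, hqx] at h
  simpa using h

/-- The component of `Δ x` in `W ⊗ W` depends only on `π₂ x`. -/
theorem map_π_one_Δ_of_π_two (x : C) (hx : S.π 2 x = 0) :
    LinearMap.lTensor C (S.π 1) (LinearMap.rTensor C (S.π 1) (S.Δ x)) = 0 := by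
  have step : ∀ {p w} x, w ∈ S.W p →
      LinearMap.lTensor C (S.π 1) (LinearMap.rTensor C (S.π 1) (S.Δ (w * x))) =
      w ⊗ₜ S.π 1 x + S.sg p (S.π 1 x) ⊗ₜ w := by
    intro p w x hw
    have h1 : w ⊗ₜ[R] S.π 1 x = TensorProduct.map (LinearMap.mulLeft R w) (S.π 1)
        (LinearMap.rTensor C (S.π 0) (S.Δ x)) := by
      rw [S.counit_left]; simp
    have h2 : S.sg p (S.π 1 x) ⊗ₜ[R] w = TensorProduct.map ((S.sg p).toLinearMap ∘ₗ S.π 1)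
        (LinearMap.mulLeft R w) (LinearMap.lTensor C (S.π 0) (S.Δ x)) := by
      rw [S.counit_right]; simp
    rw [h1, h2, S.Δ_mul hw]
    generalize S.Δ x = z
    induction z using TensorProduct.induction_on with
    | zero => simp
    | add a b ha hb => simp only [map_add, ha, hb]; abel
    | tmul a b => simp [S.π_succ_gen_mul hw, S.π_sg]
  have key : LinearMap.lTensor C (S.π 1) (LinearMap.rTensor C (S.π 1) (S.Δ x)) =
      LinearMap.lTensor C (S.π 1) (LinearMap.rTensor C (S.π 1) (S.Δ (S.π 2 x))) := by
    refine S.induction (P := fun x =>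
      LinearMap.lTensor C (S.π 1) (LinearMap.rTensor C (S.π 1) (S.Δ x)) =
      LinearMap.lTensor C (S.π 1) (LinearMap.rTensor C (S.π 1) (S.Δ (S.π 2 x)))) ?_ ?_ ?_ ?_ x
    · simp [S.Δ_one, S.π_succ_one]
    · intro p w x hw _
      rw [step x hw, S.π_succ_gen_mul hw, step _ hw, S.π_π]
    · intro x y hx hy; simp only [map_add, hx, hy]
    · intro r x hx; simp only [map_smul, hx]
  rw [key, hx]
  simp

/-- Splitting off two generators and multiplying back is `n (n - 1)` on words of length `n`. -/
theorem π_mul_map_π_one_conv (n : ℕ) (x : C) :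
    S.π n (LinearMap.mul' R C (TensorProduct.map (S.π 1) (S.conv (S.π 1)) (S.Δ x)))
      = (n * (n - 1)) • S.π n x := by
  have step : ∀ {p w} x, w ∈ S.W p →
      LinearMap.mul' R C (TensorProduct.map (S.π 1) (S.conv (S.π 1)) (S.Δ (w * x))) =
      w * S.conv (S.π 1) x + w * S.conv (S.π 1) x +
      w * LinearMap.mul' R C (TensorProduct.map (S.π 1) (S.conv (S.π 1)) (S.Δ x)) := by
    intro p w x hw
    have h1 : S.conv (S.π 1) x = LinearMap.mul' R C (LinearMap.lTensor C (S.conv (S.π 1))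
        (LinearMap.rTensor C (S.π 0) (S.Δ x))) := by
      rw [S.counit_left]; simp
    nth_rewrite 1 [h1]
    rw [S.conv_apply (S.π 1) x, S.Δ_mul hw]
    generalize S.Δ x = z
    induction z using TensorProduct.induction_on with
    | zero => simp
    | add a b ha hb => simp only [map_add, mul_add, ha, hb]; abel
    | tmul a b =>
      simp only [prim_tmul, map_add, TensorProduct.map_tmul, LinearMap.mul'_apply,
        S.π_succ_gen_mul hw, S.π_sg, S.conv_π_one_gen_mul hw, mul_add, LinearMap.rTensor_tmul,
        LinearMap.lTensor_tmul]
      rw [← mul_assoc (S.sg p _), S.sg_mul_gen hw, ← mul_assoc (S.sg p _), S.sg_mul_gen hw]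
      simp only [mul_assoc]
      abel
  revert n
  refine S.induction (P := fun x => ∀ n : ℕ,
    S.π n (LinearMap.mul' R C (TensorProduct.map (S.π 1) (S.conv (S.π 1)) (S.Δ x)))
      = (n * (n - 1)) • S.π n x) ?_ ?_ ?_ ?_ x
  · intro n
    cases n <;> simp [S.Δ_one, S.π_succ_one]
  · intro p w x hw hx n
    rw [step x hw, map_add, map_add]
    cases n with
    | zero => simp [S.π_zero_gen_mul hw]
    | succ n =>
      simp only [S.π_succ_gen_mul hw, hx, π_conv_π_one, mul_smul_comm, ← add_smul]
      congr 1
      cases n with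
      | zero => simp
      | succ n => simp only [Nat.add_sub_cancel]; ring
  · intro x y hx hy n; simp only [map_add, smul_add, hx, hy]
  · intro r x hx n; simp only [map_smul, hx, smul_comm r]

/-- An order two coderivation is determined by its compositions with `π₁` and `π₂`. -/
theorem eq_zero_of_dev3 {F : C →ₗ[R] C} (hF : S.dev3 F = 0) (h1 : ∀ x, S.π 1 (F x) = 0)
    (h2 : ∀ x, S.π 2 (F x) = 0) : F = 0 := by
  have h10 : S.π 1 ∘ₗ F = 0 := LinearMap.ext h1
  set Ψ := deviationTwo S.Δ S.o F with hΨ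
  have hG : ∀ x, LinearMap.rTensor C (S.π 1) (Ψ x) = LinearMap.rTensor C (S.π 1) (S.Δ (F x)) -
      S.T (LinearMap.rTensor C F (LinearMap.lTensor C (S.π 1) (S.Δ x))) := by
    intro x
    rw [hΨ, S.deviationTwo_apply, map_sub, map_sub,
      ← LinearMap.comp_apply (LinearMap.rTensor C (S.π 1)) (LinearMap.rTensor C F),
      ← LinearMap.rTensor_comp, h10, S.rTensor_T (S.par_π 1),
      ← LinearMap.comp_apply (LinearMap.lTensor C (S.π 1)), LinearMap.lTensor_comp_rTensor,
      ← LinearMap.rTensor_comp_lTensor, LinearMap.rTensor_zero, LinearMap.zero_apply, sub_zero,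
      LinearMap.comp_apply]
  have h11 : TensorProduct.map (S.π 1) (S.π 1) ∘ₗ Ψ = 0 := by
    ext x
    rw [← LinearMap.lTensor_comp_rTensor, LinearMap.comp_apply, LinearMap.comp_apply, hG, map_sub,
      S.map_π_one_Δ_of_π_two _ (h2 x), S.lTensor_T (S.par_π 1), ← LinearMap.comp_apply
      (LinearMap.rTensor C (S.π 1)), ← LinearMap.rTensor_comp, h10]
    simp
  -- The image of `Ψ³ = 0` under `π₁ ⊗ π₁ ⊗ 1`.
  have key : ∀ x, LinearMap.lTensor C (LinearMap.rTensor C (S.π 1) ∘ₗ S.Δ)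
      (LinearMap.rTensor C (S.π 1) (Ψ x)) =
      LinearMap.lTensor C S.T (TensorProduct.assoc R C C C
        (LinearMap.rTensor C (LinearMap.rTensor C (S.π 1) ∘ₗ Ψ)
          (LinearMap.lTensor C (S.π 1) (S.Δ x)))) := by
    intro x
    have h := congrArg (LinearMap.rTensor C (TensorProduct.map (S.π 1) (S.π 1)))
      (LinearMap.congr_fun hF x)
    rw [S.dev3_apply, ← hΨ, map_sub, map_sub, ← LinearMap.comp_apply
      (LinearMap.rTensor C (TensorProduct.map (S.π 1) (S.π 1))) (LinearMap.rTensor C Ψ),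
      ← LinearMap.rTensor_comp, h11] at h
    simp only [LinearMap.rTensor_zero, LinearMap.zero_apply, sub_zero, map_zero, sub_eq_zero] at h
    have ha : ∀ u, LinearMap.rTensor C (TensorProduct.map (S.π 1) (S.π 1))
        ((TensorProduct.assoc R C C C).symm u) = (TensorProduct.assoc R C C C).symm
          (TensorProduct.map (S.π 1) (LinearMap.rTensor C (S.π 1)) u) := by
      intro u
      obtain ⟨u, rfl⟩ := (TensorProduct.assoc R C C C).surjective u
      rw [LinearEquiv.symm_apply_apply]
      induction u using TensorProduct.induction_on with
      | zero => simp
      | add a b ha hb => simp only [map_add, ha, hb]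
      | tmul a b =>
        induction a using TensorProduct.induction_on with
        | zero => simp
        | add c d hc hd => simp only [TensorProduct.add_tmul, map_add, hc, hd]
        | tmul c d => simp
    rw [ha, ha] at h
    have h' := (TensorProduct.assoc R C C C).symm.injective h
    have hl : ∀ z, TensorProduct.map (S.π 1) (LinearMap.rTensor C (S.π 1))
        (LinearMap.lTensor C S.Δ z) = LinearMap.lTensor C (LinearMap.rTensor C (S.π 1) ∘ₗ S.Δ)
          (LinearMap.rTensor C (S.π 1) z) := by
      intro z
      induction z using TensorProduct.induction_on with
      | zero => simp
      | add a b ha hb => simp only [map_add, ha, hb]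
      | tmul a b => simp
    have hr : ∀ z, TensorProduct.map (S.π 1) (LinearMap.rTensor C (S.π 1))
        (LinearMap.lTensor C S.T (TensorProduct.assoc R C C C z)) =
        LinearMap.lTensor C S.T (TensorProduct.assoc R C C C
          (TensorProduct.map (LinearMap.rTensor C (S.π 1)) (S.π 1) z)) := by
      intro z
      induction z using TensorProduct.induction_on with
      | zero => simp
      | add a b ha hb => simp only [map_add, ha, hb]
      | tmul a b =>
        induction a using TensorProduct.induction_on with
        | zero => simp
        | add c d hc hd => simp only [TensorProduct.add_tmul, map_add, hc, hd]
        | tmul c d => simp [S.rTensor_T (S.par_π 1)]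
    rw [hl, hr] at h'
    rw [h']
    congr 2
    generalize S.Δ x = z
    induction z using TensorProduct.induction_on with
    | zero => simp
    | add a b ha hb => simp only [map_add, ha, hb]
    | tmul a b => simp
  apply S.hom_eq_zero
  intro n
  induction n using Nat.strong_induction_on with
  | _ n ih =>
    have hGm : ∀ m ≤ n, ∀ p x, S.IsWord m p x → LinearMap.rTensor C (S.π 1) (Ψ x) =
        LinearMap.rTensor C (S.π 1) (S.Δ (F x)) := by
      intro m hm p x hx
      rw [hG, S.rTensor_lTensor_π_one_Δ_word (fun i hi => ih i (by omega)) hx]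
      simp
    -- On words of length `n`, the right hand side of `key` vanishes by induction, and its left hand
    -- side becomes `n (n - 1) F x` after multiplication of the three factors.
    intro p x hx
    have hk := key x
    rw [hGm n le_rfl p x hx, S.rTensor_lTensor_π_one_Δ_word (F := LinearMap.rTensor C (S.π 1) ∘ₗ Ψ)
      (n := n) ?_ hx, map_zero, map_zero] at hk
    · have h3 : LinearMap.mul' R C
          (TensorProduct.map (S.π 1) (S.conv (S.π 1)) (S.Δ (F x))) = 0 := by
        have : TensorProduct.map (S.π 1) (S.conv (S.π 1)) =
            LinearMap.lTensor C (LinearMap.mul' R C) ∘ₗ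
            LinearMap.lTensor C (LinearMap.rTensor C (S.π 1) ∘ₗ S.Δ) ∘ₗ
            LinearMap.rTensor C (S.π 1) := by
          apply TensorProduct.ext'
          intro a b
          simp [conv_apply]
        rw [this, LinearMap.comp_apply, LinearMap.comp_apply, hk]
        simp
      apply S.eq_zero_of_π
      intro m
      match m with
      | 0 => exact S.π_zero_of_dev3 hF x
      | 1 => exact h1 x
      | m + 2 =>
        apply S.eq_zero_of_nsmul (n := (m + 2) * (m + 2 - 1)) (by simp)
        rw [← π_mul_map_π_one_conv, h3, map_zero]
    · intro m hm p y hy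
      rw [LinearMap.comp_apply, hGm m hm.le p y hy, ih m hm p y hy]
      simp

/-! ### The square of `δ + θ` -/

theorem negOnePow_smul_congr {M : Type*} [AddCommGroup M] {p q : ℤ} (h : Even (p - q)) (x : M) :
    (p.negOnePow : ℤ) • x = (q.negOnePow : ℤ) • x := by
  rw [negOnePow_congr h]

/-- The anticommutator of `conv f` with the multiplication by an odd product of two generators. -/
theorem conv_anticomm {e p q v w} {f : C →ₗ[R] C} (hf : S.Par e f) (he : Odd e) (hv : v ∈ S.W p)
    (hw : w ∈ S.W q) (hpq : Odd (p + q)) :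
    S.conv f ∘ₗ LinearMap.mulLeft R (v * w) + LinearMap.mulLeft R (v * w) ∘ₗ S.conv f =
      S.conv (f ∘ₗ LinearMap.mulLeft R (v * w)
        + (q.negOnePow : ℤ) • (LinearMap.mulLeft R w ∘ₗ f ∘ₗ LinearMap.mulLeft R v)
        + (p.negOnePow : ℤ) • (LinearMap.mulLeft R v ∘ₗ f ∘ₗ LinearMap.mulLeft R w)) := by
  have hM : LinearMap.mulLeft R (v * w) = LinearMap.mulLeft R v ∘ₗ LinearMap.mulLeft R w := by
    ext x; simp
  rw [map_add, map_add, map_zsmul, map_zsmul, S.conv_mulLeft, S.conv_mulLeft]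
  ext x
  have hfv := hf.comp (S.par_mulLeft hv)
  simp only [hM, LinearMap.add_apply, LinearMap.comp_apply, LinearMap.mulLeft_apply,
    LinearMap.smul_apply, S.conv_gen_mul hf hv, S.conv_gen_mul hf hw, S.conv_gen_mul hfv hw,
    mul_add, smul_add, mul_smul_comm, negOnePow_smul_smul]
  have h1 : Even ((e + p) * q - q) := by
    rcases Int.even_or_odd q with hq | hq
    · exact (hq.mul_left _).sub hq
    · have hp : Even p := by
        rcases Int.even_or_odd p with hp | hp
        · exact hp
        · exact absurd (hp.add_odd hq) (by simpa using hpq)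
      exact ((he.add_even hp).mul hq).sub_odd hq
  have h2 : Even (e * p - p) := by
    have : e * p - p = (e - 1) * p := by ring
    rw [this]; exact (he.sub_odd odd_one).mul_right p
  have h3 : Even (e * p + e * q - 1) := by
    have : e * p + e * q - 1 = e * (p + q) - 1 := by ring
    rw [this]; exact (he.mul hpq).sub_odd odd_one
  rw [negOnePow_smul_congr h1, negOnePow_smul_congr h2, negOnePow_smul_congr h3,
    LinearMap.comp_assoc]
  simp only [Int.negOnePow_one, Units.val_neg, Units.val_one, neg_smul, one_smul]
  abel

/-- Odd sums of products of two generators have square zero. -/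
theorem mul_self_eq_zero_of_quad {ι : Type*} [Fintype ι] {v w : ι → C} {p q : ι → ℤ}
    (hv : ∀ i, v i ∈ S.W (p i)) (hw : ∀ i, w i ∈ S.W (q i)) (hpq : ∀ i, Odd (p i + q i)) :
    (∑ i, v i * w i) * (∑ i, v i * w i) = 0 := by
  have hc : ∀ x, (∑ i, v i * w i) * x = S.s x * ∑ i, v i * w i := by
    intro x
    rw [Finset.sum_mul, Finset.mul_sum]
    refine Finset.sum_congr rfl fun i _ => ?_
    rw [mul_assoc, S.gen_mul_comm (hw i), ← mul_assoc, S.gen_mul_comm (hv i), S.sg_sg,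
      S.sg_odd (hpq i), mul_assoc]
  have hs : S.s (∑ i, v i * w i) = - ∑ i, v i * w i := by
    rw [map_sum, ← Finset.sum_neg_distrib]
    refine Finset.sum_congr rfl fun i _ => ?_
    rw [map_mul, S.s_gen (hv i), S.s_gen (hw i), smul_mul_smul_comm, ← Units.val_mul,
      ← Int.negOnePow_add, Int.negOnePow_odd _ (hpq i)]
    simp
  apply S.eq_zero_of_eq_neg
  nth_rewrite 1 [hc]
  rw [hs, neg_mul]

end SymBialgebra

section ExtBasic

variable {k V : Type*} [Field k] [AddCommGroup V] [Module k V] (𝒲 : ℤ → Submodule k V)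

/-! ### The graded commutative algebra `∧W` as an instance -/

theorem ext_mem_of_gen_mul [DirectSum.Decomposition 𝒲] (N : Submodule k (Ext 𝒲)) (one : 1 ∈ N)
    (gen_mul : ∀ p w x, w ∈ 𝒲 p → x ∈ N → gen 𝒲 w * x ∈ N) (x : Ext 𝒲) : x ∈ N := by
  have hg : ∀ w x, x ∈ N → gen 𝒲 w * x ∈ N := by
    intro w x hx
    induction w using DirectSum.Decomposition.inductionOn 𝒲 with
    | zero => simp
    | homogeneous w => exact gen_mul _ _ _ w.2 hx
    | add v w hv hw => rw [map_add, add_mul]; exact add_mem hv hw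
  obtain ⟨a, rfl⟩ := RingQuot.mkAlgHom_surjective k (ExtRel 𝒲) x
  suffices h : ∀ x ∈ N, extMk 𝒲 a * x ∈ N by
    have := h 1 one
    rwa [mul_one] at this
  induction a using TensorAlgebra.induction with
  | algebraMap r =>
    intro x hx
    rw [AlgHom.commutes, ← Algebra.smul_def]
    exact N.smul_mem _ hx
  | ι w => exact fun x hx => hg w x hx
  | mul a b ha hb =>
    intro x hx
    rw [map_mul, mul_assoc]
    exact ha _ (hb _ hx)
  | add a b ha hb =>
    intro x hx
    rw [map_add, add_mul]
    exact add_mem (ha _ hx) (hb _ hx)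

theorem extLength_gen_mul (w : V) (x : Ext 𝒲) :
    extLength 𝒲 (gen 𝒲 w * x) = Polynomial.monomial 1 (gen 𝒲 w) * extLength 𝒲 x := by
  rw [map_mul]
  congr 1
  exact extLift_gen 𝒲 _ _ w

theorem extProj_zero_gen_mul (w : V) (x : Ext 𝒲) : extProj 𝒲 0 (gen 𝒲 w * x) = 0 := by
  simp only [extProj, LinearMap.comp_apply, AlgHom.toLinearMap_apply, extLength_gen_mul,
    LinearMap.restrictScalars_apply, Polynomial.lcoeff_apply]
  simp [← Polynomial.C_mul_X_eq_monomial, mul_assoc]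

theorem extProj_succ_gen_mul (w : V) (n : ℕ) (x : Ext 𝒲) :
    extProj 𝒲 (n + 1) (gen 𝒲 w * x) = gen 𝒲 w * extProj 𝒲 n x := by
  simp only [extProj, LinearMap.comp_apply, AlgHom.toLinearMap_apply, extLength_gen_mul,
    LinearMap.restrictScalars_apply, Polynomial.lcoeff_apply]
  simp [← Polynomial.C_mul_X_eq_monomial, mul_assoc]

theorem extProj_zero_one : extProj 𝒲 0 1 = 1 := by
  simp [extProj]

theorem extProj_succ_one (n : ℕ) : extProj 𝒲 (n + 1) 1 = 0 := by
  simp [extProj, Polynomial.coeff_one]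

/-- The operators `(r, u) ↦ (0, r • v)` on `k × V`, any two of which have product zero. -/
def shiftOp (k V : Type*) [Field k] [AddCommGroup V] [Module k V] :
    V →ₗ[k] Module.End k (k × V) where
  toFun v := LinearMap.inr k k V ∘ₗ LinearMap.toSpanSingleton k V v ∘ₗ LinearMap.fst k k V
  map_add' v w := by ext <;> simp
  map_smul' r v := by ext <;> simp

theorem shiftOp_mul (v w : V) : shiftOp k V v * shiftOp k V w = 0 := by
  ext <;> simp [shiftOp]

/-- The linear part of an element of `∧W`: the left inverse of `W → ∧W` that vanishes on all words
of length different from one. -/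
def extW : Ext 𝒲 →ₗ[k] V :=
  LinearMap.snd k k V ∘ₗ LinearMap.applyₗ ((1 : k), (0 : V)) ∘ₗ
    (extLift 𝒲 (shiftOp k V) (fun p q x y _ _ => by simp [shiftOp_mul])).toLinearMap

@[simp] theorem extW_gen (v : V) : extW 𝒲 (gen 𝒲 v) = v := by
  simp [extW, extLift_gen, shiftOp]

theorem gen_injective : Function.Injective (gen 𝒲) :=
  Function.LeftInverse.injective (extW_gen 𝒲)

@[simp] theorem extW_one : extW 𝒲 1 = 0 := by
  simp [extW]

theorem extW_gen_mul_gen_mul (v w : V) (x : Ext 𝒲) : extW 𝒲 (gen 𝒲 v * (gen 𝒲 w * x)) = 0 := by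
  simp [extW, extLift_gen, ← mul_assoc, shiftOp_mul]

theorem extProj_one_eq [DirectSum.Decomposition 𝒲] (x : Ext 𝒲) :
    extProj 𝒲 1 x = gen 𝒲 (extW 𝒲 x) := by
  refine ext_mem_of_gen_mul 𝒲 (LinearMap.eqLocus (extProj 𝒲 1) (gen 𝒲 ∘ₗ extW 𝒲)) ?_ ?_ x
  · simp [LinearMap.mem_eqLocus, extProj_succ_one]
  · intro p w x _ _
    rw [LinearMap.mem_eqLocus, extProj_succ_gen_mul, LinearMap.comp_apply]
    refine ext_mem_of_gen_mul 𝒲 (LinearMap.eqLocus (LinearMap.mulLeft k (gen 𝒲 w) ∘ₗ extProj 𝒲 0)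
      (gen 𝒲 ∘ₗ extW 𝒲 ∘ₗ LinearMap.mulLeft k (gen 𝒲 w))) ?_ ?_ x
    · simp [LinearMap.mem_eqLocus, extProj_zero_one]
    · intro q v y _ _
      simp [LinearMap.mem_eqLocus, extProj_zero_gen_mul, extW_gen_mul_gen_mul]

end ExtBasic

section Generators

variable {k V : Type*} [Field k] [AddCommGroup V] [Module k V]
  (R : Type*) [CommRing R] [Algebra k R] (𝒲 : ℤ → Submodule k V)

/-- The generator `w` of `∧W ⊗ R`. -/
def genR : V →ₗ[k] ExtR R 𝒲 := (TensorProduct.mk k R (Ext 𝒲) 1) ∘ₗ gen 𝒲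

theorem genR_apply (w : V) : genR R 𝒲 w = (1 : R) ⊗ₜ gen 𝒲 w := rfl

theorem genR_mul_tmul (w : V) (r : R) (a : Ext 𝒲) :
    genR R 𝒲 w * (r ⊗ₜ[k] a) = r ⊗ₜ (gen 𝒲 w * a) := by
  simp [genR_apply]

theorem one_tmul_zsmul (z : ℤ) (a : Ext 𝒲) : (1 : R) ⊗ₜ[k] (z • a) = z • ((1 : R) ⊗ₜ[k] a) :=
  map_zsmul (TensorProduct.mk k R (Ext 𝒲) 1) z a

theorem extR_mem_of_gen_mul [DirectSum.Decomposition 𝒲] (N : Submodule R (ExtR R 𝒲)) (one : 1 ∈ N)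
    (gen_mul : ∀ p w x, w ∈ 𝒲 p → x ∈ N → genR R 𝒲 w * x ∈ N) (x : ExtR R 𝒲) : x ∈ N := by
  induction x using TensorProduct.induction_on with
  | zero => simp
  | add x y hx hy => exact add_mem hx hy
  | tmul r a =>
    have h1 : r ⊗ₜ[k] a = r • ((1 : R) ⊗ₜ[k] a) := by simp [TensorProduct.smul_tmul']
    rw [h1]
    refine N.smul_mem r ?_
    refine ext_mem_of_gen_mul 𝒲
      ((N.restrictScalars k).comap (TensorProduct.mk k R (Ext 𝒲) 1)) one ?_ a
    intro p w y hw hy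
    have := gen_mul p w _ hw hy
    rwa [TensorProduct.mk_apply, genR_mul_tmul] at this

end Generators

section Instance

variable {k V : Type*} [Field k] [CharZero k] [AddCommGroup V] [Module k V]
  (R : Type*) [CommRing R] [Algebra k R]
  (𝒲 : ℤ → Submodule k V) [DirectSum.Decomposition 𝒲]

theorem comulR_tmul (r : R) (a : Ext 𝒲) : comulR R 𝒲 (r ⊗ₜ a) =
    r • TensorProduct.AlgebraTensorModule.distribBaseChange k R (Ext 𝒲) (Ext 𝒲)
      ((1 : R) ⊗ₜ comul 𝒲 a) := by
  simp [comulR, ← map_smul, TensorProduct.smul_tmul']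

theorem isUnit_natCast (k R : Type*) [Field k] [CharZero k] [CommRing R] [Algebra k R] (n : ℕ)
    (hn : n ≠ 0) : IsUnit (n : R) := by
  have : (n : R) = algebraMap k R n := by simp
  rw [this]
  exact (IsUnit.mk0 _ (Nat.cast_ne_zero.2 hn)).map _

/-- The graded bialgebra `∧W ⊗ R`. -/
def extBialgebra : SymBialgebra R (ExtR R 𝒲) where
  W p := {x | ∃ w ∈ 𝒲 p, x = genR R 𝒲 w}
  s := Algebra.TensorProduct.map (AlgHom.id R R) (extSign 𝒲)
  o := oddR R 𝒲
  Δ := comulR R 𝒲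
  π := projR R 𝒲
  nat_unit := isUnit_natCast k R
  two_o x := by
    induction x using TensorProduct.induction_on with
    | zero => simp
    | add x y hx hy => rw [map_add, smul_add, hx, hy, map_add]; abel
    | tmul r a =>
      simp only [oddR, LinearMap.baseChange_tmul, oddProj, Algebra.TensorProduct.map_tmul,
        LinearMap.smul_apply, LinearMap.sub_apply, LinearMap.id_apply, AlgHom.toLinearMap_apply,
        AlgHom.id_apply, TensorProduct.tmul_smul]
      rw [← TensorProduct.tmul_sub, TensorProduct.smul_tmul', TensorProduct.smul_tmul',
        two_smul R, ← two_smul k, smul_smul, mul_inv_cancel₀ two_ne_zero, one_smul]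
  s_gen := by
    rintro p _ ⟨w, hw, rfl⟩
    rw [genR_apply, Algebra.TensorProduct.map_tmul, extSign_gen, signMap_of_mem 𝒲 hw, map_zsmul,
      AlgHom.id_apply, one_tmul_zsmul]
  gen_comm := by
    rintro p q _ _ ⟨v, hv, rfl⟩ ⟨w, hw, rfl⟩
    simp only [genR_apply, Algebra.TensorProduct.tmul_mul_tmul]
    rw [gen_comm 𝒲 hv hw, mul_one, one_tmul_zsmul]
  Δ_one := by
    change comulR R 𝒲 ((1 : R) ⊗ₜ 1) = _
    rw [comulR_tmul, comul_one]
    simp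
    rfl
  Δ_gen_mul := by
    rintro p _ ⟨w, hw, rfl⟩ x
    induction x using TensorProduct.induction_on with
    | zero => simp
    | add x y hx hy => simp only [mul_add, map_add, hx, hy]; abel
    | tmul r a =>
      rw [genR_mul_tmul, comulR_tmul, comulR_tmul, comul_gen_mul, map_smul, map_smul, ← smul_add]
      congr 1
      generalize comul 𝒲 a = z
      induction z using TensorProduct.induction_on with
      | zero => simp
      | add x y hx hy => simp only [map_add, TensorProduct.tmul_add, hx, hy]; abel
      | tmul a b =>
        rw [primMul_apply 𝒲 hw]
        split_ifs with hp <;>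
        simp [TensorProduct.tmul_add, genR_apply]
  π_zero_one := by
    change projR R 𝒲 0 ((1 : R) ⊗ₜ 1) = _
    simp [projR, extProj_zero_one]
    rfl
  π_succ_one n := by
    change projR R 𝒲 (n + 1) ((1 : R) ⊗ₜ 1) = _
    simp [projR, extProj_succ_one]
  π_zero_gen_mul := by
    rintro p _ ⟨w, hw, rfl⟩ x
    induction x using TensorProduct.induction_on with
    | zero => simp
    | add x y hx hy => simp only [mul_add, map_add, hx, hy, add_zero]
    | tmul r a => simp [genR_mul_tmul, projR, extProj_zero_gen_mul]
  π_succ_gen_mul := by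
    rintro p _ ⟨w, hw, rfl⟩ n x
    induction x using TensorProduct.induction_on with
    | zero => simp
    | add x y hx hy => simp only [mul_add, map_add, hx, hy]
    | tmul r a => simp [genR_mul_tmul, projR, extProj_succ_gen_mul]
  mem_of_gen N one gen_mul x :=
    extR_mem_of_gen_mul R 𝒲 N one (fun p w x hw hx => gen_mul p _ x ⟨w, hw, rfl⟩ hx) x

end Instance

/-! ### Koszul signs -/

theorem negOnePow_sum {ι : Type*} (s : Finset ι) (f : ι → ℤ) :
    (∑ i ∈ s, f i).negOnePow = ∏ i ∈ s, (f i).negOnePow := by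
  classical
  induction s using Finset.induction_on with
  | empty => simp
  | insert a s ha ih => rw [Finset.sum_insert ha, Finset.prod_insert ha, Int.negOnePow_add, ih]

theorem negOnePow_mul_self (a : ℤ) : a.negOnePow * a.negOnePow = 1 := by
  rw [← Int.negOnePow_add, Int.negOnePow_even _ (Even.add_self a)]

/-- A product over the pairs `i < j` can be taken over their images under a permutation. -/
theorem prod_lt_reindex {M : Type*} [CommMonoid M] {n : ℕ} (σ : Equiv.Perm (Fin n))
    (F : Fin n → Fin n → M) :
    ∏ p ∈ (Finset.univ : Finset (Fin n × Fin n)).filter (fun p => p.1 < p.2),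
        F (min (σ p.1) (σ p.2)) (max (σ p.1) (σ p.2)) =
      ∏ p ∈ (Finset.univ : Finset (Fin n × Fin n)).filter (fun p => p.1 < p.2), F p.1 p.2 := by
  have key : ∀ (τ : Equiv.Perm (Fin n)) (p : Fin n × Fin n), p.1 < p.2 →
      min (τ p.1) (τ p.2) < max (τ p.1) (τ p.2) := by
    intro τ p hp
    rw [min_lt_max]
    exact fun h => hp.ne (τ.injective h)
  have key2 : ∀ (τ : Equiv.Perm (Fin n)) (p : Fin n × Fin n), p.1 < p.2 →
      (min (τ.symm (min (τ p.1) (τ p.2))) (τ.symm (max (τ p.1) (τ p.2))),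
        max (τ.symm (min (τ p.1) (τ p.2))) (τ.symm (max (τ p.1) (τ p.2)))) = p := by
    intro τ p hp
    rcases le_total (τ p.1) (τ p.2) with h | h
    · rw [min_eq_left h, max_eq_right h]
      simp [min_eq_left hp.le, max_eq_right hp.le]
    · rw [min_eq_right h, max_eq_left h]
      simp [min_eq_right hp.le, max_eq_left hp.le]
  refine Finset.prod_nbij' (fun p => (min (σ p.1) (σ p.2), max (σ p.1) (σ p.2)))
    (fun p => (min (σ.symm p.1) (σ.symm p.2), max (σ.symm p.1) (σ.symm p.2))) ?_ ?_ ?_ ?_ ?_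
  · intro p hp
    simpa using key σ p (by simpa using hp)
  · intro p hp
    simpa using key σ.symm p (by simpa using hp)
  · intro p hp
    exact key2 σ p (by simpa using hp)
  · intro p hp
    have := key2 σ.symm p (by simpa using hp)
    simpa using this
  · intro p hp
    rfl

theorem koszulSign_eq {n : ℕ} (σ : Equiv.Perm (Fin n)) (d : Fin n → ℤ) : koszulSign σ d =
    ∏ p ∈ (Finset.univ : Finset (Fin n × Fin n)).filter (fun p => p.1 < p.2),
      if σ p.2 < σ p.1 then (d (σ p.1) * d (σ p.2)).negOnePow else 1 := by
  rw [koszulSign, ← Finset.filter_filter, Finset.prod_filter]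

theorem koszulSign_one {n : ℕ} (d : Fin n → ℤ) : koszulSign 1 d = 1 := by
  rw [koszulSign_eq]
  refine Finset.prod_eq_one fun p hp => ?_
  rw [if_neg]
  have : p.1 < p.2 := by simpa using hp
  simpa using this.le

/-- The Koszul sign of a composition. -/
theorem koszulSign_mul {n : ℕ} (σ τ : Equiv.Perm (Fin n)) (d : Fin n → ℤ) :
    koszulSign (σ * τ) d = koszulSign σ d * koszulSign τ (fun i => d (σ i)) := by
  rw [koszulSign_eq, koszulSign_eq, koszulSign_eq, ← prod_lt_reindex τ (fun i j =>
    if σ j < σ i then (d (σ i) * d (σ j)).negOnePow else 1), ← Finset.prod_mul_distrib]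
  refine Finset.prod_congr rfl fun p hp => ?_
  have hp : p.1 < p.2 := by simpa using hp
  have hne : τ p.1 ≠ τ p.2 := fun h => hp.ne (τ.injective h)
  have hne' : σ (τ p.1) ≠ σ (τ p.2) := fun h => hne (σ.injective h)
  change (if σ (τ p.2) < σ (τ p.1) then (d (σ (τ p.1)) * d (σ (τ p.2))).negOnePow else 1) = _
  rcases lt_or_gt_of_ne hne with h | h
  · rw [min_eq_left h.le, max_eq_right h.le, if_neg (not_lt.2 h.le), mul_one]
  · rw [min_eq_right h.le, max_eq_left h.le, if_pos h]
    rcases lt_or_gt_of_ne hne' with h' | h'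
    · rw [if_neg (not_lt.2 h'.le), if_pos h', mul_comm (d (σ (τ p.2))), negOnePow_mul_self]
    · rw [if_pos h', if_neg (not_lt.2 h'.le), one_mul]

theorem sign_eq_prod_lt {n : ℕ} (σ : Equiv.Perm (Fin n)) : Equiv.Perm.sign σ =
    ∏ p ∈ (Finset.univ : Finset (Fin n × Fin n)).filter (fun p => p.1 < p.2),
      if σ p.2 < σ p.1 then -1 else 1 := by
  rw [Equiv.Perm.sign_eq_prod_prod_Ioi, Finset.prod_filter, Fintype.prod_prod_type]
  refine Finset.prod_congr rfl fun i _ => ?_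
  rw [← Finset.filter_lt_eq_Ioi, Finset.prod_filter]
  refine Finset.prod_congr rfl fun j _ => ?_
  by_cases hij : i < j
  · have hne : σ i ≠ σ j := fun h => hij.ne (σ.injective h)
    rcases lt_or_gt_of_ne hne with h | h
    · simp [hij, h, not_lt.2 h.le]
    · simp [hij, h, not_lt.2 h.le]
  · simp [hij]

theorem negOnePow_weighted_sum {n : ℕ} (d : Fin n → ℤ) :
    (∑ i : Fin n, ((n : ℤ) - 1 - i) * d i).negOnePow =
      ∏ p ∈ (Finset.univ : Finset (Fin n × Fin n)).filter (fun p => p.1 < p.2),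
        (d p.1).negOnePow := by
  rw [← negOnePow_sum, Finset.sum_filter, Fintype.sum_prod_type]
  congr 1
  refine Finset.sum_congr rfl fun i _ => ?_
  change _ = ∑ j, if i < j then d i else 0
  rw [← Finset.sum_filter, Finset.sum_const, Finset.filter_lt_eq_Ioi, Fin.card_Ioi, nsmul_eq_mul]
  congr 1
  have := i.2
  omega

/-- The sign `(-1)^((n-1)d₁ + (n-2)d₂ + ⋯)` turns the antisymmetric signs `χ` for the degrees `dᵢ`
into the symmetric signs `ε` for the suspended degrees `dᵢ + 1`. -/
theorem chi_mul_negOnePow {n : ℕ} (σ : Equiv.Perm (Fin n)) (d : Fin n → ℤ) :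
    chi σ d * (∑ i : Fin n, ((n : ℤ) - 1 - i) * d (σ i)).negOnePow =
      koszulSign σ (fun i => d i + 1) * (∑ i : Fin n, ((n : ℤ) - 1 - i) * d i).negOnePow := by
  rw [chi, negOnePow_weighted_sum (fun i => d (σ i)), negOnePow_weighted_sum d,
    ← prod_lt_reindex σ (fun i _ => (d i).negOnePow), koszulSign_eq, koszulSign_eq,
    sign_eq_prod_lt, ← Finset.prod_mul_distrib, ← Finset.prod_mul_distrib,
    ← Finset.prod_mul_distrib]
  refine Finset.prod_congr rfl fun p hp => ?_
  have hp : p.1 < p.2 := by simpa using hp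
  have hne : σ p.1 ≠ σ p.2 := fun h => hp.ne (σ.injective h)
  rcases lt_or_gt_of_ne hne with h | h
  · simp [not_lt.2 h.le, min_eq_left h.le]
  · rw [if_pos h, if_pos h, if_pos h, min_eq_right h.le]
    have : (-1 : ℤˣ) = (1 : ℤ).negOnePow := by simp
    rw [this, ← Int.negOnePow_add, ← Int.negOnePow_add, ← Int.negOnePow_add, Int.negOnePow_eq_iff]
    refine ⟨-d (σ p.2), ?_⟩
    ring

theorem koszulSign_swap {n : ℕ} (i : Fin n) (d : Fin (n + 1) → ℤ) :
    koszulSign (Equiv.swap i.castSucc i.succ) d = (d i.castSucc * d i.succ).negOnePow := by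
  have : (Finset.univ : Finset (Fin (n + 1) × Fin (n + 1))).filter (fun p => p.1 < p.2 ∧
      Equiv.swap i.castSucc i.succ p.2 < Equiv.swap i.castSucc i.succ p.1) =
      {(i.castSucc, i.succ)} := by
    ext ⟨a, b⟩
    simp only [Finset.mem_filter, Finset.mem_univ, true_and, Finset.mem_singleton, Prod.mk.injEq,
      Equiv.swap_apply_def, Fin.ext_iff, Fin.lt_def]
    split_ifs <;> simp_all <;> omega
  rw [koszulSign, this, Finset.prod_singleton, Equiv.swap_apply_left, Equiv.swap_apply_right,
    mul_comm]

/-! ### Products of permuted factors -/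

theorem prod_ofFn_swap {A : Type*} [Ring A] {n : ℕ} (i : Fin n) (f : Fin (n + 1) → A) (c : ℤ)
    (h : f i.castSucc * f i.succ = c • (f i.succ * f i.castSucc)) :
    (List.ofFn f).prod = c • (List.ofFn fun j => f (Equiv.swap i.castSucc i.succ j)).prod := by
  induction n with
  | zero => exact i.elim0
  | succ n ih =>
    induction i using Fin.cases with
    | zero =>
      have h0 : f 0 * f 1 = c • (f 1 * f 0) := h
      have e0 : Equiv.swap (Fin.castSucc (0 : Fin (n + 1))) (Fin.succ 0) 0 = 1 :=
        Equiv.swap_apply_left _ _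
      have e1 : Equiv.swap (Fin.castSucc (0 : Fin (n + 1))) (Fin.succ 0) (Fin.succ 0) = 0 :=
        Equiv.swap_apply_right _ _
      have e2 : ∀ j : Fin n, Equiv.swap (Fin.castSucc (0 : Fin (n + 1))) (Fin.succ 0) j.succ.succ
          = j.succ.succ := fun j => Equiv.swap_apply_of_ne_of_ne (by simp [Fin.ext_iff])
            (by simp [Fin.ext_iff])
      simp only [List.ofFn_succ, List.prod_cons, e0, e1, e2]
      rw [← mul_assoc, ← mul_assoc, ← smul_mul_assoc]
      congr 1
    | succ i =>
      have e0 : Equiv.swap i.succ.castSucc i.succ.succ 0 = 0 :=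
        Equiv.swap_apply_of_ne_of_ne (by simp [Fin.ext_iff]) (by simp [Fin.ext_iff])
      have e1 : ∀ j : Fin (n + 1), Equiv.swap i.succ.castSucc i.succ.succ j.succ =
          (Equiv.swap i.castSucc i.succ j).succ := by
        intro j
        rw [← Fin.succ_castSucc]
        exact Function.Injective.swap_apply (Fin.succ_injective _) _ _ _
      have hr : (List.ofFn fun j => f (Equiv.swap i.succ.castSucc i.succ.succ j)).prod =
          f 0 * (List.ofFn fun j => f (Equiv.swap i.castSucc i.succ j).succ).prod := by
        rw [List.ofFn_succ, List.prod_cons]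
        simp only [e0, e1]
      rw [hr, List.ofFn_succ, List.prod_cons, ih i (fun j => f j.succ) (by simpa using h),
        mul_smul_comm]

/-- The rule `w₁ ⋯ wₙ = ε(σ) w_{σ(1)} ⋯ w_{σ(n)}` in `∧W`. -/
theorem prod_gen_perm {k V : Type*} [Field k] [AddCommGroup V] [Module k V]
    (𝒲 : ℤ → Submodule k V) {n : ℕ} (σ : Equiv.Perm (Fin n)) (w : Fin n → V) (d : Fin n → ℤ)
    (hw : ∀ i, w i ∈ 𝒲 (d i)) : (List.ofFn fun i => gen 𝒲 (w i)).prod =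
      (koszulSign σ d : ℤ) • (List.ofFn fun i => gen 𝒲 (w (σ i))).prod := by
  cases n with
  | zero => simp [Subsingleton.elim σ 1, koszulSign_one]
  | succ n =>
    have hσ : σ ∈ Submonoid.closure (Set.range fun i : Fin n => Equiv.swap i.castSucc i.succ) := by
      rw [Equiv.Perm.mclosure_swap_castSucc_succ]; trivial
    induction hσ using Submonoid.closure_induction generalizing w d with
    | mem σ hσ =>
      obtain ⟨i, rfl⟩ := hσ
      rw [koszulSign_swap]
      exact prod_ofFn_swap i (fun j => gen 𝒲 (w j)) _ (gen_comm 𝒲 (hw _) (hw _))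
    | one => simp [koszulSign_one]
    | mul σ τ _ _ hσ hτ =>
      rw [hσ w d hw, hτ (fun i => w (σ i)) (fun i => d (σ i)) (fun i => hw _), koszulSign_mul,
        smul_smul, Units.val_mul]
      rfl

/-! ### Unshuffles and the comultiplication of a word -/

/-- The unshuffle of `{0, …, n}` with `0` in its first block that extends `σ`. -/
def unshuffleLeft {n : ℕ} (σ : Equiv.Perm (Fin n)) : Equiv.Perm (Fin (n + 1)) :=
  Equiv.Perm.decomposeFin.symm (0, σ)

/-- The unshuffle of `{0, …, n}` with `0` at the beginning of its second block, which starts at the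
position `a`, that extends `σ`. -/
def unshuffleRight {n : ℕ} (a : Fin (n + 1)) (σ : Equiv.Perm (Fin n)) :
    Equiv.Perm (Fin (n + 1)) :=
  unshuffleLeft σ * Fin.cycleRange a

@[simp] theorem unshuffleLeft_zero {n : ℕ} (σ : Equiv.Perm (Fin n)) : unshuffleLeft σ 0 = 0 := by
  simp [unshuffleLeft]

@[simp] theorem unshuffleLeft_succ {n : ℕ} (σ : Equiv.Perm (Fin n)) (i : Fin n) :
    unshuffleLeft σ i.succ = (σ i).succ := by
  simp [unshuffleLeft]

@[simp] theorem unshuffleRight_self {n : ℕ} (a : Fin (n + 1)) (σ : Equiv.Perm (Fin n)) :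
    unshuffleRight a σ a = 0 := by
  simp [unshuffleRight, Equiv.Perm.mul_apply]

@[simp] theorem unshuffleRight_succAbove {n : ℕ} (a : Fin (n + 1)) (σ : Equiv.Perm (Fin n))
    (i : Fin n) : unshuffleRight a σ (a.succAbove i) = (σ i).succ := by
  simp [unshuffleRight, Equiv.Perm.mul_apply]

theorem exists_unshuffleLeft {n : ℕ} (σ : Equiv.Perm (Fin (n + 1))) (h : σ 0 = 0) :
    ∃ τ, unshuffleLeft τ = σ := by
  refine ⟨(Equiv.Perm.decomposeFin σ).2, ?_⟩
  rw [unshuffleLeft, Equiv.symm_apply_eq]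
  refine Prod.ext ?_ rfl
  have h1 := Equiv.Perm.decomposeFin_symm_apply_zero (Equiv.Perm.decomposeFin σ).1
    (Equiv.Perm.decomposeFin σ).2
  rw [Prod.mk.eta, Equiv.symm_apply_apply, h] at h1
  exact h1

theorem unshuffleLeft_injective {n : ℕ} :
    Function.Injective (unshuffleLeft : Equiv.Perm (Fin n) → _) := by
  intro σ τ h
  ext i
  have := Equiv.congr_fun h i.succ
  simpa [Fin.ext_iff] using this

theorem unshuffleLeft_mem {n a : ℕ} (σ : Equiv.Perm (Fin n)) :
    unshuffleLeft σ ∈ unshuffles (a + 1) (n + 1) ↔ σ ∈ unshuffles a n := by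
  simp only [unshuffles, Finset.mem_filter, Finset.mem_univ, true_and]
  constructor
  · rintro ⟨h1, h2⟩
    refine ⟨fun i j hij hj => ?_, fun i j hij hi => ?_⟩
    · simpa using h1 i.succ j.succ (by simpa using hij) (by simpa using hj)
    · simpa using h2 i.succ j.succ (by simpa using hij) (by simpa using hi)
  · rintro ⟨h1, h2⟩
    refine ⟨fun i j hij hj => ?_, fun i j hij hi => ?_⟩
    · induction j using Fin.cases with
      | zero => exact absurd hij (Fin.not_lt_zero _)
      | succ j =>
        induction i using Fin.cases with
        | zero => simp
        | succ i => simpa using h1 i j (by simpa using hij) (by simpa using hj)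
    · induction i using Fin.cases with
      | zero => simp at hi
      | succ i =>
        induction j using Fin.cases with
        | zero => exact absurd hij (Fin.not_lt_zero _)
        | succ j => simpa using h2 i j (by simpa using hij) (by simpa using hi)

theorem val_succAbove_lt {n : ℕ} (a : Fin (n + 1)) (i : Fin n) :
    ((a.succAbove i : Fin (n + 1)) : ℕ) < a ↔ (i : ℕ) < a := by
  rw [← Fin.lt_def, Fin.succAbove_lt_iff_castSucc_lt]
  rfl

theorem unshuffleRight_mem {n : ℕ} (a : Fin (n + 1)) (σ : Equiv.Perm (Fin n)) :
    unshuffleRight a σ ∈ unshuffles a (n + 1) ↔ σ ∈ unshuffles a n := by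
  simp only [unshuffles, Finset.mem_filter, Finset.mem_univ, true_and]
  constructor
  · rintro ⟨h1, h2⟩
    refine ⟨fun i j hij hj => ?_, fun i j hij hi => ?_⟩
    · simpa using h1 (a.succAbove i) (a.succAbove j) (by simpa using hij)
        ((val_succAbove_lt a j).2 hj)
    · simpa using h2 (a.succAbove i) (a.succAbove j) (by simpa using hij)
        (not_lt.1 fun h => absurd ((val_succAbove_lt a i).1 h) (not_lt.2 hi))
  · rintro ⟨h1, h2⟩
    refine ⟨fun i j hij hj => ?_, fun i j hij hi => ?_⟩
    · rcases Fin.eq_self_or_eq_succAbove a j with rfl | ⟨j, rfl⟩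
      · exact absurd hj (lt_irrefl _)
      rcases Fin.eq_self_or_eq_succAbove a i with rfl | ⟨i, rfl⟩
      · exact absurd (hij.trans (Fin.lt_def.2 hj)) (lt_irrefl _)
      simpa using h1 i j (by simpa using hij) ((val_succAbove_lt a j).1 hj)
    · rcases Fin.eq_self_or_eq_succAbove a j with rfl | ⟨j, rfl⟩
      · exact absurd hij (not_lt.2 (Fin.le_def.2 hi))
      rcases Fin.eq_self_or_eq_succAbove a i with rfl | ⟨i, rfl⟩
      · simp
      simpa using h2 i j (by simpa using hij)
        (not_lt.1 fun h => absurd ((val_succAbove_lt a i).2 h) (not_lt.2 hi))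

/-- Unshuffles of `{0, …, n}` arise from unshuffles of `{1, …, n}` by putting `0` at the beginning
of one of the two blocks. -/
theorem sum_unshuffles_succ {M : Type*} [AddCommMonoid M] {n : ℕ}
    (Φ : ℕ → Equiv.Perm (Fin (n + 1)) → M) :
    ∑ a : Fin (n + 2), ∑ σ ∈ unshuffles a (n + 1), Φ a σ =
      (∑ a : Fin (n + 1), ∑ σ ∈ unshuffles a n, Φ (a + 1) (unshuffleLeft σ)) +
      ∑ a : Fin (n + 1), ∑ σ ∈ unshuffles a n, Φ a (unshuffleRight a σ) := by
  have split : ∀ a : ℕ, ∑ σ ∈ unshuffles a (n + 1), Φ a σ =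
      (∑ σ ∈ (unshuffles a (n + 1)).filter (fun σ => (σ.symm 0 : ℕ) < a), Φ a σ) +
      ∑ σ ∈ (unshuffles a (n + 1)).filter (fun σ => ¬ (σ.symm 0 : ℕ) < a), Φ a σ :=
    fun a => (Finset.sum_filter_add_sum_filter_not _ _ _).symm
  simp only [split, Finset.sum_add_distrib]
  congr 1
  · rw [Fin.sum_univ_succ]
    simp only [Fin.val_zero, not_lt_zero, Finset.filter_false, Finset.sum_empty, zero_add]
    refine Finset.sum_congr rfl fun a _ => ?_
    symm
    refine Finset.sum_bij (fun σ _ => unshuffleLeft σ) ?_ ?_ ?_ ?_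
    · intro σ hσ
      rw [Finset.mem_filter]
      refine ⟨(unshuffleLeft_mem σ).2 hσ, ?_⟩
      have : (unshuffleLeft σ).symm 0 = 0 := by rw [Equiv.symm_apply_eq]; simp
      simp [this]
    · intro σ _ τ _ h
      exact unshuffleLeft_injective h
    · intro σ hσ
      rw [Finset.mem_filter] at hσ
      have h0 : σ 0 = 0 := by
        by_contra hne
        have hpos : (0 : Fin (n + 1)) < σ.symm 0 := by
          rw [Fin.pos_iff_ne_zero]
          intro h
          exact hne ((Equiv.symm_apply_eq σ).1 h).symm
        have := (Finset.mem_filter.1 hσ.1).2.1 0 (σ.symm 0) hpos hσ.2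
        simp at this
      obtain ⟨τ, rfl⟩ := exists_unshuffleLeft σ h0
      exact ⟨τ, (unshuffleLeft_mem τ).1 hσ.1, rfl⟩
    · intro σ _
      rfl
  · rw [Fin.sum_univ_castSucc]
    have hl : (unshuffles (Fin.last (n + 1)) (n + 1)).filter
        (fun σ => ¬ (σ.symm 0 : ℕ) < (Fin.last (n + 1) : ℕ)) = ∅ := by
      rw [Finset.filter_eq_empty_iff]
      intro σ _
      simpa using (σ.symm 0).2
    rw [hl, Finset.sum_empty, add_zero]
    refine Finset.sum_congr rfl fun a _ => ?_
    symm
    refine Finset.sum_bij (fun σ _ => unshuffleRight a σ) ?_ ?_ ?_ ?_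
    · intro σ hσ
      rw [Finset.mem_filter]
      refine ⟨(unshuffleRight_mem a σ).2 hσ, ?_⟩
      have : (unshuffleRight a σ).symm 0 = a := by rw [Equiv.symm_apply_eq]; simp
      simp [this]
    · intro σ _ τ _ h
      exact unshuffleLeft_injective (mul_right_cancel h)
    · intro σ hσ
      rw [Finset.mem_filter] at hσ
      have h0 : σ a = 0 := by
        by_contra hne
        have hlt : a < σ.symm 0 := by
          refine lt_of_le_of_ne (Fin.le_def.2 (not_lt.1 hσ.2)) fun h => hne ?_
          rw [h]; simp
        have := (Finset.mem_filter.1 hσ.1).2.2 a (σ.symm 0) hlt le_rfl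
        simp at this
      obtain ⟨τ, hτ⟩ := exists_unshuffleLeft (σ * (Fin.cycleRange a)⁻¹) (by
        rw [Equiv.Perm.mul_apply]
        have : (Fin.cycleRange a)⁻¹ 0 = a := by
          rw [Equiv.Perm.inv_def, Equiv.symm_apply_eq, Fin.cycleRange_self]
        rw [this, h0])
      have hτ' : unshuffleRight a τ = σ := by rw [unshuffleRight, hτ, inv_mul_cancel_right]
      subst hτ'
      exact ⟨τ, (unshuffleRight_mem a τ).1 hσ.1, rfl⟩
    · intro σ _
      rfl

theorem koszulSign_unshuffleLeft {n : ℕ} (σ : Equiv.Perm (Fin n)) (d : Fin (n + 1) → ℤ) :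
    koszulSign (unshuffleLeft σ) d = koszulSign σ (fun i => d i.succ) := by
  rw [koszulSign_eq, koszulSign_eq, Finset.prod_filter, Finset.prod_filter,
    Fintype.prod_prod_type, Fintype.prod_prod_type, Fin.prod_univ_succ]
  rw [Finset.prod_eq_one, one_mul]
  · refine Finset.prod_congr rfl fun i _ => ?_
    rw [Fin.prod_univ_succ]
    simp
  · intro j _
    simp

theorem koszulSign_cycleRange {n : ℕ} (a : Fin (n + 1)) (d : Fin (n + 1) → ℤ) :
    koszulSign (Fin.cycleRange a) d =
      (d 0 * ∑ i ∈ (Finset.univ : Finset (Fin n)).filter (fun i : Fin n => (i : ℕ) < a),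
        d i.succ).negOnePow := by
  rw [Finset.mul_sum, negOnePow_sum, koszulSign]
  symm
  refine Finset.prod_bij (fun i _ => (a.succAbove i, a)) ?_ ?_ ?_ ?_
  · intro i hi
    simp only [Finset.mem_filter, Finset.mem_univ, true_and] at hi ⊢
    refine ⟨Fin.lt_def.2 ((val_succAbove_lt a i).2 hi), ?_⟩
    simp
  · intro i _ j _ h
    simpa using h
  · rintro ⟨i, j⟩ h
    simp only [Finset.mem_filter, Finset.mem_univ, true_and] at h
    obtain ⟨h1, h2⟩ := h
    rcases Fin.eq_self_or_eq_succAbove a i with rfl | ⟨i, rfl⟩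
    · simp at h2
    rcases Fin.eq_self_or_eq_succAbove a j with rfl | ⟨j, rfl⟩
    · exact ⟨i, by simpa using (val_succAbove_lt j i).1 h1, rfl⟩
    · simp only [Fin.cycleRange_succAbove, Fin.succ_lt_succ_iff, Fin.succAbove_lt_succAbove_iff]
        at h1 h2
      exact absurd h1 (not_lt.2 h2.le)
  · intro i _
    simp [mul_comm]

theorem koszulSign_unshuffleRight {n : ℕ} (a : Fin (n + 1)) (σ : Equiv.Perm (Fin n))
    (d : Fin (n + 1) → ℤ) : koszulSign (unshuffleRight a σ) d =
      koszulSign σ (fun i => d i.succ) *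
      (d 0 * ∑ i ∈ (Finset.univ : Finset (Fin n)).filter (fun i : Fin n => (i : ℕ) < a),
        d (σ i).succ).negOnePow := by
  rw [unshuffleRight, koszulSign_mul, koszulSign_unshuffleLeft, koszulSign_cycleRange]
  simp

theorem take_ofFn_unshuffleLeft {A : Type*} {n : ℕ} (a : ℕ) (σ : Equiv.Perm (Fin n))
    (x : Fin (n + 1) → A) : (List.ofFn fun i => x (unshuffleLeft σ i)).take (a + 1) =
      x 0 :: (List.ofFn fun i => x (σ i).succ).take a := by
  simp [List.ofFn_succ]

theorem drop_ofFn_unshuffleLeft {A : Type*} {n : ℕ} (a : ℕ) (σ : Equiv.Perm (Fin n))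
    (x : Fin (n + 1) → A) : (List.ofFn fun i => x (unshuffleLeft σ i)).drop (a + 1) =
      (List.ofFn fun i => x (σ i).succ).drop a := by
  simp [List.ofFn_succ]

theorem take_ofFn_unshuffleRight {A : Type*} {n : ℕ} (a : Fin (n + 1)) (σ : Equiv.Perm (Fin n))
    (x : Fin (n + 1) → A) : (List.ofFn fun i => x (unshuffleRight a σ i)).take a =
      (List.ofFn fun i => x (σ i).succ).take a := by
  have ha := a.2
  refine List.ext_getElem (by simp; omega) fun i h1 h2 => ?_
  simp only [List.length_take, List.length_ofFn, lt_inf_iff] at h1 h2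
  have h3 : (⟨i, h1.2⟩ : Fin (n + 1)) = a.succAbove ⟨i, h2.2⟩ := by
    rw [Fin.succAbove_of_castSucc_lt _ _ (Fin.lt_def.2 (by simpa using h1.1))]
    rfl
  rw [List.getElem_take, List.getElem_take, List.getElem_ofFn, List.getElem_ofFn, h3,
    unshuffleRight_succAbove]

theorem drop_ofFn_unshuffleRight {A : Type*} {n : ℕ} (a : Fin (n + 1)) (σ : Equiv.Perm (Fin n))
    (x : Fin (n + 1) → A) : (List.ofFn fun i => x (unshuffleRight a σ i)).drop a =
      x 0 :: (List.ofFn fun i => x (σ i).succ).drop a := by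
  have ha := a.2
  refine List.ext_getElem (by simp; omega) fun i h1 h2 => ?_
  simp only [List.length_drop, List.length_ofFn, List.length_cons] at h1 h2
  cases i with
  | zero =>
    rw [List.getElem_drop, List.getElem_ofFn, List.getElem_cons_zero]
    exact congrArg x (unshuffleRight_self a σ)
  | succ i =>
    have h3 : (⟨a + (i + 1), by omega⟩ : Fin (n + 1)) = a.succAbove ⟨a + i, by omega⟩ := by
      rw [Fin.succAbove_of_le_castSucc _ _ (Fin.le_def.2 (by simp))]
      ext; simp; omega
    rw [List.getElem_drop, List.getElem_ofFn, List.getElem_cons_succ, List.getElem_drop,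
      List.getElem_ofFn, h3, unshuffleRight_succAbove]

section Comul

variable {k V : Type*} [Field k] [AddCommGroup V] [Module k V] (𝒲 : ℤ → Submodule k V)
  [DirectSum.Decomposition 𝒲]

theorem extSign_prod {l : List V} {d : List ℤ} (h : List.Forall₂ (fun w p => w ∈ 𝒲 p) l d) :
    extSign 𝒲 (l.map (gen 𝒲)).prod = (d.sum.negOnePow : ℤ) • (l.map (gen 𝒲)).prod := by
  induction h with
  | nil => simp
  | cons hw _ ih =>
    rw [List.map_cons, List.prod_cons, map_mul, ih, extSign_gen, signMap_of_mem 𝒲 hw, map_zsmul,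
      smul_mul_smul_comm, ← Units.val_mul, ← Int.negOnePow_add, List.sum_cons]

theorem extSign_prod_take {n : ℕ} (w : Fin n → V) (d : Fin n → ℤ) (hw : ∀ i, w i ∈ 𝒲 (d i))
    (a : ℕ) : extSign 𝒲 ((List.ofFn fun i => gen 𝒲 (w i)).take a).prod =
      ((∑ i ∈ (Finset.univ : Finset (Fin n)).filter (fun i : Fin n => (i : ℕ) < a),
        d i).negOnePow : ℤ) •
        ((List.ofFn fun i => gen 𝒲 (w i)).take a).prod := by
  have h : List.Forall₂ (fun w p => w ∈ 𝒲 p) ((List.ofFn w).take a) ((List.ofFn d).take a) := by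
    rw [List.forall₂_iff_get]
    refine ⟨by simp, fun i h1 h2 => ?_⟩
    simpa using hw _
  have h2 := extSign_prod 𝒲 h
  rw [List.map_take, List.map_ofFn, List.sum_take_ofFn] at h2
  exact h2

/-- The comultiplication of a word as a sum over unshuffles. -/
theorem comul_prod [CharZero k] {n : ℕ} (w : Fin n → V) (d : Fin n → ℤ)
    (hw : ∀ i, w i ∈ 𝒲 (d i)) : comul 𝒲 (List.ofFn fun i => gen 𝒲 (w i)).prod =
      ∑ a : Fin (n + 1), ∑ σ ∈ unshuffles a n, (koszulSign σ d : ℤ) •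
        (((List.ofFn fun i => gen 𝒲 (w (σ i))).take a).prod ⊗ₜ[k]
          ((List.ofFn fun i => gen 𝒲 (w (σ i))).drop a).prod) := by
  induction n with
  | zero =>
    have : unshuffles 0 0 = {1} := by
      ext σ
      simp [unshuffles, Subsingleton.elim σ 1]
    simp [comul_one, this, koszulSign_one]
  | succ n ih =>
    have hs := sum_unshuffles_succ (fun a σ => (koszulSign σ d : ℤ) •
        (((List.ofFn fun i => gen 𝒲 (w (σ i))).take a).prod ⊗ₜ[k]
          ((List.ofFn fun i => gen 𝒲 (w (σ i))).drop a).prod))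
    rw [hs, List.ofFn_succ, List.prod_cons, comul_gen_mul,
      ih (fun i => w i.succ) (fun i => d i.succ) (fun i => hw _)]
    simp only [map_sum, ← Finset.sum_add_distrib]
    refine Finset.sum_congr rfl fun a _ => Finset.sum_congr rfl fun σ _ => ?_
    have t1 := take_ofFn_unshuffleLeft a σ (fun i => gen 𝒲 (w i))
    have t2 := drop_ofFn_unshuffleLeft a σ (fun i => gen 𝒲 (w i))
    have t3 := take_ofFn_unshuffleRight a σ (fun i => gen 𝒲 (w i))
    have t4 := drop_ofFn_unshuffleRight a σ (fun i => gen 𝒲 (w i))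
    rw [t1, t2, t3, t4, map_zsmul, primMul_apply 𝒲 (hw 0), smul_add, koszulSign_unshuffleLeft,
      koszulSign_unshuffleRight, List.prod_cons, List.prod_cons]
    congr 1
    rw [Units.val_mul, ← smul_smul]
    congr 1
    rw [TensorProduct.smul_tmul']
    congr 1
    have := extSign_prod_take 𝒲 (fun i => w (σ i).succ) (fun i => d (σ i).succ) (fun i => hw _) a
    split_ifs with hp
    · rw [Int.negOnePow_even _ (hp.mul_right _)]; simp
    · rw [this]
      congr 2
      refine (SymBialgebra.negOnePow_congr ?_)
      rw [← one_sub_mul]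
      exact (odd_one.sub_odd (Int.not_even_iff_odd.1 hp)).mul_right _

end Comul

/-! ### Homogeneous elements -/

section Homogeneous

variable {k V : Type*} [Field k] [AddCommGroup V] [Module k V] (𝒲 : ℤ → Submodule k V)
  [DirectSum.Decomposition 𝒲]

theorem tensor_hom_ext {M : Type*} [AddCommGroup M] [Module k M] {f g : V ⊗[k] V →ₗ[k] M}
    (h : ∀ p q x y, x ∈ 𝒲 p → y ∈ 𝒲 q → f (x ⊗ₜ y) = g (x ⊗ₜ y)) : f = g := by
  apply TensorProduct.ext'
  intro x y
  induction x using DirectSum.Decomposition.inductionOn 𝒲 with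
  | zero => simp
  | add x x' hx hx' => simp only [TensorProduct.add_tmul, map_add, hx, hx']
  | homogeneous x =>
    induction y using DirectSum.Decomposition.inductionOn 𝒲 with
    | zero => simp
    | add y y' hy hy' => simp only [TensorProduct.tmul_add, map_add, hy, hy']
    | homogeneous y => exact h _ _ _ _ x.2 y.2

theorem gradedSwap_tmul [CharZero k] {p q : ℤ} {x y : V} (hx : x ∈ 𝒲 p) (hy : y ∈ 𝒲 q) :
    gradedSwap (oddProj (signMap 𝒲)) (x ⊗ₜ[k] y) = ((p * q).negOnePow : ℤ) • (y ⊗ₜ[k] x) := by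
  simp only [gradedSwap, LinearMap.comp_apply, LinearMap.sub_apply, LinearMap.id_apply,
    LinearMap.smul_apply, TensorProduct.map_tmul, LinearEquiv.coe_coe]
  rcases Int.even_or_odd p with hp | hp
  · simp [oddProj_signMap_of_even 𝒲 hx hp, Int.negOnePow_even _ (hp.mul_right q)]
  · rcases Int.even_or_odd q with hq | hq
    · simp [oddProj_signMap_of_even 𝒲 hy hq, Int.negOnePow_even _ (hq.mul_left p)]
    · rw [oddProj_signMap_of_odd 𝒲 hx hp, oddProj_signMap_of_odd 𝒲 hy hq,
        Int.negOnePow_odd _ (hp.mul hq), map_sub, map_smul, TensorProduct.comm_tmul, two_smul]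
      simp

/-- The multiplication `W ⊗ W → ∧²W`. -/
def mulGen : V ⊗[k] V →ₗ[k] Ext 𝒲 :=
  LinearMap.mul' k (Ext 𝒲) ∘ₗ TensorProduct.map (gen 𝒲) (gen 𝒲)

omit [DirectSum.Decomposition 𝒲] in
theorem mulGen_tmul (x y : V) : mulGen 𝒲 (x ⊗ₜ y) = gen 𝒲 x * gen 𝒲 y := by
  simp [mulGen]

theorem mulGen_gradedSwap [CharZero k] (z : V ⊗[k] V) :
    mulGen 𝒲 (gradedSwap (oddProj (signMap 𝒲)) z) = mulGen 𝒲 z := by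
  have : mulGen 𝒲 ∘ₗ gradedSwap (oddProj (signMap 𝒲)) = mulGen 𝒲 := by
    apply tensor_hom_ext 𝒲
    intro p q x y hx hy
    rw [LinearMap.comp_apply, gradedSwap_tmul 𝒲 hx hy, map_zsmul, mulGen_tmul, mulGen_tmul,
      gen_comm 𝒲 hx hy]
  exact LinearMap.congr_fun this z

theorem extW_comul_mulGen [CharZero k] (z : V ⊗[k] V) :
    TensorProduct.map (extW 𝒲) (extW 𝒲) (comul 𝒲 (mulGen 𝒲 z)) =
      z + gradedSwap (oddProj (signMap 𝒲)) z := by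
  have : TensorProduct.map (extW 𝒲) (extW 𝒲) ∘ₗ comul 𝒲 ∘ₗ mulGen 𝒲 =
      LinearMap.id + gradedSwap (oddProj (signMap 𝒲)) := by
    apply tensor_hom_ext 𝒲
    intro p q x y hx hy
    have h1 : extW 𝒲 (gen 𝒲 x * gen 𝒲 y) = 0 := by
      simpa using extW_gen_mul_gen_mul 𝒲 x y 1
    have h2 : comul 𝒲 (gen 𝒲 y) = gen 𝒲 y ⊗ₜ 1 + 1 ⊗ₜ gen 𝒲 y := by
      have := comul_gen_mul 𝒲 y 1
      rw [mul_one, comul_one, primMul_apply 𝒲 hy] at this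
      simpa using this
    rw [LinearMap.comp_apply, LinearMap.comp_apply, LinearMap.add_apply, LinearMap.id_apply,
      gradedSwap_tmul 𝒲 hx hy, mulGen_tmul, comul_gen_mul, h2, map_add, primMul_apply 𝒲 hx,
      primMul_apply 𝒲 hx]
    simp only [map_add, TensorProduct.map_tmul, h1, extW_one, mul_one, TensorProduct.tmul_zero,
      zero_add, extW_gen, add_zero]
    rw [add_comm]
    congr 1
    split_ifs with hp
    · simp [Int.negOnePow_even _ (hp.mul_right q)]
    · rw [extSign_gen, extW_gen, signMap_of_mem 𝒲 hy, ← TensorProduct.smul_tmul']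
      refine SymBialgebra.negOnePow_smul_congr ?_ _
      rw [← one_sub_mul]
      exact (odd_one.sub_odd (Int.not_even_iff_odd.1 hp)).mul_right _
  exact LinearMap.congr_fun this z

/-- The kernel of `W ⊗ W → ∧²W` consists of the graded antisymmetric tensors. -/
theorem mulGen_eq_zero_iff [CharZero k] (z : V ⊗[k] V) :
    mulGen 𝒲 z = 0 ↔ gradedSwap (oddProj (signMap 𝒲)) z = -z := by
  constructor
  · intro h
    have := extW_comul_mulGen 𝒲 z
    rw [h, map_zero, map_zero] at this
    exact (neg_eq_of_add_eq_zero_right this.symm).symm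
  · intro h
    have := mulGen_gradedSwap 𝒲 z
    rw [h, map_neg] at this
    have h2 : (2 : k) • mulGen 𝒲 z = 0 := by
      rw [two_smul]
      nth_rewrite 1 [← this]
      simp
    exact (smul_eq_zero.1 h2).resolve_left two_ne_zero

theorem signMap_signMap (x : V) : signMap 𝒲 (signMap 𝒲 x) = x := by
  induction x using DirectSum.Decomposition.inductionOn 𝒲 with
  | zero => simp
  | add x y hx hy => simp only [map_add, hx, hy]
  | homogeneous x =>
    rw [signMap_of_mem 𝒲 x.2, map_zsmul, signMap_of_mem 𝒲 x.2, SymBialgebra.negOnePow_smul_self]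

omit [DirectSum.Decomposition 𝒲] in
theorem mem_susp {p : ℤ} {x : V} (hx : x ∈ 𝒲 p) : x ∈ susp 𝒲 (p + 1) := by
  simpa [susp] using hx

/-- Suspension exchanges symmetric and antisymmetric tensors. -/
theorem gradedSwap_susp [CharZero k] (z : V ⊗[k] V) :
    gradedSwap (oddProj (signMap (susp 𝒲))) (LinearMap.rTensor V (signMap (susp 𝒲)) z) =
      - LinearMap.rTensor V (signMap (susp 𝒲)) (gradedSwap (oddProj (signMap 𝒲)) z) := by
  have : gradedSwap (oddProj (signMap (susp 𝒲))) ∘ₗ LinearMap.rTensor V (signMap (susp 𝒲)) =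
      - (LinearMap.rTensor V (signMap (susp 𝒲)) ∘ₗ gradedSwap (oddProj (signMap 𝒲))) := by
    apply tensor_hom_ext 𝒲
    intro p q x y hx hy
    rw [LinearMap.comp_apply, LinearMap.rTensor_tmul, LinearMap.neg_apply, LinearMap.comp_apply,
      gradedSwap_tmul 𝒲 hx hy, map_zsmul, LinearMap.rTensor_tmul,
      signMap_of_mem _ (mem_susp 𝒲 hx), signMap_of_mem _ (mem_susp 𝒲 hy),
      ← TensorProduct.smul_tmul', ← TensorProduct.smul_tmul', map_zsmul,
      gradedSwap_tmul (susp 𝒲) (mem_susp 𝒲 hx) (mem_susp 𝒲 hy),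
      SymBialgebra.negOnePow_smul_smul, SymBialgebra.negOnePow_smul_smul, ← neg_one_smul ℤ,
      smul_smul]
    congr 1
    have h1 : (-1 : ℤ) = ((1 : ℤ).negOnePow : ℤ) := by simp
    rw [h1, ← Units.val_mul, ← Int.negOnePow_add]
    congr 1
    refine SymBialgebra.negOnePow_congr ⟨p, ?_⟩
    ring
  exact LinearMap.congr_fun this z

theorem mulGen_rTensor_eq_zero_iff [CharZero k] (z : V ⊗[k] V) :
    mulGen (susp 𝒲) (LinearMap.rTensor V (signMap (susp 𝒲)) z) = 0 ↔
      gradedSwap (oddProj (signMap 𝒲)) z = z := by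
  rw [mulGen_eq_zero_iff, gradedSwap_susp, neg_inj]
  constructor
  · intro h
    have h2 := congrArg (LinearMap.rTensor V (signMap (susp 𝒲))) h
    have h3 : signMap (susp 𝒲) ∘ₗ signMap (susp 𝒲) = LinearMap.id :=
      LinearMap.ext (signMap_signMap _)
    rw [← LinearMap.comp_apply, ← LinearMap.comp_apply (LinearMap.rTensor V _)
      (LinearMap.rTensor V _), ← LinearMap.rTensor_comp, h3] at h2
    simpa using h2
  · intro h
    rw [h]

end Homogeneous

/-! ### Dual bases of a loop form -/

section Dual

variable {k V ι : Type*} [Field k] [AddCommGroup V] [Module k V] [Fintype ι] [DecidableEq ι]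
  {𝒱 : ℤ → Submodule k V} [DirectSum.Decomposition 𝒱] {B : LinearMap.BilinForm k V}
  (hB : IsLoopForm 𝒱 B) {h h' : Module.Basis ι k V} {dh : ι → ℤ} (hdeg : ∀ s, h s ∈ 𝒱 (dh s))
  (hdual : ∀ s u, B (h' s) (h u) = if s = u then 1 else 0)

include hdual in
omit [Fintype ι] [DirectSum.Decomposition 𝒱] in
theorem coord_eq (s : ι) (x : V) : h.coord s x = B (h' s) x := by
  have : h.coord s = B (h' s) := by
    apply h.ext
    intro u
    rw [hdual, Module.Basis.coord_apply, Module.Basis.repr_self, Finsupp.single_apply]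
    simp [eq_comm]
  rw [this]

omit [Fintype ι] in
include hB hdeg hdual in
theorem dual_mem (s : ι) : h' s ∈ 𝒱 (-3 - dh s) := by
  classical
  have key : ∀ p, p ≠ -3 - dh s → (DirectSum.decompose 𝒱 (h' s) p : V) = 0 := by
    intro p hp
    refine hB.nondegenerate.1 _ fun y => ?_
    have h0 : B (DirectSum.decompose 𝒱 (h' s) p : V) = 0 := by
      apply h.ext
      intro u
      rw [LinearMap.zero_apply]
      by_cases hpu : p + dh u + 3 = 0
      · have h1 : B (h' s) (h u) = B (DirectSum.decompose 𝒱 (h' s) p : V) (h u) := by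
          conv_lhs => rw [← DirectSum.sum_support_decompose 𝒱 (h' s)]
          rw [map_sum, LinearMap.sum_apply]
          refine Finset.sum_eq_single p (fun q _ hq => ?_) fun hns => ?_
          · exact hB.degree q (dh u) _ _ (SetLike.coe_mem _) (hdeg u) (by omega)
          · rw [DFinsupp.notMem_support_iff.1 hns]; simp
        rw [← h1, hdual, if_neg]
        rintro rfl
        exact hp (by omega)
      · exact hB.degree p (dh u) _ _ (SetLike.coe_mem _) (hdeg u) hpu
    rw [h0]; rfl
  rw [← DirectSum.sum_support_decompose 𝒱 (h' s)]
  refine Submodule.sum_mem _ fun p _ => ?_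
  by_cases hp : p = -3 - dh s
  · rw [← hp]; exact SetLike.coe_mem _
  · rw [key p hp]; exact zero_mem _

include hB hdeg hdual in
theorem coord_eq_zero_of_mem {s : ι} {q : ℤ} {x : V} (hx : x ∈ 𝒱 q) (hq : q ≠ dh s) :
    h.coord s x = 0 := by
  rw [coord_eq hdual]
  exact hB.degree _ _ _ _ (dual_mem hB hdeg hdual s) hx (by omega)

include hB hdeg hdual in
/-- The tensor `∑ h_s ⊗ h^s` is symmetric, without a sign. -/
theorem sum_dual_comm {M : Type*} [AddCommGroup M] [Module k M] (β : V →ₗ[k] V →ₗ[k] M) :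
    ∑ s, β (h' s) (h s) = ∑ s, β (h s) (h' s) := by
  have hsymm : ∀ s u, B (h' s) (h' u) = B (h' u) (h' s) := by
    intro s u
    have hs := dual_mem hB hdeg hdual s
    have hu := dual_mem hB hdeg hdual u
    by_cases h0 : (-3 - dh s) + (-3 - dh u) + 3 = 0
    · rw [hB.symm _ _ _ _ hs hu, Int.negOnePow_even]
      · simp
      · have : -3 - dh u = - (-3 - dh s) - 3 := by omega
        rw [this]
        rcases Int.even_or_odd (-3 - dh s) with he | he
        · exact he.mul_right _
        · refine Even.mul_left ?_ _
          exact he.neg.sub_odd (by decide)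
    · rw [hB.degree _ _ _ _ hs hu h0, hB.degree _ _ _ _ hu hs (by omega)]
  have hexp : ∀ u, h' u = ∑ s, B (h' s) (h' u) • h s := by
    intro u
    conv_lhs => rw [← h.sum_repr (h' u)]
    refine Finset.sum_congr rfl fun s _ => ?_
    rw [← coord_eq hdual]
    rfl
  have h1 : ∑ u, β (h' u) (h u) = ∑ u, ∑ s, B (h' s) (h' u) • β (h s) (h u) := by
    refine Finset.sum_congr rfl fun u _ => ?_
    conv_lhs => rw [hexp u]
    simp
  have h2 : ∑ s, β (h s) (h' s) = ∑ s, ∑ u, B (h' u) (h' s) • β (h s) (h u) := by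
    refine Finset.sum_congr rfl fun u _ => ?_
    conv_lhs => rw [hexp u]
    simp
  rw [h1, h2, Finset.sum_comm]
  refine Finset.sum_congr rfl fun s _ => Finset.sum_congr rfl fun u _ => ?_
  rw [hsymm]

omit [Fintype ι] [DecidableEq ι] [DirectSum.Decomposition 𝒱] in
include hdeg in
theorem multilinear_ext [Finite ι] {M : Type*} [AddCommGroup M] [Module k M] {n : ℕ}
    {f g : MultilinearMap k (fun _ : Fin n => V) M}
    (hfg : ∀ (v : Fin n → V) (d : Fin n → ℤ), (∀ i, v i ∈ 𝒱 (d i)) → f v = g v) : f = g :=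
  Module.Basis.ext_multilinear (fun _ => h) fun j => hfg _ (fun i => dh (j i)) fun i => hdeg (j i)

end Dual

/-! ### Linear maps on `∧W` from graded symmetric multilinear maps -/

section Symmetric

variable {k V : Type*} [Field k] [AddCommGroup V] [Module k V] (𝒲 : ℤ → Submodule k V)

theorem ext_mem_of_word [DirectSum.Decomposition 𝒲] (N : Submodule k (Ext 𝒲))
    (hN : ∀ (n : ℕ) (w : Fin n → V) (d : Fin n → ℤ), (∀ i, w i ∈ 𝒲 (d i)) →
      (List.ofFn fun i => gen 𝒲 (w i)).prod ∈ N) (x : Ext 𝒲) : x ∈ N := by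
  have key : ∀ x, x ∈ Submodule.span k {x | ∃ (n : ℕ) (w : Fin n → V) (d : Fin n → ℤ),
      (∀ i, w i ∈ 𝒲 (d i)) ∧ x = (List.ofFn fun i => gen 𝒲 (w i)).prod} := by
    apply ext_mem_of_gen_mul 𝒲
    · exact Submodule.subset_span ⟨0, Fin.elim0, Fin.elim0, fun i => i.elim0, by simp⟩
    · intro p w x hw hx
      induction hx using Submodule.span_induction with
      | mem x hx =>
        obtain ⟨n, v, d, hv, rfl⟩ := hx
        refine Submodule.subset_span ⟨n + 1, Fin.cons w v, Fin.cons p d, ?_, ?_⟩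
        · intro i
          induction i using Fin.cases with
          | zero => exact hw
          | succ i => exact hv i
        · simp [List.ofFn_succ]
      | zero => simp
      | add x y _ _ hx hy => rw [mul_add]; exact add_mem hx hy
      | smul r x _ hx => rw [mul_smul_comm]; exact Submodule.smul_mem _ _ hx
  refine Submodule.span_le.2 ?_ (key x)
  rintro _ ⟨n, w, d, hw, rfl⟩
  exact hN n w d hw

variable (M : Type*) [AddCommGroup M] [Module k M]

/-- Families of multilinear maps that are graded symmetric. -/
def symFamily : Submodule k (∀ n : ℕ, MultilinearMap k (fun _ : Fin n => V) M) where
  carrier := {φ | ∀ (n : ℕ) (v : Fin (n + 1) → V) (d : Fin (n + 1) → ℤ), (∀ i, v i ∈ 𝒲 (d i)) →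
    ∀ i : Fin n, φ (n + 1) v = ((d i.castSucc * d i.succ).negOnePow : ℤ) •
      φ (n + 1) (fun j => v (Equiv.swap i.castSucc i.succ j))}
  add_mem' hφ hψ n v d hv i := by
    simp only [Pi.add_apply, add_apply, hφ n v d hv i, hψ n v d hv i, smul_add]
  zero_mem' n v d hv i := by simp
  smul_mem' r φ hφ n v d hv i := by
    simp only [Pi.smul_apply, smul_apply, hφ n v d hv i]
    rw [smul_comm]

/-- Inserting `w` into the last argument of all members of a family. -/
def insertLast : V →ₗ[k] Module.End k (∀ n : ℕ, MultilinearMap k (fun _ : Fin n => V) M) where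
  toFun w :=
    { toFun := fun φ n => (LinearMap.applyₗ w).compMultilinearMap (φ (n + 1)).curryRight
      map_add' := fun φ ψ => by ext; simp
      map_smul' := fun r φ => by ext; simp }
  map_add' v w := by ext; simp
  map_smul' r v := by ext; simp

theorem insertLast_apply (w : V) (φ : ∀ n : ℕ, MultilinearMap k (fun _ : Fin n => V) M) (n : ℕ)
    (v : Fin n → V) : insertLast M w φ n v = φ (n + 1) (Fin.snoc v w : Fin (n + 1) → V) := rfl

variable {M}

theorem snoc_comp_swap {V : Type*} {n : ℕ} (v : Fin (n + 1) → V) (w : V) (i : Fin n) :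
    (fun j => (Fin.snoc v w : Fin (n + 2) → V)
      (Equiv.swap i.castSucc.castSucc i.castSucc.succ j)) =
    (Fin.snoc (fun j => v (Equiv.swap i.castSucc i.succ j)) w : Fin (n + 2) → V) := by
  funext j
  induction j using Fin.lastCases with
  | last =>
    rw [Equiv.swap_apply_of_ne_of_ne]
    · simp
    · simp [Fin.ext_iff]; omega
    · simp [Fin.ext_iff]; omega
  | cast j =>
    have : Equiv.swap i.castSucc.castSucc i.castSucc.succ j.castSucc =
        (Equiv.swap i.castSucc i.succ j).castSucc := by
      rw [Fin.succ_castSucc]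
      exact Function.Injective.swap_apply (Fin.castSucc_injective _) _ _ _
    rw [this, Fin.snoc_castSucc, Fin.snoc_castSucc]

theorem snoc_mem {n : ℕ} {v : Fin n → V} {d : Fin n → ℤ} (hv : ∀ i, v i ∈ 𝒲 (d i)) {w : V} {p : ℤ}
    (hw : w ∈ 𝒲 p) (i : Fin (n + 1)) :
    (Fin.snoc v w : Fin (n + 1) → V) i ∈ 𝒲 ((Fin.snoc d p : Fin (n + 1) → ℤ) i) := by
  induction i using Fin.lastCases with
  | last => simpa using hw
  | cast i => simpa using hv i

theorem insertLast_mem [DirectSum.Decomposition 𝒲] (w : V)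
    {φ : ∀ n : ℕ, MultilinearMap k (fun _ : Fin n => V) M} (hφ : φ ∈ symFamily 𝒲 M) :
    insertLast M w φ ∈ symFamily 𝒲 M := by
  induction w using DirectSum.Decomposition.inductionOn 𝒲 with
  | zero => simp
  | add v w hv hw => rw [map_add, LinearMap.add_apply]; exact add_mem hv hw
  | @homogeneous p w =>
    intro n v d hv i
    have h := hφ (n + 1) (Fin.snoc v w : Fin (n + 2) → V) (Fin.snoc d p : Fin (n + 2) → ℤ)
      (snoc_mem 𝒲 hv w.2) i.castSucc
    rw [snoc_comp_swap] at h
    have hd : (Fin.snoc d p : Fin (n + 2) → ℤ) i.castSucc.succ = d i.succ := by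
      rw [Fin.succ_castSucc]
      exact Fin.snoc_castSucc (α := fun _ => ℤ) _ _ _
    rw [insertLast_apply, insertLast_apply, h, hd, Fin.snoc_castSucc]

/-- The universal property of `∧W` with respect to graded symmetric multilinear maps: `∧W` acts on
the graded symmetric families by insertion into the last arguments. -/
theorem exists_hom_of_symFamily [DirectSum.Decomposition 𝒲] {ι : Type*} [Finite ι]
    {h : Module.Basis ι k V} {dh : ι → ℤ} (hdeg : ∀ s, h s ∈ 𝒲 (dh s))
    {φ : ∀ n : ℕ, MultilinearMap k (fun _ : Fin n => V) M} (hφ : φ ∈ symFamily 𝒲 M) :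
    ∃ F : Ext 𝒲 →ₗ[k] M, ∀ (n : ℕ) (w : Fin n → V),
      F (List.ofFn fun i => gen 𝒲 (w i)).prod = φ n w := by
  let act : V →ₗ[k] Module.End k (symFamily 𝒲 M) :=
    { toFun := fun w => (insertLast M w).restrict fun φ hφ => insertLast_mem 𝒲 w hφ
      map_add' := fun v w => by ext; simp
      map_smul' := fun r w => by ext; simp }
  have hact : ∀ w ψ, (act w ψ).1 = insertLast M w ψ.1 := fun w ψ => rfl
  have hcomm : ∀ (p q : ℤ) (x y : V), x ∈ 𝒲 p → y ∈ 𝒲 q →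
      act x * act y = ((p * q).negOnePow : ℤ) • (act y * act x) := by
    intro p q x y hx hy
    refine LinearMap.ext fun ψ => Subtype.ext (funext fun n => ?_)
    refine multilinear_ext (𝒱 := 𝒲) hdeg fun v d hv => ?_
    have hs := ψ.2 (n + 1) (Fin.snoc (Fin.snoc v x : Fin (n + 1) → V) y : Fin (n + 2) → V)
      (Fin.snoc (Fin.snoc d p : Fin (n + 1) → ℤ) q : Fin (n + 2) → ℤ)
      (snoc_mem 𝒲 (snoc_mem 𝒲 hv hx) hy) (Fin.last n)
    have hsw : (fun j => (Fin.snoc (Fin.snoc v x : Fin (n + 1) → V) y : Fin (n + 2) → V)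
        (Equiv.swap (Fin.last n).castSucc (Fin.last n).succ j)) =
        (Fin.snoc (Fin.snoc v y : Fin (n + 1) → V) x : Fin (n + 2) → V) := by
      funext j
      induction j using Fin.lastCases with
      | last =>
        have : Equiv.swap (Fin.last n).castSucc (Fin.last n).succ (Fin.last (n + 1)) =
          (Fin.last n).castSucc := Equiv.swap_apply_right _ _
        rw [this]; simp
      | cast j =>
        induction j using Fin.lastCases with
        | last =>
          rw [Equiv.swap_apply_left]
          rw [Fin.succ_last]; simp
        | cast j =>
          rw [Equiv.swap_apply_of_ne_of_ne]
          · simp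
          · simp [Fin.ext_iff]; omega
          · simp [Fin.ext_iff]; omega
    rw [hsw] at hs
    have hsign : (Fin.snoc (Fin.snoc d p : Fin (n + 1) → ℤ) q : Fin (n + 2) → ℤ)
        (Fin.last n).castSucc * (Fin.snoc (Fin.snoc d p : Fin (n + 1) → ℤ) q : Fin (n + 2) → ℤ)
        (Fin.last n).succ = p * q := by
      rw [Fin.succ_last]; simp
    rw [hsign] at hs
    exact hs
  let A := extLift 𝒲 (S := Module.End k (symFamily 𝒲 M)) act hcomm
  have key : ∀ (n : ℕ) (w : Fin n → V) (ψ : symFamily 𝒲 M),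
      (A (List.ofFn fun i => gen 𝒲 (w i)).prod ψ).1 0 Fin.elim0 = ψ.1 n w := by
    intro n
    induction n with
    | zero =>
      intro w ψ
      simp only [List.ofFn_zero, List.prod_nil, map_one, Module.End.one_apply]
      congr 1
      exact Subsingleton.elim _ _
    | succ n ih =>
      intro w ψ
      rw [List.ofFn_succ', List.concat_eq_append, List.prod_append, List.prod_singleton, map_mul,
        Module.End.mul_apply, ih, extLift_gen, hact, insertLast_apply]
      congr 1
      exact Fin.snoc_init_self w
  refine ⟨{ toFun := fun x => (A x ⟨φ, hφ⟩).1 0 Fin.elim0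
            map_add' := fun x y => by simp
            map_smul' := fun r x => by simp }, fun n w => key n w ⟨φ, hφ⟩⟩

end Symmetric

namespace SymBialgebra

variable {R C : Type*} [CommRing R] [Ring C] [Algebra R C] (S : SymBialgebra R C)

/-- The square of the sum of the coderivation `conv f` and a multiple of the multiplication by the
element `y = ∑ v i * w i`. -/
theorem sq_conv_add {e : ℤ} {f : C →ₗ[R] C} (hf : S.Par e f) (he : Odd e) (hl : ∀ x, f x ∈ S.lin)
    {ι : Type*} [Fintype ι] {v w : ι → C} {p q : ι → ℤ} (hv : ∀ i, v i ∈ S.W (p i))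
    (hw : ∀ i, w i ∈ S.W (q i)) (hpq : ∀ i, Odd (p i + q i))
    (hsymm : ∑ i, ((q i).negOnePow : ℤ) •
        (LinearMap.mulLeft R (w i) ∘ₗ f ∘ₗ LinearMap.mulLeft R (v i))
      = ∑ i, ((p i).negOnePow : ℤ) • (LinearMap.mulLeft R (v i) ∘ₗ f ∘ₗ LinearMap.mulLeft R (w i)))
    (r : R) :
    (S.conv f + r • LinearMap.mulLeft R (∑ i, v i * w i)) ∘ₗ
      (S.conv f + r • LinearMap.mulLeft R (∑ i, v i * w i)) =
    S.conv ((f ∘ₗ S.conv f + r • (f ∘ₗ LinearMap.mulLeft R (∑ i, v i * w i))) +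
      (2 * r) • ∑ i, ((p i).negOnePow : ℤ) •
        (LinearMap.mulLeft R (v i) ∘ₗ f ∘ₗ LinearMap.mulLeft R (w i))) := by
  have h1 : S.conv f ∘ₗ S.conv f = S.conv (f ∘ₗ S.conv f) := by
    rw [((S.isCod_conv hf hl).sq hf.conv he).eq_conv (hf.conv.comp hf.conv)]
    congr 1
    ext x
    exact S.π_one_conv_lin hl _
  have hy : LinearMap.mulLeft R (∑ i, v i * w i) = ∑ i, LinearMap.mulLeft R (v i * w i) := by
    ext x; simp [Finset.sum_mul, mul_assoc]
  have hsum : ∀ (F : C →ₗ[R] C) (G : ι → C →ₗ[R] C), F ∘ₗ ∑ i, G i = ∑ i, F ∘ₗ G i := by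
    intro F G; ext x; simp
  have hsum' : ∀ (F : C →ₗ[R] C) (G : ι → C →ₗ[R] C), (∑ i, G i) ∘ₗ F = ∑ i, G i ∘ₗ F := by
    intro F G; ext x; simp
  have h2 : S.conv f ∘ₗ LinearMap.mulLeft R (∑ i, v i * w i) +
      LinearMap.mulLeft R (∑ i, v i * w i) ∘ₗ S.conv f =
      S.conv (f ∘ₗ LinearMap.mulLeft R (∑ i, v i * w i) + (2 : R) • ∑ i, ((p i).negOnePow : ℤ) •
        (LinearMap.mulLeft R (v i) ∘ₗ f ∘ₗ LinearMap.mulLeft R (w i))) := by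
    rw [two_smul]
    nth_rewrite 1 [← hsymm]
    rw [hy, hsum, hsum', hsum, ← Finset.sum_add_distrib,
      ← Finset.sum_add_distrib, ← Finset.sum_add_distrib, map_sum]
    refine Finset.sum_congr rfl fun i _ => ?_
    rw [S.conv_anticomm hf he (hv i) (hw i) (hpq i), add_assoc]
  have h3 : LinearMap.mulLeft R (∑ i, v i * w i) ∘ₗ LinearMap.mulLeft R (∑ i, v i * w i) = 0 := by
    rw [← LinearMap.mulLeft_mul, S.mul_self_eq_zero_of_quad hv hw hpq,
      LinearMap.mulLeft_zero_eq_zero]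
  rw [LinearMap.comp_add, LinearMap.add_comp, LinearMap.add_comp, LinearMap.comp_smul,
    LinearMap.comp_smul, LinearMap.smul_comp, LinearMap.smul_comp, h3, smul_zero, smul_zero,
    add_zero, h1, add_assoc (f ∘ₗ S.conv f), map_add, add_assoc, mul_comm 2 r, mul_smul,
    ← smul_add r, ← smul_add r, map_smul, ← h2]
  congr 2
  rw [add_comm]

variable {G₁ G₂ : C →ₗ[R] C}

theorem π_one_conv_add (h₁ : ∀ x, G₁ x ∈ S.lin) (h₂ : ∀ x, G₂ x ∈ S.quad) (x : C) :
    S.π 1 (S.conv (G₁ + G₂) x) = G₁ x := by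
  rw [map_add, LinearMap.add_apply, map_add, S.π_one_conv_lin h₁, S.π_one_conv_quad h₂, add_zero]

/-- The linear and the quadratic part of a convolution can be recovered from it. -/
theorem conv_add_eq_zero_iff (h₁ : ∀ x, G₁ x ∈ S.lin) (h₂ : ∀ x, G₂ x ∈ S.quad) :
    S.conv (G₁ + G₂) = 0 ↔ G₁ = 0 ∧ G₂ = 0 := by
  constructor
  · intro h
    have hG : G₁ = 0 := by
      ext x
      rw [← S.π_one_conv_add h₁ h₂ x, h]
      simp
    refine ⟨hG, ?_⟩
    ext x
    rw [hG, zero_add] at h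
    rw [← S.π_two_conv_quad h₂ x, h]
    simp
  · rintro ⟨rfl, rfl⟩
    simp

end SymBialgebra

/-! ### Coefficients -/

/-- Coefficient functionals `c g` on an algebra `R` of polynomials or power series in `t`. -/
structure CoeffSystem {k R : Type*} [Field k] [CommRing R] [Algebra k R] (t : R)
    (c : ℕ → R →ₗ[k] k) : Prop where
  ext : ∀ r, (∀ g, c g r = 0) → r = 0
  mul : ∀ g r r', c g (r * r') = ∑ p ∈ Finset.HasAntidiagonal.antidiagonal g, c p.1 r * c p.2 r'
  t_zero : ∀ r, c 0 (t * r) = 0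
  t_succ : ∀ g r, c (g + 1) (t * r) = c g r

section Coeff

variable {k V R : Type*} [Field k] [AddCommGroup V] [Module k V] [CommRing R] [Algebra k R]
  {𝒲 : ℤ → Submodule k V} {t : R} {c : ℕ → R →ₗ[k] k}

@[simp] theorem coefR_tmul (c : R →ₗ[k] k) (r : R) (a : Ext 𝒲) :
    coefR 𝒲 c (r ⊗ₜ a) = c r • a := by
  simp [coefR]

/-- The coefficients are jointly injective on `∧W ⊗ R` as well. -/
theorem CoeffSystem.eq_zero (hc : CoeffSystem t c) {x : ExtR R 𝒲}
    (h : ∀ g, coefR 𝒲 (c g) x = 0) : x = 0 := by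
  classical
  let b := Module.Basis.ofVectorSpace k (Ext 𝒲)
  let e := TensorProduct.equivFinsuppOfBasisRight (M := R) b
  have key : ∀ g i (x : ExtR R 𝒲), c g (e x i) = b.repr (coefR 𝒲 (c g) x) i := by
    intro g i x
    induction x using TensorProduct.induction_on with
    | zero => simp
    | add x y hx hy => simp only [map_add, Finsupp.add_apply, hx, hy]
    | tmul r a => simp [e, mul_comm]
  apply e.injective
  ext i
  rw [map_zero, Finsupp.zero_apply]
  refine hc.ext _ fun g => ?_
  rw [key, h]
  simp

theorem CoeffSystem.coefR_smul (hc : CoeffSystem t c) (g : ℕ) (r : R) (u : ExtR R 𝒲) :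
    coefR 𝒲 (c g) (r • u) =
      ∑ p ∈ Finset.HasAntidiagonal.antidiagonal g, c p.2 r • coefR 𝒲 (c p.1) u := by
  induction u using TensorProduct.induction_on with
  | zero => simp
  | add x y hx hy => simp only [smul_add, map_add, hx, hy, Finset.sum_add_distrib]
  | tmul r' b =>
    rw [TensorProduct.smul_tmul', coefR_tmul, smul_eq_mul, mul_comm, hc.mul, Finset.sum_smul]
    simp only [coefR_tmul, smul_smul, mul_comm]

/-- The coefficients of `H z` for an `R`-linear map `H`. -/
theorem CoeffSystem.coefR_hom (hc : CoeffSystem t c) (H : ExtR R 𝒲 →ₗ[R] ExtR R 𝒲) (g : ℕ)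
    (z : ExtR R 𝒲) : coefR 𝒲 (c g) (H z) = ∑ p ∈ Finset.HasAntidiagonal.antidiagonal g,
      coefR 𝒲 (c p.1) (H ((1 : R) ⊗ₜ coefR 𝒲 (c p.2) z)) := by
  induction z using TensorProduct.induction_on with
  | zero => simp
  | add x y hx hy =>
    simp only [map_add, TensorProduct.tmul_add, hx, hy, Finset.sum_add_distrib]
  | tmul r a =>
    have h1 : r ⊗ₜ[k] a = r • ((1 : R) ⊗ₜ[k] a) := by simp [TensorProduct.smul_tmul']
    have h2 : ∀ s : k, (1 : R) ⊗ₜ[k] (s • a) = s • ((1 : R) ⊗ₜ[k] a) := fun s => by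
      rw [TensorProduct.tmul_smul]
    rw [h1, map_smul]
    simp only [coefR_tmul, h2, ← h1]
    have h3 : ∀ s : k, H (s • ((1 : R) ⊗ₜ[k] a)) = s • H ((1 : R) ⊗ₜ[k] a) := fun s => by
      rw [LinearMap.map_smul_of_tower]
    simp only [h3, map_smul]
    exact hc.coefR_smul g r _

theorem CoeffSystem.coefR_t_zero (hc : CoeffSystem t c) (x : ExtR R 𝒲) :
    coefR 𝒲 (c 0) (t • x) = 0 := by
  induction x using TensorProduct.induction_on with
  | zero => simp
  | add x y hx hy => rw [smul_add, map_add, hx, hy, add_zero]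
  | tmul r a => rw [TensorProduct.smul_tmul', coefR_tmul, smul_eq_mul, hc.t_zero, zero_smul]

theorem CoeffSystem.coefR_t_succ (hc : CoeffSystem t c) (g : ℕ) (x : ExtR R 𝒲) :
    coefR 𝒲 (c (g + 1)) (t • x) = coefR 𝒲 (c g) x := by
  induction x using TensorProduct.induction_on with
  | zero => simp
  | add x y hx hy => rw [smul_add, map_add, hx, hy, map_add]
  | tmul r a => rw [TensorProduct.smul_tmul', coefR_tmul, smul_eq_mul, hc.t_succ, coefR_tmul]

theorem coefR_projR (c : R →ₗ[k] k) (n : ℕ) (x : ExtR R 𝒲) :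
    coefR 𝒲 c (projR R 𝒲 n x) = extProj 𝒲 n (coefR 𝒲 c x) := by
  induction x using TensorProduct.induction_on with
  | zero => simp
  | add x y hx hy => simp only [map_add, hx, hy]
  | tmul r a => simp [projR]

theorem coefR_genR_mul (c : R →ₗ[k] k) (w : V) (x : ExtR R 𝒲) :
    coefR 𝒲 c (genR R 𝒲 w * x) = gen 𝒲 w * coefR 𝒲 c x := by
  induction x using TensorProduct.induction_on with
  | zero => simp
  | add x y hx hy => simp only [mul_add, map_add, hx, hy]
  | tmul r a => simp [genR_mul_tmul]

theorem coefR_mem_extDeg (c : R →ₗ[k] k) {p : ℤ} {x : ExtR R 𝒲}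
    (hx : x ∈ (extDeg 𝒲 p).baseChange R) : coefR 𝒲 c x ∈ extDeg 𝒲 p := by
  rw [Submodule.baseChange_eq_span] at hx
  have key : ∀ r : R, coefR 𝒲 c (r • x) ∈ extDeg 𝒲 p := by
    induction hx using Submodule.span_induction with
    | mem x hx =>
      obtain ⟨a, ha, rfl⟩ := hx
      intro r
      rw [TensorProduct.mk_apply, TensorProduct.smul_tmul', coefR_tmul]
      exact Submodule.smul_mem _ _ ha
    | zero => simp
    | add x y _ _ hx hy => intro r; rw [smul_add, map_add]; exact add_mem (hx r) (hy r)
    | smul s x _ hx => intro r; rw [smul_smul]; exact hx _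
  simpa using key 1

theorem extW_mem {p : ℤ} {x : Ext 𝒲} (hx : x ∈ extDeg 𝒲 p) : extW 𝒲 x ∈ 𝒲 p := by
  have : extDeg 𝒲 p ≤ (𝒲 p).comap (extW 𝒲) := by
    refine Submodule.span_le.2 ?_
    rintro _ ⟨n, x, d, hw, rfl, rfl⟩
    change extW 𝒲 _ ∈ 𝒲 _
    match n, x, d, hw with
    | 0, _, _, _ => rw [List.ofFn_zero, List.prod_nil, extW_one]; exact zero_mem _
    | 1, _, _, hw => simpa using hw 0
    | n + 2, _, _, _ =>
      rw [List.ofFn_succ, List.ofFn_succ, List.prod_cons, List.prod_cons, extW_gen_mul_gen_mul]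
      exact zero_mem _
  exact this hx

end Coeff

/-! ### Degrees -/

section Degree

variable {k V : Type*} [Field k] [AddCommGroup V] [Module k V] {R : Type*} [CommRing R]
  [Algebra k R] {𝒲 : ℤ → Submodule k V}

/-- The word `w₁ ⋯ wₙ` in `∧W`. -/
abbrev word (𝒲 : ℤ → Submodule k V) {n : ℕ} (w : Fin n → V) : Ext 𝒲 :=
  (List.ofFn fun i => gen 𝒲 (w i)).prod

theorem word_mem {n : ℕ} {w : Fin n → V} {d : Fin n → ℤ} (hw : ∀ i, w i ∈ 𝒲 (d i)) :
    word 𝒲 w ∈ extDeg 𝒲 (∑ i, d i) :=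
  Submodule.subset_span ⟨n, w, d, hw, rfl, rfl⟩

theorem baseChange_le {A : Submodule k (Ext 𝒲)} {N : Submodule R (ExtR R 𝒲)}
    (h : ∀ a ∈ A, (1 : R) ⊗ₜ[k] a ∈ N) : A.baseChange R ≤ N := by
  rw [Submodule.baseChange_eq_span, Submodule.span_le]
  rintro _ ⟨a, ha, rfl⟩
  exact h a ha

theorem extDeg_baseChange_le {p : ℤ} {N : Submodule R (ExtR R 𝒲)}
    (h : ∀ (n : ℕ) (w : Fin n → V) (d : Fin n → ℤ), (∀ i, w i ∈ 𝒲 (d i)) → ∑ i, d i = p →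
      (1 : R) ⊗ₜ[k] word 𝒲 w ∈ N) : (extDeg 𝒲 p).baseChange R ≤ N := by
  refine baseChange_le ?_
  have : extDeg 𝒲 p ≤ (N.restrictScalars k).comap (TensorProduct.mk k R (Ext 𝒲) 1) := by
    refine Submodule.span_le.2 ?_
    rintro _ ⟨n, w, d, hw, hd, rfl⟩
    exact h n w d hw hd
  exact fun a ha => this ha

theorem extR_mem_of_word [DirectSum.Decomposition 𝒲] {N : Submodule R (ExtR R 𝒲)}
    (h : ∀ (n : ℕ) (w : Fin n → V) (d : Fin n → ℤ), (∀ i, w i ∈ 𝒲 (d i)) →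
      (1 : R) ⊗ₜ[k] word 𝒲 w ∈ N) (x : ExtR R 𝒲) : x ∈ N := by
  induction x using TensorProduct.induction_on with
  | zero => simp
  | add x y hx hy => exact add_mem hx hy
  | tmul r a =>
    have h1 : r ⊗ₜ[k] a = r • ((1 : R) ⊗ₜ[k] a) := by simp [TensorProduct.smul_tmul']
    rw [h1]
    exact N.smul_mem r (ext_mem_of_word 𝒲
      ((N.restrictScalars k).comap (TensorProduct.mk k R (Ext 𝒲) 1)) h a)

theorem extR_hom_ext [DirectSum.Decomposition 𝒲] {M : Type*} [AddCommGroup M] [Module R M]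
    {F G : ExtR R 𝒲 →ₗ[R] M} (h : ∀ (n : ℕ) (w : Fin n → V) (d : Fin n → ℤ),
      (∀ i, w i ∈ 𝒲 (d i)) → F (1 ⊗ₜ[k] word 𝒲 w) = G (1 ⊗ₜ[k] word 𝒲 w)) : F = G :=
  LinearMap.ext fun x => extR_mem_of_word (N := LinearMap.eqLocus F G) h x

theorem word_succ {n : ℕ} (w : Fin (n + 1) → V) :
    (1 : R) ⊗ₜ[k] word 𝒲 w = genR R 𝒲 (w 0) * (1 ⊗ₜ[k] word 𝒲 fun i => w i.succ) := by
  rw [genR_mul_tmul, word, List.ofFn_succ, List.prod_cons]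

theorem genR_mul_mem {p q : ℤ} {w : V} (hw : w ∈ 𝒲 q) {x : ExtR R 𝒲}
    (hx : x ∈ (extDeg 𝒲 p).baseChange R) : genR R 𝒲 w * x ∈ (extDeg 𝒲 (q + p)).baseChange R := by
  have : (extDeg 𝒲 p).baseChange R ≤
      ((extDeg 𝒲 (q + p)).baseChange R).comap (LinearMap.mulLeft R (genR R 𝒲 w)) := by
    refine extDeg_baseChange_le ?_
    rintro n v d hv rfl
    rw [Submodule.mem_comap, LinearMap.mulLeft_apply, genR_mul_tmul]
    refine Submodule.tmul_mem_baseChange_of_mem _ (Submodule.subset_span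
      ⟨n + 1, Fin.cons w v, Fin.cons q d, ?_, ?_, ?_⟩)
    · intro i
      induction i using Fin.cases with
      | zero => exact hw
      | succ i => exact hv i
    · simp [Fin.sum_univ_succ]
    · simp [List.ofFn_succ]
  exact this hx

theorem hasDegree_of_word {e : ℤ} {F : Module.End R (ExtR R 𝒲)}
    (h : ∀ (n : ℕ) (w : Fin n → V) (d : Fin n → ℤ), (∀ i, w i ∈ 𝒲 (d i)) →
      F (1 ⊗ₜ[k] word 𝒲 w) ∈ (extDeg 𝒲 (∑ i, d i + e)).baseChange R) : HasDegree 𝒲 e F := by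
  intro p x hx
  have : (extDeg 𝒲 p).baseChange R ≤ ((extDeg 𝒲 (p + e)).baseChange R).comap F := by
    refine extDeg_baseChange_le ?_
    rintro n w d hw rfl
    exact h n w d hw
  exact this hx

theorem word_mem_baseChange {n : ℕ} {w : Fin n → V} {d : Fin n → ℤ} (hw : ∀ i, w i ∈ 𝒲 (d i)) :
    (1 : R) ⊗ₜ[k] word 𝒲 w ∈ (extDeg 𝒲 (∑ i, d i)).baseChange R :=
  Submodule.tmul_mem_baseChange_of_mem _ (word_mem hw)

theorem HasDegree.comp {e f : ℤ} {F G : Module.End R (ExtR R 𝒲)} (hF : HasDegree 𝒲 e F)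
    (hG : HasDegree 𝒲 f G) : HasDegree 𝒲 (f + e) (F ∘ₗ G) := by
  intro p x hx
  rw [← add_assoc]
  exact hF _ _ (hG _ _ hx)

theorem hasDegree_mulLeft_genR {q : ℤ} {w : V} (hw : w ∈ 𝒲 q) :
    HasDegree 𝒲 q (LinearMap.mulLeft R (genR R 𝒲 w)) := by
  intro p x hx
  rw [add_comm]
  exact genR_mul_mem hw hx

theorem extProj_word (m : ℕ) {n : ℕ} (w : Fin n → V) :
    extProj 𝒲 m (word 𝒲 w) = if m = n then word 𝒲 w else 0 := by
  induction n generalizing m with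
  | zero =>
    cases m with
    | zero => simp [word, extProj_zero_one]
    | succ m => simp [word, extProj_succ_one]
  | succ n ih =>
    rw [word, List.ofFn_succ, List.prod_cons]
    cases m with
    | zero => simp [extProj_zero_gen_mul]
    | succ m =>
      rw [extProj_succ_gen_mul, ih]
      split_ifs with h1 h2 h2
      · rfl
      · omega
      · omega
      · simp

theorem hasDegree_projR (m : ℕ) : HasDegree 𝒲 0 (projR R 𝒲 m) := by
  refine hasDegree_of_word fun n w d hw => ?_
  rw [projR, LinearMap.baseChange_tmul, extProj_word, add_zero]
  split_ifs
  · exact word_mem_baseChange hw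
  · simp

variable [CharZero k] [DirectSum.Decomposition 𝒲]

theorem genR_mem_W {p : ℤ} {w : V} (hw : w ∈ 𝒲 p) : genR R 𝒲 w ∈ (extBialgebra R 𝒲).W p :=
  ⟨w, hw, rfl⟩

theorem isWord_word {n : ℕ} {w : Fin n → V} {d : Fin n → ℤ} (hw : ∀ i, w i ∈ 𝒲 (d i)) :
    (extBialgebra R 𝒲).IsWord n (∑ i, d i) (1 ⊗ₜ[k] word 𝒲 w) := by
  induction n with
  | zero =>
    have h1 : (1 : R) ⊗ₜ[k] word 𝒲 w = 1 := by simp [word]; rfl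
    rw [h1, Fin.sum_univ_zero]
    exact .one
  | succ n ih =>
    rw [word_succ, Fin.sum_univ_succ]
    exact .gen_mul (genR_mem_W (hw 0)) (ih fun i => hw _)

/-- Homogeneous maps have a parity. -/
theorem par_of_hasDegree {e : ℤ} {F : Module.End R (ExtR R 𝒲)} (hF : HasDegree 𝒲 e F) :
    (extBialgebra R 𝒲).Par e F := by
  have hs : ∀ p, ∀ x ∈ (extDeg 𝒲 p).baseChange R, ∀ q,
      (extBialgebra R 𝒲).sg q x = ((p * q).negOnePow : ℤ) • x := by
    intro p x hx q
    have : (extDeg 𝒲 p).baseChange R ≤ LinearMap.eqLocus ((extBialgebra R 𝒲).sg q).toLinearMap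
        (((p * q).negOnePow : ℤ) • LinearMap.id) := by
      refine extDeg_baseChange_le ?_
      rintro n w d hw rfl
      exact (isWord_word hw).sg q
    exact this hx
  intro q x
  have key : F ∘ₗ ((extBialgebra R 𝒲).sg q).toLinearMap =
      ((e * q).negOnePow : ℤ) • (((extBialgebra R 𝒲).sg q).toLinearMap ∘ₗ F) := by
    refine extR_hom_ext fun n w d hw => ?_
    have h1 := word_mem_baseChange (R := R) hw
    simp only [LinearMap.comp_apply, LinearMap.smul_apply, AlgHom.toLinearMap_apply]
    rw [hs _ _ h1, hs _ _ (hF _ _ h1), map_zsmul, SymBialgebra.negOnePow_smul_smul]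
    refine SymBialgebra.negOnePow_smul_congr ⟨- (e * q), ?_⟩ _
    ring
  exact LinearMap.congr_fun key x

theorem hasDegree_conv {e : ℤ} {F : Module.End R (ExtR R 𝒲)} (hF : HasDegree 𝒲 e F) :
    HasDegree 𝒲 e ((extBialgebra R 𝒲).conv F) := by
  refine hasDegree_of_word fun n w d hw => ?_
  induction n generalizing e F with
  | zero =>
    have h1 : (1 : R) ⊗ₜ[k] word 𝒲 w = 1 := by simp [word]; rfl
    have h2 := word_mem_baseChange (R := R) hw
    rw [h1] at h2 ⊢
    rw [SymBialgebra.conv_one]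
    exact hF _ _ h2
  | succ n ih =>
    rw [word_succ, SymBialgebra.conv_gen_mul _ (par_of_hasDegree hF) (genR_mem_W (hw 0)),
      Fin.sum_univ_succ]
    refine add_mem ?_ (zsmul_mem ?_ _)
    · have := ih (hF.comp (hasDegree_mulLeft_genR (hw 0))) (fun i => w i.succ) (fun i => d i.succ)
        (fun i => hw _)
      convert this using 3
      ring
    · rw [add_assoc]
      exact genR_mul_mem (hw 0) (ih hF _ _ fun i => hw _)

/-- The convolution of `F` with the identity on a word. -/
theorem conv_word (F : Module.End R (ExtR R 𝒲)) {n : ℕ} {w : Fin n → V} {d : Fin n → ℤ}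
    (hw : ∀ i, w i ∈ 𝒲 (d i)) : (extBialgebra R 𝒲).conv F (1 ⊗ₜ[k] word 𝒲 w) =
      ∑ a : Fin (n + 1), ∑ σ ∈ unshuffles a n, (koszulSign σ d : ℤ) •
        (F (1 ⊗ₜ[k] ((List.ofFn fun i => gen 𝒲 (w (σ i))).take a).prod) *
          (1 ⊗ₜ[k] ((List.ofFn fun i => gen 𝒲 (w (σ i))).drop a).prod)) := by
  have h1 : ∀ z : Ext 𝒲 ⊗[k] Ext 𝒲, LinearMap.mul' R (ExtR R 𝒲) (LinearMap.rTensor (ExtR R 𝒲) F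
      (TensorProduct.AlgebraTensorModule.distribBaseChange k R (Ext 𝒲) (Ext 𝒲) ((1 : R) ⊗ₜ z))) =
      LinearMap.mul' k (ExtR R 𝒲) (TensorProduct.map (F.restrictScalars k ∘ₗ
        TensorProduct.mk k R (Ext 𝒲) 1) (TensorProduct.mk k R (Ext 𝒲) 1) z) := by
    intro z
    induction z using TensorProduct.induction_on with
    | zero => simp
    | add x y hx hy => simp only [map_add, TensorProduct.tmul_add, hx, hy]
    | tmul a b => simp
  rw [SymBialgebra.conv_apply]
  change LinearMap.mul' R (ExtR R 𝒲) (LinearMap.rTensor (ExtR R 𝒲) F (comulR R 𝒲 _)) = _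
  rw [comulR_tmul, one_smul, h1, comul_prod 𝒲 w d hw]
  simp only [map_sum, map_zsmul, TensorProduct.map_tmul, LinearMap.mul'_apply,
    LinearMap.comp_apply, TensorProduct.mk_apply, LinearMap.restrictScalars_apply]

end Degree

/-! ### The order two coderivation and the square of its perturbations -/

section Theta

variable {k V ι R : Type*} [Field k] [CharZero k] [AddCommGroup V] [Module k V]
  [Fintype ι] [DecidableEq ι] [CommRing R] [Algebra k R] {𝒱 : ℤ → Submodule k V}
  [DirectSum.Decomposition 𝒱] {B : LinearMap.BilinForm k V} (hB : IsLoopForm 𝒱 B)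
  {h h' : Module.Basis ι k V} {dh : ι → ℤ} (hdeg : ∀ s, h s ∈ 𝒱 (dh s))
  (hdual : ∀ s u, B (h' s) (h u) = if s = u then 1 else 0) (t : R)

variable (h h') in
/-- Multiplication by `½ t y`. -/
def theta : Module.End R (ExtR R (susp 𝒱)) :=
  ((2 : k)⁻¹ • t) • LinearMap.mulLeft R (∑ s, genR R (susp 𝒱) (h s) * genR R (susp 𝒱) (h' s))

omit [CharZero k] [DecidableEq ι] [DirectSum.Decomposition 𝒱] in
theorem one_tmul_symElement : (1 : R) ⊗ₜ[k] symElement 𝒱 h h' =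
    ∑ s, genR R (susp 𝒱) (h s) * genR R (susp 𝒱) (h' s) := by
  simp only [symElement, TensorProduct.tmul_sum, genR_apply, Algebra.TensorProduct.tmul_mul_tmul,
    one_mul]

omit [CharZero k] [DecidableEq ι] [DirectSum.Decomposition 𝒱] in
theorem theta_apply (x : ExtR R (susp 𝒱)) : theta (𝒱 := 𝒱) h h' t x =
    ((2 : k)⁻¹ • t) • ∑ s, genR R (susp 𝒱) (h s) * (genR R (susp 𝒱) (h' s) * x) := by
  simp [theta, Finset.sum_mul, mul_assoc]

omit [Fintype ι] [DecidableEq ι] in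
include hdeg in
theorem genR_mem (s : ι) : genR R (susp 𝒱) (h s) ∈ (extBialgebra R (susp 𝒱)).W (dh s + 1) :=
  genR_mem_W (mem_susp 𝒱 (hdeg s))

include hB hdeg hdual in
theorem genR_dual_mem (s : ι) :
    genR R (susp 𝒱) (h' s) ∈ (extBialgebra R (susp 𝒱)).W (-3 - dh s + 1) :=
  genR_mem_W (mem_susp 𝒱 (dual_mem hB hdeg hdual s))

include hB hdeg hdual in
theorem dev3_theta : (extBialgebra R (susp 𝒱)).dev3 (theta h h' t) = 0 := by
  have hy : LinearMap.mulLeft R (∑ s, genR R (susp 𝒱) (h s) * genR R (susp 𝒱) (h' s)) =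
      ∑ s, LinearMap.mulLeft R (genR R (susp 𝒱) (h s) * genR R (susp 𝒱) (h' s)) := by
    ext x; simp [Finset.sum_mul, mul_assoc]
  rw [theta, map_smul, hy, map_sum, Finset.sum_eq_zero, smul_zero]
  exact fun s _ => SymBialgebra.dev3_mulLeft _ (genR_mem hdeg s) (genR_dual_mem hB hdeg hdual s)

omit [DecidableEq ι] in
theorem projR_theta (n : ℕ) (hdeg : ∀ s, h s ∈ 𝒱 (dh s))
    (hdeg' : ∀ s, h' s ∈ 𝒱 (-3 - dh s)) (x : ExtR R (susp 𝒱)) :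
    projR R (susp 𝒱) (n + 2) (theta h h' t x) = theta h h' t (projR R (susp 𝒱) n x) := by
  have h1 : ∀ s, projR R (susp 𝒱) (n + 2)
      (genR R (susp 𝒱) (h s) * (genR R (susp 𝒱) (h' s) * x)) =
      genR R (susp 𝒱) (h s) * (genR R (susp 𝒱) (h' s) * projR R (susp 𝒱) n x) := by
    intro s
    have h2 := (extBialgebra R (susp 𝒱)).π_succ_gen_mul (genR_mem_W (mem_susp 𝒱 (hdeg s))) (n + 1)
      (genR R (susp 𝒱) (h' s) * x)
    rw [(extBialgebra R (susp 𝒱)).π_succ_gen_mul (genR_mem_W (mem_susp 𝒱 (hdeg' s)))] at h2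
    exact h2
  rw [theta_apply, map_smul, map_sum, theta_apply]
  simp only [h1]

omit [DecidableEq ι] in
theorem projR_one_theta (hdeg : ∀ s, h s ∈ 𝒱 (dh s))
    (hdeg' : ∀ s, h' s ∈ 𝒱 (-3 - dh s)) (x : ExtR R (susp 𝒱)) :
    projR R (susp 𝒱) 1 (theta h h' t x) = 0 := by
  have h1 : ∀ s, projR R (susp 𝒱) 1
      (genR R (susp 𝒱) (h s) * (genR R (susp 𝒱) (h' s) * x)) = 0 := by
    intro s
    have h2 := (extBialgebra R (susp 𝒱)).π_succ_gen_mul (genR_mem_W (mem_susp 𝒱 (hdeg s))) 0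
      (genR R (susp 𝒱) (h' s) * x)
    rw [(extBialgebra R (susp 𝒱)).π_zero_gen_mul (genR_mem_W (mem_susp 𝒱 (hdeg' s))),
      mul_zero] at h2
    exact h2
  rw [theta_apply, map_smul, map_sum, Finset.sum_eq_zero fun s _ => h1 s, smul_zero]

omit [CharZero k] in
include hB hdeg hdual in
theorem hasDegree_theta : HasDegree (susp 𝒱) (-1) (theta (R := R) h h' t) := by
  intro p x hx
  rw [theta_apply]
  refine Submodule.smul_mem _ _ (Submodule.sum_mem _ fun s _ => ?_)
  have h1 := genR_mul_mem (mem_susp 𝒱 (hdeg s))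
    (genR_mul_mem (mem_susp 𝒱 (dual_mem hB hdeg hdual s)) hx)
  convert h1 using 3
  ring

include hB hdeg hdual in
theorem isTheta_theta : IsTheta 𝒱 h h' t (theta (R := R) h h' t) where
  coder := ⟨dev3_theta hB hdeg hdual t, hasDegree_theta hB hdeg hdual t⟩
  proj_one := projR_one_theta t hdeg (dual_mem hB hdeg hdual)
  proj_two := by
    intro n hn x hx
    rw [projR_theta t 0 hdeg (dual_mem hB hdeg hdual)]
    have h1 : (extPow (susp 𝒱) n).baseChange R ≤ LinearMap.ker (projR R (susp 𝒱) 0) := by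
      refine baseChange_le fun a ha => ?_
      have h2 : extPow (susp 𝒱) n ≤ LinearMap.ker (extProj (susp 𝒱) 0) := by
        refine Submodule.span_le.2 ?_
        rintro _ ⟨w, rfl⟩
        exact (extProj_word 0 w).trans (if_neg hn.ne)
      rw [LinearMap.mem_ker, projR, LinearMap.baseChange_tmul, LinearMap.mem_ker.1 (h2 ha),
        TensorProduct.tmul_zero]
    rw [LinearMap.mem_ker.1 (h1 hx), map_zero]
  proj_two_one := by
    rw [projR_theta t 0 hdeg (dual_mem hB hdeg hdual), projR, LinearMap.baseChange_tmul,
      extProj_zero_one, theta, LinearMap.smul_apply, LinearMap.mulLeft_apply, ← one_tmul_symElement,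
      Algebra.TensorProduct.tmul_mul_tmul, one_mul, mul_one, TensorProduct.smul_tmul',
      smul_eq_mul, mul_one, TensorProduct.smul_tmul]

omit [DecidableEq ι] in
theorem IsTheta.unique {t : R} {θ θ' : Module.End R (ExtR R (susp 𝒱))}
    (hθ : IsTheta 𝒱 h h' t θ) (hθ' : IsTheta 𝒱 h h' t θ') : θ' = θ := by
  rw [← sub_eq_zero]
  refine (extBialgebra R (susp 𝒱)).eq_zero_of_dev3 ?_ (fun x => ?_) (LinearMap.congr_fun (?_ :
    (extBialgebra R (susp 𝒱)).π 2 ∘ₗ (θ' - θ) = 0))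
  · exact SymBialgebra.dev3_sub _ hθ'.coder.1 hθ.coder.1
  · rw [LinearMap.sub_apply, map_sub, sub_eq_zero]
    exact (hθ'.proj_one x).trans (hθ.proj_one x).symm
  · refine extR_hom_ext fun n w d hw => ?_
    rw [LinearMap.comp_apply, LinearMap.sub_apply, map_sub, LinearMap.zero_apply, sub_eq_zero]
    rcases Nat.eq_zero_or_pos n with rfl | hn
    · have h1 : word (susp 𝒱) w = 1 := by simp [word]
      rw [h1]
      exact hθ'.proj_two_one.trans hθ.proj_two_one.symm
    · have hm : (1 : R) ⊗ₜ[k] word (susp 𝒱) w ∈ (extPow (susp 𝒱) n).baseChange R :=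
        Submodule.tmul_mem_baseChange_of_mem _ (Submodule.subset_span ⟨w, rfl⟩)
      exact (hθ'.proj_two n hn _ hm).trans (hθ.proj_two n hn _ hm).symm

/-! #### The two components of `(δ + θ)²` -/

/-- The linear part `π₁ (δ + θ)²` for `f = π₁ δ`. -/
def linPart (h h' : Module.Basis ι k V) (t : R) (f : Module.End R (ExtR R (susp 𝒱))) :
    Module.End R (ExtR R (susp 𝒱)) :=
  f ∘ₗ (extBialgebra R (susp 𝒱)).conv f + ((2 : k)⁻¹ • t) • (f ∘ₗ LinearMap.mulLeft R
    (∑ s, genR R (susp 𝒱) (h s) * genR R (susp 𝒱) (h' s)))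

/-- The map `a ↦ ∑ (-1)^|↑h_s| ↑h_s f(↑h^s a)`; the quadratic part of `(δ + θ)²` is its `t`-fold. -/
def quadPart (h h' : Module.Basis ι k V) (dh : ι → ℤ) (f : Module.End R (ExtR R (susp 𝒱))) :
    Module.End R (ExtR R (susp 𝒱)) :=
  ∑ s, ((dh s + 1).negOnePow : ℤ) • (LinearMap.mulLeft R (genR R (susp 𝒱) (h s)) ∘ₗ f ∘ₗ
    LinearMap.mulLeft R (genR R (susp 𝒱) (h' s)))

variable {δ : Module.End R (ExtR R (susp 𝒱))}

theorem IsCoDer.isCod (hδ : IsCoDer (susp 𝒱) 1 (-1) δ) : (extBialgebra R (susp 𝒱)).IsCod δ :=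
  ((extBialgebra R (susp 𝒱)).isCoderivation_one_iff δ).1 hδ.1

theorem IsCoDer.hasDegree_proj (hδ : IsCoDer (susp 𝒱) 1 (-1) δ) :
    HasDegree (susp 𝒱) (-1) (projR R (susp 𝒱) 1 ∘ₗ δ) :=
  by simpa only [add_zero] using (hasDegree_projR (R := R) (𝒲 := susp 𝒱) 1).comp hδ.2

theorem IsCoDer.eq_conv (hδ : IsCoDer (susp 𝒱) 1 (-1) δ) :
    δ = (extBialgebra R (susp 𝒱)).conv (projR R (susp 𝒱) 1 ∘ₗ δ) :=
  hδ.isCod.eq_conv (par_of_hasDegree hδ.2)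

theorem proj_comp_mem_lin (δ : Module.End R (ExtR R (susp 𝒱))) (x : ExtR R (susp 𝒱)) :
    (projR R (susp 𝒱) 1 ∘ₗ δ) x ∈ (extBialgebra R (susp 𝒱)).lin :=
  (extBialgebra R (susp 𝒱)).π_one_mem_lin (δ x)

omit [DecidableEq ι] in
theorem linPart_mem (x : ExtR R (susp 𝒱)) :
    linPart h h' t (projR R (susp 𝒱) 1 ∘ₗ δ) x ∈ (extBialgebra R (susp 𝒱)).lin :=
  add_mem (proj_comp_mem_lin _ _) (Submodule.smul_mem _ _ (proj_comp_mem_lin _ _))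

omit [DecidableEq ι] in
include hdeg in
theorem quadPart_mem (x : ExtR R (susp 𝒱)) :
    quadPart h h' dh (projR R (susp 𝒱) 1 ∘ₗ δ) x ∈ (extBialgebra R (susp 𝒱)).quad := by
  rw [quadPart, LinearMap.sum_apply]
  refine Submodule.sum_mem _ fun s _ => zsmul_mem ?_ _
  exact SymBialgebra.mul_mem_quad _ (SymBialgebra.gen_mem_lin _ (genR_mem hdeg s))
    (proj_comp_mem_lin _ _)

include hB hdeg hdual in
theorem sq_eq_conv (hδ : IsCoDer (susp 𝒱) 1 (-1) δ) : (δ + theta h h' t) ^ 2 =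
    (extBialgebra R (susp 𝒱)).conv (linPart h h' t (projR R (susp 𝒱) 1 ∘ₗ δ) +
      t • quadPart h h' dh (projR R (susp 𝒱) 1 ∘ₗ δ)) := by
  have hf := par_of_hasDegree hδ.hasDegree_proj
  have hδf := hδ.eq_conv
  have hl := proj_comp_mem_lin δ
  generalize projR R (susp 𝒱) 1 ∘ₗ δ = f at *
  let β : V →ₗ[k] V →ₗ[k] Module.End R (ExtR R (susp 𝒱)) := LinearMap.mk₂ k
    (fun x y => LinearMap.mulLeft R (genR R (susp 𝒱) (signMap (susp 𝒱) x)) ∘ₗ f ∘ₗ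
      LinearMap.mulLeft R (genR R (susp 𝒱) y))
    (fun x x' y => by apply LinearMap.ext; intro z; simp [add_mul])
    (fun r x y => by apply LinearMap.ext; intro z; simp)
    (fun x y y' => by apply LinearMap.ext; intro z; simp [add_mul, mul_add])
    (fun r x y => by
      apply LinearMap.ext; intro z
      simp [LinearMap.map_smul_of_tower])
  have hβ : ∀ {p x} y, x ∈ susp 𝒱 p → β x y = (p.negOnePow : ℤ) •
      (LinearMap.mulLeft R (genR R (susp 𝒱) x) ∘ₗ f ∘ₗ
        LinearMap.mulLeft R (genR R (susp 𝒱) y)) := by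
    intro p x y hx
    apply LinearMap.ext; intro z
    change genR R (susp 𝒱) (signMap (susp 𝒱) x) * f (genR R (susp 𝒱) y * z) =
      (p.negOnePow : ℤ) • (genR R (susp 𝒱) x * f (genR R (susp 𝒱) y * z))
    rw [signMap_of_mem _ hx, map_zsmul, smul_mul_assoc]
  have hsymm := sum_dual_comm hB hdeg hdual β
  simp only [hβ _ (mem_susp 𝒱 (hdeg _)), hβ _ (mem_susp 𝒱 (dual_mem hB hdeg hdual _))] at hsymm
  have key := (extBialgebra R (susp 𝒱)).sq_conv_add hf (by decide) hl (genR_mem hdeg)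
    (genR_dual_mem hB hdeg hdual) (fun s => ⟨-1, by ring⟩) hsymm ((2 : k)⁻¹ • t)
  have h2 : (2 : R) * ((2 : k)⁻¹ • t) = t := by
    rw [two_mul, ← two_smul k, smul_smul, mul_inv_cancel₀ two_ne_zero, one_smul]
  rw [h2] at key
  rw [pow_two, hδf]
  exact key

end Theta

/-! ### Operations and coderivations -/

section Twist

variable {k V M : Type*} [Field k] [AddCommGroup V] [Module k V] [AddCommGroup M] [Module k M]

/-- The exponent `(n-1) d₀ + (n-2) d₁ + ⋯ + d_{n-2}` of the sign that relates operations on `V` to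
maps on `∧(↑V)`. -/
def suspExp {n : ℕ} (d : Fin n → ℤ) : ℤ := ∑ i : Fin n, ((n : ℤ) - 1 - i) * d i

theorem signMap_pow (𝒱 : ℤ → Submodule k V) [DirectSum.Decomposition 𝒱] {p : ℤ} {x : V}
    (hx : x ∈ 𝒱 p) (m : ℕ) : (signMap 𝒱 ^ m) x = ((m * p).negOnePow : ℤ) • x := by
  induction m with
  | zero => simp
  | succ m ih =>
    rw [pow_succ, Module.End.mul_apply, signMap_of_mem 𝒱 hx, map_zsmul, ih,
      SymBialgebra.negOnePow_smul_smul]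
    refine SymBialgebra.negOnePow_smul_congr ⟨0, ?_⟩ _
    push_cast
    ring

/-- The multilinear map `φ` with the sign `(-1)^((n-1) v₀ + ⋯ + v_{n-2})`. -/
def twist (𝒱 : ℤ → Submodule k V) [DirectSum.Decomposition 𝒱] {n : ℕ}
    (φ : MultilinearMap k (fun _ : Fin n => V) M) : MultilinearMap k (fun _ : Fin n => V) M :=
  φ.compLinearMap fun i => signMap 𝒱 ^ (n - 1 - (i : ℕ))

theorem twist_apply (𝒱 : ℤ → Submodule k V) [DirectSum.Decomposition 𝒱] {n : ℕ}
    (φ : MultilinearMap k (fun _ : Fin n => V) M) {v : Fin n → V} {d : Fin n → ℤ}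
    (hv : ∀ i, v i ∈ 𝒱 (d i)) : twist 𝒱 φ v = ((suspExp d).negOnePow : ℤ) • φ v := by
  have h1 : ∀ i : Fin n, (signMap 𝒱 ^ (n - 1 - (i : ℕ))) (v i) =
      (((((n : ℤ) - 1 - i) * d i).negOnePow : ℤ) : k) • v i := by
    intro i
    rw [signMap_pow 𝒱 (hv i), Int.cast_smul_eq_zsmul]
    have : ((n - 1 - (i : ℕ) : ℕ) : ℤ) = (n : ℤ) - 1 - i := by omega
    rw [this]
  rw [twist, MultilinearMap.compLinearMap_apply]
  simp only [h1]
  rw [MultilinearMap.map_smul_univ, suspExp, negOnePow_sum, ← Int.cast_smul_eq_zsmul k]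
  push_cast
  rfl

/-- The product of generators, as a multilinear map. -/
def wordMap (𝒲 : ℤ → Submodule k V) (n : ℕ) : MultilinearMap k (fun _ : Fin n => V) (Ext 𝒲) :=
  (MultilinearMap.mkPiAlgebraFin k n (Ext 𝒲)).compLinearMap fun _ => gen 𝒲

end Twist

section Correspondence

variable {k V R : Type*} [Field k] [AddCommGroup V] [Module k V]
  [CommRing R] [Algebra k R] {𝒱 : ℤ → Submodule k V} {t : R} {c : ℕ → R →ₗ[k] k}
  {δ : Module.End R (ExtR R (susp 𝒱))}

/-- The linear part of the coefficient of `t^g` of an element of `∧W ⊗ R`. -/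
def coefW (𝒱 : ℤ → Submodule k V) (c : R →ₗ[k] k) : ExtR R (susp 𝒱) →ₗ[k] V :=
  extW (susp 𝒱) ∘ₗ coefR (susp 𝒱) c

/-- The coefficient of `t^g` of `π₁ δ`, a linear map `∧W → W`. -/
def coefOp (c : R →ₗ[k] k) (δ : Module.End R (ExtR R (susp 𝒱))) : Ext (susp 𝒱) →ₗ[k] V :=
  coefW 𝒱 c ∘ₗ δ.restrictScalars k ∘ₗ TensorProduct.mk k R (Ext (susp 𝒱)) 1

theorem coefOp_apply (c : R →ₗ[k] k) (δ : Module.End R (ExtR R (susp 𝒱))) (a : Ext (susp 𝒱)) :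
    coefOp c δ a = coefW 𝒱 c (δ (1 ⊗ₜ a)) := rfl

theorem neg_one_pow_smul_eq_iff {M : Type*} [AddCommGroup M] (p : ℤ) (x y : M) :
    (p.negOnePow : ℤ) • x = y ↔ x = (p.negOnePow : ℤ) • y := by
  constructor
  · rintro rfl; rw [SymBialgebra.negOnePow_smul_self]
  · rintro rfl; rw [SymBialgebra.negOnePow_smul_self]

variable [DirectSum.Decomposition 𝒱]

theorem gen_coefW (c : R →ₗ[k] k) (x : ExtR R (susp 𝒱)) :
    gen (susp 𝒱) (coefW 𝒱 c x) = coefR (susp 𝒱) c (projR R (susp 𝒱) 1 x) := by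
  rw [coefR_projR, extProj_one_eq]; rfl

theorem coefW_projR (c : R →ₗ[k] k) (x : ExtR R (susp 𝒱)) :
    coefW 𝒱 c (projR R (susp 𝒱) 1 x) = coefW 𝒱 c x := by
  apply gen_injective (susp 𝒱)
  rw [gen_coefW, gen_coefW, coefR_projR, coefR_projR, extProj_one_eq, extProj_one_eq, extW_gen]

theorem corresponds_iff {l : Ops k V} : Corresponds 𝒱 c δ l ↔
    ∀ (g n : ℕ) (v : Fin n → V) (d : Fin n → ℤ), (∀ i, v i ∈ 𝒱 (d i)) →
      l g n v = ((suspExp d).negOnePow : ℤ) • coefOp (c g) δ (word (susp 𝒱) v) := by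
  unfold Corresponds
  refine forall₅_congr fun g n v d hv => ?_
  rw [← gen_coefW, ← map_zsmul, (gen_injective (susp 𝒱)).eq_iff]
  rfl

/-- The operations that correspond to `δ`. -/
def opsOf (c : ℕ → R →ₗ[k] k) (δ : Module.End R (ExtR R (susp 𝒱))) : Ops k V := fun g n =>
  twist 𝒱 ((coefOp (c g) δ).compMultilinearMap (wordMap (susp 𝒱) n))

theorem corresponds_opsOf (c : ℕ → R →ₗ[k] k) (δ : Module.End R (ExtR R (susp 𝒱))) :
    Corresponds 𝒱 c δ (opsOf c δ) := by
  rw [corresponds_iff]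
  intro g n v d hv
  rw [opsOf, twist_apply 𝒱 _ hv]
  rfl

/-- The signs of the suspension turn graded symmetric maps on `W` into graded antisymmetric maps on
`V`. -/
theorem isOps_opsOf (hδ : HasDegree (susp 𝒱) (-1) δ) : IsOps 𝒱 (opsOf c δ) := by
  have hl := corresponds_iff.1 (corresponds_opsOf c δ)
  constructor
  · intro g n v d hv
    rw [hl g n v d hv]
    refine zsmul_mem ?_ _
    have h1 := extW_mem (coefR_mem_extDeg (c g)
      (hδ _ _ (word_mem_baseChange (R := R) fun i => mem_susp 𝒱 (hv i))))
    have hd : ∑ i, d i + n - 2 = ∑ i, (d i + 1) + -1 - 1 := by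
      rw [Finset.sum_add_distrib]
      simp
      ring
    rw [hd]
    exact h1
  · intro g n v d hv σ
    rw [hl g n v d hv, hl g n _ _ fun i => hv (σ i), smul_smul, ← Units.val_mul]
    have h1 := chi_mul_negOnePow σ d
    have h2 : word (susp 𝒱) v = _ := prod_gen_perm (susp 𝒱) σ v _ fun i => mem_susp 𝒱 (hv i)
    unfold suspExp
    rw [h1, h2, map_zsmul, smul_smul, ← Units.val_mul, mul_comm]

/-- The coordinates of the operations of `δ` are the coefficients of elements of `R`. -/
theorem opsOf_coeff {ι : Type*} (h : Module.Basis ι k V) (δ : Module.End R (ExtR R (susp 𝒱)))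
    (n : ℕ) (v : Fin n → V) (s : ι) : ∃ r : R, ∀ g, c g r = h.coord s (opsOf c δ g n v) := by
  let ρ : ExtR R (susp 𝒱) →ₗ[k] R :=
    (TensorProduct.rid k R).toLinearMap ∘ₗ LinearMap.lTensor R (h.coord s ∘ₗ extW (susp 𝒱))
  have hρ : ∀ g x, c g (ρ x) = h.coord s (coefW 𝒱 (c g) x) := by
    intro g x
    induction x using TensorProduct.induction_on with
    | zero => simp
    | add x y hx hy => simp only [map_add, hx, hy]
    | tmul r a => simp [ρ, coefW, mul_comm]
  exact ⟨_, fun g => hρ g _⟩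

theorem corresponds_unique {ι : Type*} [Finite ι] {h : Module.Basis ι k V} {dh : ι → ℤ}
    (hdeg : ∀ s, h s ∈ 𝒱 (dh s)) {l l' : Ops k V} (hl : Corresponds 𝒱 c δ l)
    (hl' : Corresponds 𝒱 c δ l') : l = l' := by
  funext g n
  refine multilinear_ext hdeg fun v d hv => ?_
  exact (corresponds_iff.1 hl g n v d hv).trans (corresponds_iff.1 hl' g n v d hv).symm

theorem CoeffSystem.eq_of_corresponds [CharZero k] (hc : CoeffSystem t c)
    {δ' : Module.End R (ExtR R (susp 𝒱))}
    {l : Ops k V} (hδ : IsCoDer (susp 𝒱) 1 (-1) δ) (hδ' : IsCoDer (susp 𝒱) 1 (-1) δ')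
    (h : Corresponds 𝒱 c δ l) (h' : Corresponds 𝒱 c δ' l) : δ = δ' := by
  rw [← sub_eq_zero]
  refine SymBialgebra.IsCod.eq_zero (hδ.isCod.sub hδ'.isCod) (LinearMap.congr_fun (?_ :
    projR R (susp 𝒱) 1 ∘ₗ (δ - δ') = 0))
  refine extR_hom_ext fun n w d hw => hc.eq_zero fun g => ?_
  have hw' : ∀ i, w i ∈ 𝒱 (d i - 1) := hw
  rw [LinearMap.comp_apply, ← gen_coefW, LinearMap.sub_apply, map_sub]
  have h1 := corresponds_iff.1 h g n w _ hw'
  rw [corresponds_iff.1 h' g n w _ hw', eq_comm, neg_one_pow_smul_eq_iff,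
    SymBialgebra.negOnePow_smul_self] at h1
  rw [coefOp_apply, coefOp_apply] at h1
  rw [h1, sub_self, map_zero]

/-- Since the coefficient functionals are jointly injective, a map to `R` with prescribed linear
coefficients is linear. -/
theorem CoeffSystem.exists_hom (hc : CoeffSystem t c) {M : Type*} [AddCommGroup M] [Module k M]
    (G : ℕ → M →ₗ[k] k) (hG : ∀ a, ∃ r, ∀ g, c g r = G g a) :
    ∃ f : M →ₗ[k] R, ∀ g a, c g (f a) = G g a := by
  choose f hf using hG
  refine ⟨{ toFun := f, map_add' := fun x y => ?_, map_smul' := fun r x => ?_ }, fun g a => hf a g⟩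
  · rw [← sub_eq_zero]
    exact hc.ext _ fun g => by simp [hf]
  · rw [← sub_eq_zero]
    exact hc.ext _ fun g => by simp [hf]

theorem twist_mem_symFamily {l : Ops k V} (hl : IsOps 𝒱 l) (g : ℕ) :
    (fun n => twist 𝒱 (l g n)) ∈ symFamily (susp 𝒱) V := by
  intro n v e hv i
  have hv' : ∀ i, v i ∈ 𝒱 (e i - 1) := hv
  set σ := Equiv.swap i.castSucc i.succ with hσ
  have h1 := chi_mul_negOnePow σ fun i => e i - 1
  simp only [sub_add_cancel] at h1
  rw [hσ, koszulSign_swap, ← hσ] at h1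
  change twist 𝒱 (l g (n + 1)) v = _ • twist 𝒱 (l g (n + 1)) _
  rw [twist_apply 𝒱 _ hv', twist_apply 𝒱 _ fun j => hv' (σ j),
    hl.antisymm g (n + 1) v _ hv' σ, smul_smul, smul_smul, ← Units.val_mul, ← Units.val_mul]
  congr 2
  unfold suspExp
  set a := (∑ i : Fin (n + 1), (((n + 1 : ℕ) : ℤ) - 1 - i) * (e i - 1)).negOnePow
  set b := (∑ i : Fin (n + 1), (((n + 1 : ℕ) : ℤ) - 1 - i) * (e (σ i) - 1)).negOnePow with hb
  have hbb : b * b = 1 := negOnePow_mul_self _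
  have haa : a * a = 1 := negOnePow_mul_self _
  calc a * chi σ (fun i => e i - 1) = a * (chi σ (fun i => e i - 1) * b) * b := by
        rw [mul_assoc a, mul_assoc (chi _ _), hbb, mul_one]
    _ = _ := by rw [h1, mul_comm a, mul_assoc _ a a, haa, mul_one]

/-- Operations whose coordinates are coefficients of elements of `R` come from a coderivation
`conv f`, where `f` takes the value `∑ r_s ⊗ ↑h_s` on a word, `r_s` being the element of `R` with the
coefficients given by the `s`-th coordinates of the operations. -/
theorem exists_corresponds {ι : Type*} [Fintype ι] [DecidableEq ι] [CharZero k]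
    {B : LinearMap.BilinForm k V} (hB : IsLoopForm 𝒱 B) {h h' : Module.Basis ι k V} {dh : ι → ℤ}
    (hdeg : ∀ s, h s ∈ 𝒱 (dh s)) (hdual : ∀ s u, B (h' s) (h u) = if s = u then 1 else 0)
    (hc : CoeffSystem t c) {l : Ops k V} (hl : IsOps 𝒱 l)
    (hcoeff : ∀ n v s, ∃ r : R, ∀ g, c g r = h.coord s (l g n v)) :
    ∃ δ, IsCoDer (susp 𝒱) 1 (-1) δ ∧ Corresponds 𝒱 c δ l := by
  choose F hF using fun g =>
    exists_hom_of_symFamily (susp 𝒱) (fun s => mem_susp 𝒱 (hdeg s)) (twist_mem_symFamily hl g)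
  have hex : ∀ s a, ∃ r : R, ∀ g, c g r = (h.coord s ∘ₗ F g) a := by
    intro s a
    let N : Submodule k (Ext (susp 𝒱)) :=
      (LinearMap.range (LinearMap.pi c)).comap (LinearMap.pi fun g => h.coord s ∘ₗ F g)
    have hN : a ∈ N := by
      refine ext_mem_of_word (susp 𝒱) N (fun n w d hw => ?_) a
      obtain ⟨r, hr⟩ := hcoeff n (fun i => (signMap 𝒱 ^ (n - 1 - (i : ℕ))) (w i)) s
      refine ⟨r, funext fun g => ?_⟩
      rw [LinearMap.pi_apply, LinearMap.pi_apply, hr, LinearMap.comp_apply, hF]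
      rfl
    obtain ⟨r, hr⟩ := hN
    exact ⟨r, fun g => congrFun hr g⟩
  choose fs hfs using fun s => hc.exists_hom _ (hex s)
  let f : Module.End R (ExtR R (susp 𝒱)) := LinearMap.liftBaseChange R
    (∑ s, (TensorProduct.mk k R (Ext (susp 𝒱))).flip (gen (susp 𝒱) (h s)) ∘ₗ fs s)
  have hf : ∀ a, f (1 ⊗ₜ a) = ∑ s, fs s a ⊗ₜ gen (susp 𝒱) (h s) := by
    intro a
    simp [f]
  have hcf : ∀ g a, coefR (susp 𝒱) (c g) (f (1 ⊗ₜ a)) = gen (susp 𝒱) (F g a) := by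
    intro g a
    rw [hf, map_sum]
    simp only [coefR_tmul, hfs, ← map_smul]
    rw [← map_sum]
    congr 1
    exact h.sum_repr _
  -- The coordinate functionals are homogeneous since they are given by `B` and the dual basis.
  have hdegf : HasDegree (susp 𝒱) (-1) f := by
    refine hasDegree_of_word fun n w d hw => ?_
    have hw' : ∀ i, w i ∈ 𝒱 (d i - 1) := hw
    rw [hf]
    refine Submodule.sum_mem _ fun s _ => ?_
    by_cases hs : ∑ i, d i + -1 = dh s + 1
    · refine Submodule.tmul_mem_baseChange_of_mem _ (Submodule.subset_span
        ⟨1, fun _ => h s, fun _ => dh s + 1, fun _ => mem_susp 𝒱 (hdeg s), by simp [hs], by simp⟩)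
    · have h0 : fs s (word (susp 𝒱) w) = 0 := by
        refine hc.ext _ fun g => ?_
        rw [hfs, LinearMap.comp_apply, hF, twist_apply 𝒱 _ hw']
        refine coord_eq_zero_of_mem hB hdeg hdual (zsmul_mem (hl.degree g n w _ hw') _) ?_
        intro h1
        apply hs
        rw [Finset.sum_sub_distrib] at h1
        simp at h1
        linarith
      rw [h0, TensorProduct.zero_tmul]
      exact zero_mem _
  have hlin : ∀ x, f x ∈ (extBialgebra R (susp 𝒱)).lin := by
    refine extR_mem_of_word (N := (extBialgebra R (susp 𝒱)).lin.comap f) fun n w d hw => ?_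
    rw [Submodule.mem_comap, hf]
    refine Submodule.sum_mem _ fun s _ => ?_
    have h1 : fs s (word (susp 𝒱) w) ⊗ₜ[k] gen (susp 𝒱) (h s) =
        fs s (word (susp 𝒱) w) • genR R (susp 𝒱) (h s) := by
      rw [genR_apply, TensorProduct.smul_tmul', smul_eq_mul, mul_one]
    rw [h1]
    exact Submodule.smul_mem _ _ (SymBialgebra.gen_mem_lin _ (genR_mem hdeg s))
  have hpar := par_of_hasDegree hdegf
  refine ⟨(extBialgebra R (susp 𝒱)).conv f,
    ⟨((extBialgebra R (susp 𝒱)).isCoderivation_one_iff _).2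
      ((extBialgebra R (susp 𝒱)).isCod_conv hpar hlin), hasDegree_conv hdegf⟩, ?_⟩
  rw [corresponds_iff]
  intro g n v d hv
  have h1 : projR R (susp 𝒱) 1 ((extBialgebra R (susp 𝒱)).conv f (1 ⊗ₜ word (susp 𝒱) v)) =
      f (1 ⊗ₜ word (susp 𝒱) v) := (extBialgebra R (susp 𝒱)).π_one_conv_lin hlin _
  rw [coefOp_apply, ← coefW_projR, h1, coefW, LinearMap.comp_apply, hcf, extW_gen, hF,
    twist_apply 𝒱 _ hv, SymBialgebra.negOnePow_smul_self]

end Correspondence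

/-! ### The axioms of loop homotopy Lie algebras -/

/-- The exponent of the suspension sign for a sequence that is cut into two blocks. -/
theorem suspExp_split {n a m : ℕ} (hn : n = a + m) (e : Fin n → ℤ) : suspExp e =
    m * ∑ i : Fin a, e ⟨i, by omega⟩ + suspExp (fun i : Fin a => e ⟨i, by omega⟩) +
      suspExp (fun j : Fin m => e ⟨a + j, by omega⟩) := by
  subst hn
  unfold suspExp
  rw [Fin.sum_univ_add, Finset.mul_sum, ← Finset.sum_add_distrib]
  congr 1
  · refine Finset.sum_congr rfl fun i _ => ?_
    have : Fin.castAdd m i = ⟨i, by omega⟩ := rfl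
    rw [this]
    push_cast
    ring
  · refine Finset.sum_congr rfl fun i _ => ?_
    have : Fin.natAdd a i = ⟨a + i, by omega⟩ := rfl
    rw [this]
    push_cast
    ring

theorem suspExp_cons {m : ℕ} (p : ℤ) (e : Fin m → ℤ) :
    suspExp (Fin.cons p e : Fin (m + 1) → ℤ) = m * p + suspExp e := by
  unfold suspExp
  rw [Fin.sum_univ_succ]
  congr 1
  · simp
  · refine Finset.sum_congr rfl fun i _ => ?_
    rw [Fin.cons_succ, Fin.val_succ]
    push_cast
    ring

section Words

variable {k V : Type*} [Field k] [AddCommGroup V] [Module k V] {𝒲 : ℤ → Submodule k V}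

theorem gen_mul_word {n : ℕ} (x : V) (w : Fin n → V) :
    gen 𝒲 x * word 𝒲 w = word 𝒲 (Fin.cons x w : Fin (n + 1) → V) := by
  simp [word, List.ofFn_succ]

theorem cons_mem {n : ℕ} {v : Fin n → V} {d : Fin n → ℤ} (hv : ∀ i, v i ∈ 𝒲 (d i)) {x : V} {p : ℤ}
    (hx : x ∈ 𝒲 p) (i : Fin (n + 1)) :
    (Fin.cons x v : Fin (n + 1) → V) i ∈ 𝒲 ((Fin.cons p d : Fin (n + 1) → ℤ) i) := by
  induction i using Fin.cases with
  | zero => exact hx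
  | succ i => exact hv i

end Words

theorem take_ofFn {A : Type*} {n a : ℕ} (ha : a ≤ n) (x : Fin n → A) :
    (List.ofFn x).take a = List.ofFn fun i : Fin a => x ⟨i, by omega⟩ := by
  refine List.ext_getElem (by simp; omega) fun i h1 h2 => ?_
  simp

theorem drop_ofFn {A : Type*} {n a : ℕ} (x : Fin n → A) :
    (List.ofFn x).drop a = List.ofFn fun j : Fin (n - a) => x ⟨a + j, by omega⟩ := by
  refine List.ext_getElem (by simp) fun i h1 h2 => ?_
  simp

section Axioms

variable {k V ι R : Type*} [Field k] [CharZero k] [AddCommGroup V] [Module k V]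
  [Fintype ι] [CommRing R] [Algebra k R] {𝒱 : ℤ → Submodule k V}
  [DirectSum.Decomposition 𝒱] {h h' : Module.Basis ι k V} {dh : ι → ℤ} {t : R}
  {c : ℕ → R →ₗ[k] k} {δ : Module.End R (ExtR R (susp 𝒱))} {l : Ops k V}

omit [CharZero k] in
theorem coefR_proj_comp (c : R →ₗ[k] k) (a : Ext (susp 𝒱)) :
    coefR (susp 𝒱) c ((projR R (susp 𝒱) 1 ∘ₗ δ) (1 ⊗ₜ a)) = gen (susp 𝒱) (coefOp c δ a) := by
  rw [coefOp_apply, gen_coefW]; rfl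

omit [CharZero k] in
theorem coefW_proj_comp (c : R →ₗ[k] k) (a : Ext (susp 𝒱)) :
    coefW 𝒱 c ((projR R (susp 𝒱) 1 ∘ₗ δ) (1 ⊗ₜ a)) = coefOp c δ a := by
  rw [LinearMap.comp_apply, coefW_projR]; rfl

theorem CoeffSystem.coefW_conv (hc : CoeffSystem t c) (g : ℕ) {n : ℕ} {v : Fin n → V}
    {d : Fin n → ℤ} (hv : ∀ i, v i ∈ 𝒱 (d i)) :
    coefW 𝒱 (c g) ((projR R (susp 𝒱) 1 ∘ₗ δ) ((extBialgebra R (susp 𝒱)).conv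
      (projR R (susp 𝒱) 1 ∘ₗ δ) (1 ⊗ₜ word (susp 𝒱) v))) =
    ∑ a : Fin (n + 1), ∑ σ ∈ unshuffles a n, (koszulSign σ (fun i => d i + 1) : ℤ) •
      ∑ p ∈ Finset.HasAntidiagonal.antidiagonal g, coefOp (c p.1) δ
        (gen (susp 𝒱) (coefOp (c p.2) δ
            (word (susp 𝒱) fun i : Fin a => v (σ ⟨i, by omega⟩))) *
          word (susp 𝒱) fun j : Fin (n - a) => v (σ ⟨a + j, by omega⟩)) := by
  rw [conv_word _ fun i => mem_susp 𝒱 (hv i), map_sum, map_sum]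
  refine Finset.sum_congr rfl fun a _ => ?_
  rw [map_sum, map_sum]
  refine Finset.sum_congr rfl fun σ _ => ?_
  rw [map_zsmul, map_zsmul, take_ofFn (by omega), drop_ofFn]
  congr 1
  have h1 := hc.coefR_hom ((projR R (susp 𝒱) 1 ∘ₗ δ) ∘ₗ LinearMap.mulRight R
    ((1 : R) ⊗ₜ[k] word (susp 𝒱) fun j : Fin (n - a) => v (σ ⟨a + j, by omega⟩))) g
    ((projR R (susp 𝒱) 1 ∘ₗ δ) (1 ⊗ₜ word (susp 𝒱) fun i : Fin a => v (σ ⟨i, by omega⟩)))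
  have h2 := congrArg (extW (susp 𝒱)) h1
  rw [map_sum] at h2
  refine h2.trans (Finset.sum_congr rfl fun p _ => ?_)
  rw [coefR_proj_comp, LinearMap.comp_apply, LinearMap.mulRight_apply,
    Algebra.TensorProduct.tmul_mul_tmul, one_mul]
  exact coefW_proj_comp _ _

omit [CharZero k] in
theorem coefOp_gen_mul_word (hl : IsOps 𝒱 l) (hδ : Corresponds 𝒱 c δ l) (g₁ g₂ : ℕ) {a m : ℕ}
    {v : Fin a → V} {d : Fin a → ℤ} (hv : ∀ i, v i ∈ 𝒱 (d i))
    {w : Fin m → V} {e : Fin m → ℤ} (hw : ∀ i, w i ∈ 𝒱 (e i)) :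
    coefOp (c g₁) δ (gen (susp 𝒱) (coefOp (c g₂) δ (word (susp 𝒱) v)) * word (susp 𝒱) w) =
      ((suspExp d + (m * (∑ i, d i + a - 2) + suspExp e)).negOnePow : ℤ) •
        l g₁ (m + 1) (Fin.cons (l g₂ a v) w : Fin (m + 1) → V) := by
  have h1 := corresponds_iff.1 hδ g₂ a v d hv
  have h2 := corresponds_iff.1 hδ g₁ (m + 1) _ _ (cons_mem hw (hl.degree g₂ a v d hv))
  rw [eq_comm, neg_one_pow_smul_eq_iff] at h1 h2
  rw [h1, map_zsmul, smul_mul_assoc, map_zsmul, gen_mul_word, h2, suspExp_cons,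
    SymBialgebra.negOnePow_smul_smul]

/-- The linear part of `δ²` on a word, with the sign of the suspension, is the double sum of the
main identity. -/
theorem mainIdentity_sum (hc : CoeffSystem t c) (hl : IsOps 𝒱 l) (hδ : Corresponds 𝒱 c δ l)
    (g : ℕ) {n : ℕ} {v : Fin n → V} {d : Fin n → ℤ} (hv : ∀ i, v i ∈ 𝒱 (d i)) :
    ((suspExp d).negOnePow : ℤ) • coefW 𝒱 (c g) ((projR R (susp 𝒱) 1 ∘ₗ δ)
      ((extBialgebra R (susp 𝒱)).conv (projR R (susp 𝒱) 1 ∘ₗ δ) (1 ⊗ₜ word (susp 𝒱) v))) =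
    ∑ p ∈ Finset.HasAntidiagonal.antidiagonal g, ∑ a : Fin (n + 1), ∑ σ ∈ unshuffles a n,
      ((chi σ d * ((a : ℤ) * ((n : ℤ) - a)).negOnePow : ℤˣ) : ℤ) •
        l p.1 (n - a + 1)
          (Fin.cons
            (l p.2 a (fun i : Fin a => v (σ ⟨i, by omega⟩)))
            (fun j : Fin (n - a) => v (σ ⟨a + j, by omega⟩)) : Fin (n - a + 1) → V) := by
  rw [hc.coefW_conv g hv, Finset.smul_sum, Finset.sum_comm]
  refine Finset.sum_congr rfl fun a _ => ?_
  rw [Finset.smul_sum, Finset.sum_comm]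
  refine Finset.sum_congr rfl fun σ _ => ?_
  rw [Finset.smul_sum, Finset.smul_sum]
  refine Finset.sum_congr rfl fun p _ => ?_
  have h1 := chi_mul_negOnePow σ d
  have hna : ((n - (a : ℕ) : ℕ) : ℤ) = (n : ℤ) - a := by omega
  have h2 := suspExp_split (n := n) (a := a) (m := n - a) (by omega) fun i => d (σ i)
  rw [coefOp_gen_mul_word hl hδ p.1 p.2 (fun i : Fin a => hv (σ ⟨i, by omega⟩))
    (fun j : Fin (n - a) => hv (σ ⟨a + j, by omega⟩)), smul_smul, smul_smul, ← Units.val_mul,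
    ← Units.val_mul]
  congr 2
  change chi σ d * (suspExp fun i => d (σ i)).negOnePow = _ * (suspExp d).negOnePow at h1
  rw [mul_comm _ (koszulSign _ _), ← h1, mul_assoc, ← Int.negOnePow_add, h2, hna]
  congr 1
  refine SymBialgebra.negOnePow_congr ?_
  set D := ∑ i : Fin (a : ℕ), d (σ ⟨i, by omega⟩)
  set x := suspExp fun i : Fin (a : ℕ) => d (σ ⟨i, by omega⟩)
  set y := suspExp fun j : Fin (n - (a : ℕ)) => d (σ ⟨a + j, by omega⟩)
  exact ⟨((n : ℤ) - a) * D + x + y - ((n : ℤ) - a), by ring⟩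

omit [CharZero k] in
/-- The linear part of `δ θ` on a word, with the sign of the suspension, is the loop term of the main
identity; the factor `t` shifts the genus by one. -/
theorem mainIdentity_loopTerm (hc : CoeffSystem t c) (hδ : Corresponds 𝒱 c δ l)
    (hdeg : ∀ s, h s ∈ 𝒱 (dh s)) (hdeg' : ∀ s, h' s ∈ 𝒱 (-3 - dh s))
    (g : ℕ) {n : ℕ} {v : Fin n → V} {d : Fin n → ℤ} (hv : ∀ i, v i ∈ 𝒱 (d i)) :
    ((suspExp d).negOnePow : ℤ) • coefW 𝒱 (c g) (((2 : k)⁻¹ • t) • (projR R (susp 𝒱) 1 ∘ₗ δ)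
      ((∑ s, genR R (susp 𝒱) (h s) * genR R (susp 𝒱) (h' s)) * (1 ⊗ₜ word (susp 𝒱) v))) =
    (2 : k)⁻¹ • loopTerm h h' dh l n v g := by
  rw [smul_assoc, map_smul, smul_comm]
  congr 1
  cases g with
  | zero =>
    rw [coefW, LinearMap.comp_apply, hc.coefR_t_zero, map_zero, smul_zero]
    rfl
  | succ g =>
    rw [coefW, LinearMap.comp_apply, hc.coefR_t_succ, ← LinearMap.comp_apply, ← coefW,
      Finset.sum_mul, map_sum, map_sum, Finset.smul_sum, loopTerm]
    refine Finset.sum_congr rfl fun s _ => ?_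
    have h1 := corresponds_iff.1 hδ g (n + 2) _ _ (cons_mem (cons_mem hv (hdeg' s)) (hdeg s))
    rw [eq_comm, neg_one_pow_smul_eq_iff] at h1
    rw [mul_assoc, genR_mul_tmul, genR_mul_tmul, coefW_proj_comp, gen_mul_word, gen_mul_word, h1,
      SymBialgebra.negOnePow_smul_smul, suspExp_cons, suspExp_cons]
    refine SymBialgebra.negOnePow_smul_congr ?_ _
    push_cast
    exact ⟨suspExp d - 2 * n, by ring⟩

theorem linPart_eq_zero_iff (hc : CoeffSystem t c) (hl : IsOps 𝒱 l) (hδ : Corresponds 𝒱 c δ l)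
    (hdeg : ∀ s, h s ∈ 𝒱 (dh s)) (hdeg' : ∀ s, h' s ∈ 𝒱 (-3 - dh s)) :
    linPart h h' t (projR R (susp 𝒱) 1 ∘ₗ δ) = 0 ↔ MainIdentity 𝒱 h h' dh l := by
  have key : (∀ (g n : ℕ) (v : Fin n → V) (d : Fin n → ℤ), (∀ i, v i ∈ 𝒱 (d i)) →
      coefW 𝒱 (c g) (linPart h h' t (projR R (susp 𝒱) 1 ∘ₗ δ) (1 ⊗ₜ word (susp 𝒱) v)) = 0) ↔
      MainIdentity 𝒱 h h' dh l := by
    unfold MainIdentity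
    refine forall₅_congr fun g n v d hv => ?_
    rw [← mainIdentity_sum hc hl hδ g hv, ← mainIdentity_loopTerm hc hδ hdeg hdeg' g hv,
      ← smul_add, neg_one_pow_smul_eq_iff, smul_zero, ← map_add]
    rfl
  rw [← key]
  constructor
  · intro h0 g n v d hv
    rw [h0, LinearMap.zero_apply, map_zero]
  · intro hA
    refine extR_hom_ext fun n w d hw => hc.eq_zero fun g => ?_
    have hw' : ∀ i, w i ∈ 𝒱 (d i - 1) := hw
    have h1 := hA g n w _ hw'
    have h2 : ∀ x, projR R (susp 𝒱) 1 (linPart h h' t (projR R (susp 𝒱) 1 ∘ₗ δ) x) =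
        linPart h h' t (projR R (susp 𝒱) 1 ∘ₗ δ) x := by
      intro x
      have h3 := (extBialgebra R (susp 𝒱)).π_π 1
      simp only [linPart, LinearMap.add_apply, LinearMap.smul_apply, map_add, map_smul]
      exact congrArg₂ (fun x y => x + ((2 : k)⁻¹ • t) • y) (h3 _) (h3 _)
    rw [← h2, ← gen_coefW, h1, map_zero]

omit [CharZero k] in
/-- The sign `(-1)^|↑h_s|` in the quadratic part makes it the image of a tensor under
`signMap ⊗ 1`. -/
theorem coefR_quadPart (hdeg : ∀ s, h s ∈ 𝒱 (dh s)) (c : R →ₗ[k] k) (a : Ext (susp 𝒱)) :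
    coefR (susp 𝒱) c (quadPart h h' dh (projR R (susp 𝒱) 1 ∘ₗ δ) (1 ⊗ₜ a)) =
      mulGen (susp 𝒱) (LinearMap.rTensor V (signMap (susp 𝒱))
        (∑ s, h s ⊗ₜ[k] coefOp c δ (gen (susp 𝒱) (h' s) * a))) := by
  rw [quadPart, LinearMap.sum_apply, map_sum, map_sum, map_sum]
  refine Finset.sum_congr rfl fun s _ => ?_
  rw [LinearMap.smul_apply, map_zsmul, LinearMap.comp_apply, LinearMap.comp_apply,
    LinearMap.mulLeft_apply, LinearMap.mulLeft_apply, coefR_genR_mul, genR_mul_tmul,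
    coefR_proj_comp, LinearMap.rTensor_tmul, signMap_of_mem _ (mem_susp 𝒱 (hdeg s)),
    ← TensorProduct.smul_tmul', map_zsmul, mulGen_tmul]

omit [CharZero k] in
/-- The tensors of the symmetry axiom agree up to a common sign with those that occur in the
quadratic part of `(δ + θ)²`. -/
theorem symmetry_tensor (hδ : Corresponds 𝒱 c δ l) (hdeg' : ∀ s, h' s ∈ 𝒱 (-3 - dh s)) (g : ℕ)
    {m : ℕ} {v : Fin m → V} {d : Fin m → ℤ} (hv : ∀ i, v i ∈ 𝒱 (d i)) :
    ∑ s, ((((m : ℤ) + 2) * dh s).negOnePow : ℤ) •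
        (h s ⊗ₜ[k] l g (m + 1) (Fin.cons (h' s) v : Fin (m + 1) → V)) =
      ((suspExp d + m).negOnePow : ℤ) •
        ∑ s, h s ⊗ₜ[k] coefOp (c g) δ (gen (susp 𝒱) (h' s) * word (susp 𝒱) v) := by
  rw [Finset.smul_sum]
  refine Finset.sum_congr rfl fun s _ => ?_
  have h1 : ∀ (z : ℤ) (x : V), h s ⊗ₜ[k] (z • x) = z • (h s ⊗ₜ[k] x) :=
    map_zsmul (TensorProduct.mk k V V (h s))
  rw [corresponds_iff.1 hδ g (m + 1) _ _ (cons_mem hv (hdeg' s)), gen_mul_word, h1, suspExp_cons,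
    SymBialgebra.negOnePow_smul_smul]
  exact SymBialgebra.negOnePow_smul_congr ⟨dh s - 2 * m, by ring⟩ _

omit [CharZero k] in
/-- By multilinearity, the symmetry axiom need only be tested on homogeneous arguments. -/
theorem symmetryAxiom_iff (hdeg : ∀ s, h s ∈ 𝒱 (dh s)) : SymmetryAxiom 𝒱 h h' dh l ↔
    ∀ (g m : ℕ) (v : Fin m → V) (d : Fin m → ℤ), (∀ i, v i ∈ 𝒱 (d i)) →
      gradedSwap (oddProj (signMap 𝒱))
        (∑ s, ((((m : ℤ) + 2) * dh s).negOnePow : ℤ) •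
          (h s ⊗ₜ[k] l g (m + 1) (Fin.cons (h' s) v : Fin (m + 1) → V)))
      = ∑ s, ((((m : ℤ) + 2) * dh s).negOnePow : ℤ) •
          (h s ⊗ₜ[k] l g (m + 1) (Fin.cons (h' s) v : Fin (m + 1) → V)) := by
  refine ⟨fun hA g m v d _ => hA g m v, fun hA g m v => ?_⟩
  let A : MultilinearMap k (fun _ : Fin m => V) (V ⊗[k] V) :=
    ∑ s, (((((m : ℤ) + 2) * dh s).negOnePow : ℤ) : k) •
      (TensorProduct.mk k V V (h s)).compMultilinearMap ((l g (m + 1)).curryLeft (h' s))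
  have hA' : ∀ v, A v = ∑ s, ((((m : ℤ) + 2) * dh s).negOnePow : ℤ) •
      (h s ⊗ₜ[k] l g (m + 1) (Fin.cons (h' s) v : Fin (m + 1) → V)) := by
    intro v
    simp only [A, sum_apply, smul_apply, Int.cast_smul_eq_zsmul]
    rfl
  have key : (gradedSwap (oddProj (signMap 𝒱))).compMultilinearMap A = A := by
    refine multilinear_ext hdeg fun v d hv => ?_
    rw [LinearMap.compMultilinearMap_apply, hA']
    exact hA g m v d hv
  rw [← hA']
  exact DFunLike.congr_fun key v

theorem quadPart_eq_zero_iff (hc : CoeffSystem t c) (hδ : Corresponds 𝒱 c δ l)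
    (hdeg : ∀ s, h s ∈ 𝒱 (dh s)) (hdeg' : ∀ s, h' s ∈ 𝒱 (-3 - dh s)) :
    t • quadPart h h' dh (projR R (susp 𝒱) 1 ∘ₗ δ) = 0 ↔ SymmetryAxiom 𝒱 h h' dh l := by
  have ht : t • quadPart h h' dh (projR R (susp 𝒱) 1 ∘ₗ δ) = 0 ↔
      quadPart h h' dh (projR R (susp 𝒱) 1 ∘ₗ δ) = 0 := by
    refine ⟨fun h0 => LinearMap.ext fun x => hc.eq_zero fun g => ?_,
      fun h0 => by rw [h0, smul_zero]⟩
    rw [← hc.coefR_t_succ, ← LinearMap.smul_apply, h0, LinearMap.zero_apply, map_zero]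
  have hsym : ∀ (g m : ℕ) (v : Fin m → V) (d : Fin m → ℤ), (∀ i, v i ∈ 𝒱 (d i)) →
      (coefR (susp 𝒱) (c g) (quadPart h h' dh (projR R (susp 𝒱) 1 ∘ₗ δ)
        (1 ⊗ₜ word (susp 𝒱) v)) = 0 ↔ gradedSwap (oddProj (signMap 𝒱))
        (∑ s, ((((m : ℤ) + 2) * dh s).negOnePow : ℤ) •
          (h s ⊗ₜ[k] l g (m + 1) (Fin.cons (h' s) v : Fin (m + 1) → V)))
      = ∑ s, ((((m : ℤ) + 2) * dh s).negOnePow : ℤ) •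
          (h s ⊗ₜ[k] l g (m + 1) (Fin.cons (h' s) v : Fin (m + 1) → V))) := by
    intro g m v d hv
    rw [coefR_quadPart hdeg, mulGen_rTensor_eq_zero_iff, symmetry_tensor hδ hdeg' g hv, map_zsmul,
      neg_one_pow_smul_eq_iff, SymBialgebra.negOnePow_smul_self]
  rw [ht, symmetryAxiom_iff hdeg]
  constructor
  · intro h0 g m v d hv
    rw [← hsym g m v d hv, h0, LinearMap.zero_apply, map_zero]
  · intro hA
    refine extR_hom_ext fun n w d hw => hc.eq_zero fun g => ?_
    have hw' : ∀ i, w i ∈ 𝒱 (d i - 1) := hw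
    exact (hsym g n w _ hw').2 (hA g n w _ hw')

theorem apply_one_eq_zero_iff (hc : CoeffSystem t c) (hcod : IsCoDer (susp 𝒱) 1 (-1) δ)
    (hδ : Corresponds 𝒱 c δ l) :
    δ ((1 : R) ⊗ₜ[k] (1 : Ext (susp 𝒱))) = 0 ↔ ∀ g, l g 0 = 0 := by
  have h1 : δ ((1 : R) ⊗ₜ[k] (1 : Ext (susp 𝒱))) =
      projR R (susp 𝒱) 1 (δ ((1 : R) ⊗ₜ[k] (1 : Ext (susp 𝒱)))) := by
    conv_lhs => rw [hcod.eq_conv]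
    exact SymBialgebra.conv_one _ _
  have h2 : ∀ g (v : Fin 0 → V), l g 0 v = coefOp (c g) δ 1 := by
    intro g v
    rw [corresponds_iff.1 hδ g 0 v Fin.elim0 fun i => i.elim0]
    simp [suspExp, word]
  constructor
  · intro h0 g
    ext v
    rw [h2, coefOp_apply, h0, map_zero]
    rfl
  · intro h0
    rw [h1]
    refine hc.eq_zero fun g => ?_
    rw [← gen_coefW, ← coefOp_apply, ← h2 g Fin.elim0, h0]
    simp

end Axioms

/-! ### The correspondence -/

section Main

variable {k V ι R : Type*} [Field k] [CharZero k] [AddCommGroup V] [Module k V]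
  [Fintype ι] [DecidableEq ι] [CommRing R] [Algebra k R] {𝒱 : ℤ → Submodule k V}
  [DirectSum.Decomposition 𝒱] {B : LinearMap.BilinForm k V} (hB : IsLoopForm 𝒱 B)
  {h h' : Module.Basis ι k V} {dh : ι → ℤ} (hdeg : ∀ s, h s ∈ 𝒱 (dh s))
  (hdual : ∀ s u, B (h' s) (h u) = if s = u then 1 else 0)
  {δ : Module.End R (ExtR R (susp 𝒱))}

include hB hdeg hdual in
theorem proj_one_sq_eq_zero_iff (t : R) (hδ : IsCoDer (susp 𝒱) 1 (-1) δ) :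
    (∀ x, projR R (susp 𝒱) 1 (((δ + theta h h' t) ^ 2 : Module.End R (ExtR R (susp 𝒱))) x) = 0) ↔
      linPart h h' t (projR R (susp 𝒱) 1 ∘ₗ δ) = 0 := by
  rw [sq_eq_conv hB hdeg hdual t hδ, LinearMap.ext_iff]
  refine forall_congr' fun x => ?_
  exact Eq.congr_left ((extBialgebra R (susp 𝒱)).π_one_conv_add (linPart_mem t)
    (fun x => Submodule.smul_mem _ t (quadPart_mem hdeg x)) x)

include hB hdeg hdual in
theorem proj_two_sq_eq_zero_iff (t : R) (hδ : IsCoDer (susp 𝒱) 1 (-1) δ)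
    (h0 : linPart h h' t (projR R (susp 𝒱) 1 ∘ₗ δ) = 0) :
    (∀ x, projR R (susp 𝒱) 2 (((δ + theta h h' t) ^ 2 : Module.End R (ExtR R (susp 𝒱))) x) = 0) ↔
      t • quadPart h h' dh (projR R (susp 𝒱) 1 ∘ₗ δ) = 0 := by
  rw [sq_eq_conv hB hdeg hdual t hδ, LinearMap.ext_iff, h0, zero_add]
  refine forall_congr' fun x => ?_
  exact Eq.congr_left ((extBialgebra R (susp 𝒱)).π_two_conv_quad
    (G := t • quadPart h h' dh (projR R (susp 𝒱) 1 ∘ₗ δ))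
    (fun x => Submodule.smul_mem _ t (quadPart_mem hdeg x)) x)

include hB hdeg hdual in
theorem sq_eq_zero_iff (t : R) (hδ : IsCoDer (susp 𝒱) 1 (-1) δ) :
    (δ + theta h h' t) ^ 2 = 0 ↔ linPart h h' t (projR R (susp 𝒱) 1 ∘ₗ δ) = 0 ∧
      t • quadPart h h' dh (projR R (susp 𝒱) 1 ∘ₗ δ) = 0 := by
  rw [sq_eq_conv hB hdeg hdual t hδ]
  exact (extBialgebra R (susp 𝒱)).conv_add_eq_zero_iff (linPart_mem t)
    (fun x => Submodule.smul_mem _ t (quadPart_mem hdeg x))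

include hB hdeg hdual in
/-- The correspondence over a ring `R` with coefficient functionals, for the class of those
operations whose coordinates are the coefficients of elements of `R`. -/
theorem CoeffSystem.coderivationCorrespondence {t : R} {c : ℕ → R →ₗ[k] k}
    (hc : CoeffSystem t c) {𝒜 : Set (Ops k V)}
    (h𝒜 : ∀ l, l ∈ 𝒜 ↔ ∀ n v s, ∃ r : R, ∀ g, c g r = h.coord s (l g n v)) :
    CoderivationCorrespondence 𝒱 h h' dh R t c 𝒜 := by
  have hdeg' := dual_mem hB hdeg hdual
  have hmem : ∀ δ : Module.End R (ExtR R (susp 𝒱)), opsOf c δ ∈ 𝒜 :=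
    fun δ => (h𝒜 _).2 (opsOf_coeff h δ)
  have hmain : ∀ {δ}, IsCoDer (susp 𝒱) 1 (-1) δ →
      (linPart h h' t (projR R (susp 𝒱) 1 ∘ₗ δ) = 0 ↔ MainIdentity 𝒱 h h' dh (opsOf c δ)) :=
    fun {δ} hδ => linPart_eq_zero_iff hc (isOps_opsOf hδ.2) (corresponds_opsOf c δ) hdeg hdeg'
  have hsymm : ∀ {δ : Module.End R (ExtR R (susp 𝒱))},
      t • quadPart h h' dh (projR R (susp 𝒱) 1 ∘ₗ δ) = 0 ↔
      SymmetryAxiom 𝒱 h h' dh (opsOf c δ) :=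
    fun {δ} => quadPart_eq_zero_iff hc (corresponds_opsOf c δ) hdeg hdeg'
  have hsq : ∀ {δ}, IsCoDer (susp 𝒱) 1 (-1) δ → ((δ + theta h h' t) ^ 2 = 0 ↔
      MainIdentity 𝒱 h h' dh (opsOf c δ) ∧ SymmetryAxiom 𝒱 h h' dh (opsOf c δ)) :=
    fun {δ} hδ => by
      rw [sq_eq_zero_iff hB hdeg hdual t hδ, hmain hδ, hsymm]
  have hinj : ∀ {δ δ'}, IsCoDer (susp 𝒱) 1 (-1) δ → IsCoDer (susp 𝒱) 1 (-1) δ' →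
      opsOf c δ = opsOf c δ' → δ = δ' := fun {δ δ'} hδ hδ' heq =>
    hc.eq_of_corresponds hδ hδ' (corresponds_opsOf c δ) (heq ▸ corresponds_opsOf c δ')
  have hsurj : ∀ {l}, IsOps 𝒱 l → l ∈ 𝒜 → ∃ δ, IsCoDer (susp 𝒱) 1 (-1) δ ∧ opsOf c δ = l := by
    intro l hl hlA
    obtain ⟨δ, hδ, hcor⟩ := exists_corresponds hB hdeg hdual hc hl ((h𝒜 l).1 hlA)
    exact ⟨δ, hδ, corresponds_unique hdeg (corresponds_opsOf c δ) hcor⟩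
  refine ⟨theta h h' t, isTheta_theta hB hdeg hdual t,
    fun θ' hθ' => (isTheta_theta hB hdeg hdual t).unique hθ', ?_, ?_⟩
  · refine ⟨Equiv.ofBijective (fun δ => ⟨opsOf c δ.1,
      ⟨isOps_opsOf δ.2.1.2, ((hsq δ.2.1).1 δ.2.2).1, ((hsq δ.2.1).1 δ.2.2).2⟩, hmem δ.1⟩)
      ⟨fun δ δ' heq => ?_, fun l => ?_⟩, fun δ => corresponds_opsOf c δ.1⟩
    · exact Subtype.ext (hinj δ.2.1 δ'.2.1 (congrArg Subtype.val heq))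
    · obtain ⟨δ, hδ, hl⟩ := hsurj l.2.1.ops l.2.2
      exact ⟨⟨δ, hδ, (hsq hδ).2 ⟨hl.symm ▸ l.2.1.main, hl.symm ▸ l.2.1.symmetry⟩⟩, Subtype.ext hl⟩
  · refine ⟨Equiv.ofBijective (fun δ => ⟨opsOf c δ.1, isOps_opsOf δ.2.2, hmem δ.1⟩)
      ⟨fun δ δ' heq => ?_, fun l => ?_⟩, fun δ => ⟨corresponds_opsOf c δ.1, ?_, fun hA => ?_,
        hsq δ.2, apply_one_eq_zero_iff hc δ.2 (corresponds_opsOf c δ.1)⟩⟩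
    · exact Subtype.ext (hinj δ.2 δ'.2 (congrArg Subtype.val heq))
    · obtain ⟨δ, hδ, hl⟩ := hsurj l.2.1 l.2.2
      exact ⟨⟨δ, hδ⟩, Subtype.ext hl⟩
    · rw [proj_one_sq_eq_zero_iff hB hdeg hdual t δ.2, hmain δ.2]
      rfl
    · rw [proj_two_sq_eq_zero_iff hB hdeg hdual t δ.2 ((hmain δ.2).2 hA), hsymm]
      rfl

end Main

section Instances

variable {k : Type*} [Field k]

theorem coeffSystem_polynomial :
    CoeffSystem (Polynomial.X : Polynomial k) (fun g => Polynomial.lcoeff k g) where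
  ext r hr := Polynomial.ext fun g => by simpa using hr g
  mul g r r' := by simp [Polynomial.coeff_mul]
  t_zero r := by simp
  t_succ g r := by simp [Polynomial.coeff_X_mul]

theorem coeffSystem_powerSeries :
    CoeffSystem (PowerSeries.X : PowerSeries k) (fun g => PowerSeries.coeff g) where
  ext r hr := PowerSeries.ext fun g => by simpa using hr g
  mul g r r' := by rw [PowerSeries.coeff_mul]
  t_zero r := by simp
  t_succ g r := by simp [PowerSeries.coeff_succ_X_mul]

/-- A family of operations with finitely many nonzero members in each arity is a family of
operations with polynomial coordinates. -/
theorem finite_iff_exists_polynomial {V ι : Type*} [AddCommGroup V] [Module k V] [Finite ι]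
    (h : Module.Basis ι k V) (l : Ops k V) : (∀ n, {g | l g n ≠ 0}.Finite) ↔
      ∀ n v s, ∃ r : Polynomial k, ∀ g, Polynomial.lcoeff k g r = h.coord s (l g n v) := by
  constructor
  · intro hl n v s
    refine ⟨∑ g ∈ (hl n).toFinset, Polynomial.monomial g (h.coord s (l g n v)), fun g => ?_⟩
    rw [Polynomial.lcoeff_apply, Polynomial.finsetSum_coeff]
    simp only [Polynomial.coeff_monomial]
    rw [Finset.sum_ite_eq' (hl n).toFinset g]
    split_ifs with hg
    · rfl
    · have h0 : l g n = 0 := by simpa using hg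
      rw [h0]
      simp
  · intro hl n
    choose r hr using hl n
    refine (Set.finite_iUnion fun p : (Fin n → ι) × ι =>
      (r (fun i => h (p.1 i)) p.2).support.finite_toSet).subset fun g hg => ?_
    by_contra hnot
    refine hg (Module.Basis.ext_multilinear (fun _ => h) fun j => ?_)
    refine h.ext_elem fun s => ?_
    have h1 : (r (fun i => h (j i)) s).coeff g = 0 := by
      by_contra h2
      exact hnot (Set.mem_iUnion.2 ⟨(j, s), by simpa using h2⟩)
    have h2 := hr (fun i => h (j i)) s g
    rw [Polynomial.lcoeff_apply, h1] at h2
    simpa using h2.symm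

end Instances

end LoopLie

end

theorem theorem4p2 {k V ι : Type*} [Field k] [CharZero k] [AddCommGroup V] [Module k V]
    [Fintype ι] [DecidableEq ι]
    (𝒱 : ℤ → Submodule k V) [DirectSum.Decomposition 𝒱]
    (B : LinearMap.BilinForm k V) (hB : LoopLie.IsLoopForm 𝒱 B)
    (h h' : Module.Basis ι k V) (dh : ι → ℤ) (hdeg : ∀ s, h s ∈ 𝒱 (dh s))
    (hdual : ∀ s u, B (h' s) (h u) = if s = u then 1 else 0) :
    LoopLie.CoderivationCorrespondence 𝒱 h h' dh (Polynomial k) Polynomial.X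
        (fun g => Polynomial.lcoeff k g)
        {l : LoopLie.Ops k V | ∀ n, {g | l g n ≠ 0}.Finite} ∧
      LoopLie.CoderivationCorrespondence 𝒱 h h' dh (PowerSeries k) PowerSeries.X
        (fun g => PowerSeries.coeff g)
        Set.univ :=
  ⟨LoopLie.coeffSystem_polynomial.coderivationCorrespondence hB hdeg hdual
      (LoopLie.finite_iff_exists_polynomial h),
    LoopLie.coeffSystem_powerSeries.coderivationCorrespondence hB hdeg hdual
      fun l => ⟨fun _ n v s => ⟨PowerSeries.mk fun g => h.coord s (l g n v), fun g => by simp⟩,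
        fun _ => trivial⟩⟩
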